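/- **Conventions.** A *Picard groupoid* is a symmetric monoidal groupoid $(\mathcal P,+,0)$ in which every functor $x+(-)$ is an equivalence. Triangulated categories and Picard groupoids are small. *Determinant functors.* A determinant functor $D\colon\mathcal T\to\mathcal P$ on a triangulated category is a functor $\mathrm{isom}(\mathcal T)\to\mathcal P$ with a morphism $D(\Delta)\colon D(z)+D(x)\to D(y)$ for every distinguished triangle $\Delta\colon x\to y\to z\to\Sigma x$, natural for isomorphisms of triangles and satisfying the commutativity axiom (for the two split triangles on $x\oplus y$) and the associativity (octahedron) axiom. A multi-determinant functor $E\colon\mathcal T_1\times\dots\times\mathcal T_n\to\mathcal P$ is a functor $\mathrm{isom}(\mathcal T_1)\times\dots\times\mathrm{isom}(\mathcal T_n)\to\mathcal P$ that is a determinant functor in each variable, such that the additivity morphisms in one variable are natural for isomorphisms in the other variables, and such that for distinguished triangles in two different variables the two ways $(E(z,z')+E(x,z'))+(E(z,x')+E(x,x'))\to E(y,y')$ (first variable first, or second variable first after the canonical isomorphism $(A+B)+(C+D)\cong(A+C)+(B+D)$) agree. Morphisms are natural transformations compatible with the additivity morphisms in each variable. A determinant functor $\det\colon\mathcal T\to V(\mathcal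 T)$ is *universal* if for every determinant functor $D\colon\mathcal T\to\mathcal P'$ there is a pair $(f,\tau)$ of a symmetric monoidal functor $f\colon V(\mathcal T)\to\mathcal P'$ and a morphism of determinant functors $\tau\colon f\circ\det\Rightarrow D$ such that for every other such pair $(f',\tau')$ there is a unique monoidal natural transformation $\beta\colon f\Rightarrow f'$ with $\tau'\circ(\beta*\det)=\tau$. *Multiexact functors.* A functor $d\colon\mathcal P_1\times\dots\times\mathcal P_n\to\mathcal P$ of Picard groupoids is multiexact if it is symmetric monoidal in each variable, naturally in the others, and for any two variables the two isomorphisms between $d(a+b,c+e)$ and the sum of the four values $d(a,c),d(a,e),d(b,c),d(b,e)$ agree up to the canonical isomorphism above; its natural transformations are those that are monoidal in each variable. A functor $F\colon\mathcal T_1\times\dots\times\mathcal T_n\to\mathcal T_0$ of triangulated categories is multiexact if it is triangulated in each variable, with isomorphisms $F(\dots,\Sigma x,\dots)\cong\Sigma F(\dots,x,\dots)$ natural in all variables, and for any two variables the two resulting isomorphisms $F(\Sigma x,\Sigma y)\cong\Sigma^2F(x,y)$ differ by the sign $-1$; its natural transformations are those compatible with these isomorphisms in each variable. *Verdier structures.*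 Let a $3\times3$ diagram have rows $x'\xrightarrow{f'}y'\xrightarrow{g'}z'\xrightarrow{h'}\Sigma x'$, $x\xrightarrow{f}y\xrightarrow{g}z\xrightarrow{h}\Sigma x$, $x''\xrightarrow{f''}y''\xrightarrow{g''}z''\xrightarrow{h''}\Sigma x''$ and columns $x'\xrightarrow{p'}x\xrightarrow{p}x''\xrightarrow{p''}\Sigma x'$, $y'\xrightarrow{q'}y\xrightarrow{q}y''\xrightarrow{q''}\Sigma y'$, $z'\xrightarrow{r'}z\xrightarrow{r}z''\xrightarrow{r''}\Sigma z'$, all of them distinguished triangles, with $fp'=q'f'$. It admits a Verdier structure if there are a distinguished triangle $x'\xrightarrow{fp'}y\xrightarrow{\alpha}A\xrightarrow{v}\Sigma x'$, an octahedron on $f\circ p'$ with new triangle $x''\xrightarrow{\epsilon}A\xrightarrow{\eta}z\xrightarrow{\Sigma p\circ h}\Sigma x''$, an octahedron on $q'\circ f'$ with new triangle $z'\xrightarrow{\beta}A\xrightarrow{\gamma}y''\xrightarrow{\Sigma g'\circ q''}\Sigma z'$ (both using the above triangle with third vertex $A$), with $\gamma\epsilon=f''$ and $\eta\beta=r'$,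 and an octahedron on $\gamma\circ\epsilon$, using the rotated triangle $A\xrightarrow{\gamma}y''\to\Sigma z'\xrightarrow{-\Sigma\beta}\Sigma A$ and the third row, with new triangle $z\xrightarrow{r}z''\xrightarrow{r''}\Sigma z'\xrightarrow{-\Sigma r'}\Sigma z$. A multiexact $F$ admits a Verdier structure if for all $i<j$ and all distinguished triangles in $\mathcal T_i$ and $\mathcal T_j$ (the other variables being fixed) the induced $3\times3$ diagram, whose rows come from $\mathcal T_i$ and columns from $\mathcal T_j$, admits one. **Theorem.** Let $\mathcal T_0,\mathcal T_1,\dots,\mathcal T_n$ be triangulated categories, $\mathcal P$ a Picard groupoid, $\det\colon\mathcal T_i\to V(\mathcal T_i)$ $(1\le i\le n)$ universal determinant functors, $D\colon\mathcal T_0\to\mathcal P$ a determinant functor, $F_1,F_2\colon\mathcal T_1\times\dots\times\mathcal T_n\to\mathcal T_0$ multiexact functors that admit Verdier structures, and $\alpha\colon F_1\Rightarrow F_2$ a natural isomorphism of multiexact functors. Then: 1. $D\circ F_1$ and $D\circ F_2$ are multi-determinant functors and $D*\alpha\colon D\circ F_1\Rightarrow D\circ F_2$ is a morphism of multi-determinant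 functors. 2. For $k=1,2$ there is a pair $(\overline{D\circ F_k},a_k)$ of a multiexact functor $\overline{D\circ F_k}\colon V(\mathcal T_1)\times\dots\times V(\mathcal T_n)\to\mathcal P$ and a natural transformation $a_k\colon\overline{D\circ F_k}\circ\det\Rightarrow D\circ F_k$ compatible with additivity, which is universal: for any other such pair $(g,b)$ there is a unique natural transformation of multiexact functors $\gamma\colon\overline{D\circ F_k}\Rightarrow g$ with $a_k=b\circ(\gamma*\det)$. 3. For any pairs $(\overline{D\circ F_1},a_1)$ and $(\overline{D\circ F_2},a_2)$ as in 2 (universal or not), there is a unique natural transformation of multiexact functors $\overline{D*\alpha}\colon\overline{D\circ F_2}\Rightarrow\overline{D\circ F_1}$ with $a_2=(D*\alpha)\circ a_1\circ(\overline{D*\alpha}*\det)$. -/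

import Mathlib

open CategoryTheory CategoryTheory.Limits CategoryTheory.Pretriangulated
  CategoryTheory.Triangulated CategoryTheory.MonoidalCategory

universe u v w u₀ v₀

noncomputable section

namespace MultiDeterminant

/-! ### Functors of several variables: freezing all variables but one -/

section Slots

variable {n : ℕ} {C : Fin n → Type u} [∀ i, Category.{v} (C i)]

/-- Morphisms `φ j : a j ⟶ b j` for `j ≠ i` together with a morphism `f : x ⟶ y` in the `i`-th
category induce a morphism between the families in which the `i`-th entry is replaced by
`x`, resp. `y`: it is `f` at `i` and `φ j` at `j ≠ i`. -/
def updHom {a b : ∀ j, C j} (i : Fin n) (φ : ∀ j, j ≠ i → (a j ⟶ b j)) {x y : C i}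
    (f : x ⟶ y) : (Function.update a i x : ∀ j, C j) ⟶ Function.update b i y := fun j => by
  by_cases h : j = i
  · subst h
    exact eqToHom (Function.update_self j x a) ≫ f ≫
      eqToHom (Function.update_self j y b).symm
  · exact eqToHom (Function.update_of_ne h x a) ≫ φ j h ≫
      eqToHom (Function.update_of_ne h y b).symm

lemma updHom_id (a : ∀ j, C j) (i : Fin n) (x : C i) :
    updHom i (fun j _ => 𝟙 (a j)) (𝟙 x) = 𝟙 (Function.update a i x : ∀ j, C j) := by
  funext j
  by_cases h : j = i
  · subst h
    simp [updHom]
  · simp [updHom, h]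

lemma updHom_comp {a b c : ∀ j, C j} (i : Fin n) (φ : ∀ j, j ≠ i → (a j ⟶ b j))
    (ψ : ∀ j, j ≠ i → (b j ⟶ c j)) {x y z : C i} (f : x ⟶ y) (g : y ⟶ z) :
    updHom i (fun j h => φ j h ≫ ψ j h) (f ≫ g) = updHom i φ f ≫ updHom i ψ g := by
  funext j
  by_cases h : j = i
  · subst h
    simp [updHom]
  · simp [updHom, h]

/-- The functor `x ↦ (a_1, …, a_{i-1}, x, a_{i+1}, …, a_n)`. -/
@[simps]
def slot (a : ∀ j, C j) (i : Fin n) : C i ⥤ ∀ j, C j where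
  obj x := Function.update a i x
  map f := updHom i (fun j _ => 𝟙 (a j)) f
  map_id x := updHom_id a i x
  map_comp f g := by
    rw [← updHom_comp]
    simp only [Category.comp_id]

/-- Morphisms in the variables other than the `i`-th induce a natural transformation between
the corresponding functors of the `i`-th variable. (In particular, these functors do not depend
on the `i`-th entry of the family.) -/
@[simps]
def slotMap {a b : ∀ j, C j} (i : Fin n) (φ : ∀ j, j ≠ i → (a j ⟶ b j)) :
    slot a i ⟶ slot b i where
  app x := updHom i φ (𝟙 x)
  naturality x y f := by
    change updHom i (fun j _ => 𝟙 (a j)) f ≫ updHom i φ (𝟙 y) =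
      updHom i φ (𝟙 x) ≫ updHom i (fun j _ => 𝟙 (b j)) f
    rw [← updHom_comp, ← updHom_comp]
    simp only [Category.comp_id, Category.id_comp]

/-- Isomorphisms in the variables other than the `i`-th induce a natural isomorphism between
the corresponding functors of the `i`-th variable. -/
@[simps]
def slotIso {a b : ∀ j, C j} (i : Fin n) (φ : ∀ j, j ≠ i → (a j ≅ b j)) :
    slot a i ≅ slot b i where
  hom := slotMap i fun j h => (φ j h).hom
  inv := slotMap i fun j h => (φ j h).inv
  hom_inv_id := by
    ext x : 2
    change updHom i (fun j h => (φ j h).hom) (𝟙 x) ≫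
      updHom i (fun j h => (φ j h).inv) (𝟙 x) = 𝟙 _
    rw [← updHom_comp]
    simp only [Category.comp_id, Iso.hom_inv_id]
    exact updHom_id a i x
  inv_hom_id := by
    ext x : 2
    change updHom i (fun j h => (φ j h).inv) (𝟙 x) ≫
      updHom i (fun j h => (φ j h).hom) (𝟙 x) = 𝟙 _
    rw [← updHom_comp]
    simp only [Category.comp_id, Iso.inv_hom_id]
    exact updHom_id b i x

/-- The identification of the two ways to put `x` at the place `i` and `y` at the place `j`;
the two families are equal, and this is the identity morphism. -/
def swap {i j : Fin n} (hij : i ≠ j) (a : ∀ k, C k) (x : C i) (y : C j) :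
    (Function.update (Function.update a i x) j y : ∀ k, C k) ≅
      Function.update (Function.update a j y) i x :=
  eqToIso (Function.update_comm hij x y a)

end Slots

/-! ### Picard groupoids and their multiexact functors -/

/-- A symmetric monoidal category is a Picard groupoid if it is a groupoid and every functor
`x ⊗ -` is an equivalence. -/
class PicardGroupoid (P : Type w) [Category.{w} P] [MonoidalCategory P]
    [SymmetricCategory P] : Prop extends IsGroupoid P where
  isEquivalence_tensorLeft : ∀ x : P, (tensorLeft x).IsEquivalence

section Pic

variable {n : ℕ} (V : Fin n → Type w) [∀ i, Category.{w} (V i)]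
  [∀ i, MonoidalCategory (V i)] [∀ i, SymmetricCategory (V i)]
  (P : Type w) [Category.{w} P] [MonoidalCategory P] [SymmetricCategory P]

/-- A functor of `n` variables which is symmetric monoidal in each variable, naturally in
the others. -/
structure PreMultiexactPic where
  toFunctor : (∀ i, V i) ⥤ P
  braided : ∀ (a : ∀ i, V i) (i : Fin n), (slot a i ⋙ toFunctor).Braided
  natural : ∀ {a b : ∀ i, V i} (i : Fin n) (φ : ∀ j, j ≠ i → (a j ⟶ b j)),
    letI := braided a i
    letI := braided b i
    NatTrans.IsMonoidal (Functor.whiskerRight (slotMap i φ) toFunctor)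

attribute [instance] PreMultiexactPic.braided

variable {V P}

namespace PreMultiexactPic

variable (F : PreMultiexactPic V P)

/-- The value of `F` with `x` at the place `i` and `y` at the place `j`. -/
abbrev obj₂ (a : ∀ k, V k) (i j : Fin n) (x : V i) (y : V j) : P :=
  F.toFunctor.obj (Function.update (Function.update a i x) j y)

/-- The structure morphism `F(x, y) + F(x', y) ⟶ F(x + x', y)`. -/
def sumFst {i j : Fin n} (hij : i ≠ j) (a : ∀ k, V k) (x x' : V i) (y : V j) :
    F.obj₂ a i j x y ⊗ F.obj₂ a i j x' y ⟶ F.obj₂ a i j (x ⊗ x') y :=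
  (F.toFunctor.map (swap hij a x y).hom ⊗ₘ F.toFunctor.map (swap hij a x' y).hom) ≫
    Functor.LaxMonoidal.μ (slot (Function.update a j y) i ⋙ F.toFunctor) x x' ≫
    F.toFunctor.map (swap hij a (x ⊗ x') y).inv

/-- The structure morphism `F(x, y) + F(x, y') ⟶ F(x, y + y')`. -/
def sumSnd (i j : Fin n) (a : ∀ k, V k) (x : V i) (y y' : V j) :
    F.obj₂ a i j x y ⊗ F.obj₂ a i j x y' ⟶ F.obj₂ a i j x (y ⊗ y') :=
  Functor.LaxMonoidal.μ (slot (Function.update a i x) j ⋙ F.toFunctor) y y'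

end PreMultiexactPic

variable (V P)

/-- A multiexact functor `V_1 × ⋯ × V_n ⟶ P` of Picard groupoids: a functor which is symmetric
monoidal in each variable and for which the two ways to decompose `F(a + b, c + d)`,
for any pair of variables, agree up to the canonical isomorphism
`(A + B) + (C + D) ≅ (A + C) + (B + D)`. -/
structure MultiexactPic extends PreMultiexactPic V P where
  interchange : ∀ {i j : Fin n} (hij : i ≠ j) (e : ∀ k, V k) (a b : V i) (c d : V j),
    (toPreMultiexactPic.sumSnd i j e a c d ⊗ₘ toPreMultiexactPic.sumSnd i j e b c d) ≫
      toPreMultiexactPic.sumFst hij e a b (c ⊗ d) =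
    tensorμ (toPreMultiexactPic.obj₂ e i j a c) (toPreMultiexactPic.obj₂ e i j a d)
        (toPreMultiexactPic.obj₂ e i j b c) (toPreMultiexactPic.obj₂ e i j b d) ≫
      (toPreMultiexactPic.sumFst hij e a b c ⊗ₘ toPreMultiexactPic.sumFst hij e a b d) ≫
      toPreMultiexactPic.sumSnd i j e (a ⊗ b) c d

variable {V P}

/-- A natural transformation between multiexact functors of Picard groupoids is monoidal if it
is monoidal in each variable. -/
def MultiexactPic.IsMonoidal {F G : MultiexactPic V P} (β : F.toFunctor ⟶ G.toFunctor) : Prop :=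
  ∀ (a : ∀ i, V i) (i : Fin n), NatTrans.IsMonoidal (Functor.whiskerLeft (slot a i) β)

end Pic

/-! ### Determinant functors -/

section Det

variable (T : Type u) [Category.{v} T] [HasZeroObject T] [Preadditive T] [HasShift T ℤ]
  [∀ k : ℤ, (shiftFunctor T k).Additive] [Pretriangulated T]
  (P : Type w) [Category.{w} P] [MonoidalCategory P]

/-- The data of a determinant functor: a functor on the isomorphisms of `T`, and for each
distinguished triangle `x ⟶ y ⟶ z ⟶ Σ x` a morphism `D z + D x ⟶ D y`. -/
structure PreDet where
  toFunctor : Core T ⥤ P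
  add : ∀ Δ : Triangle T, Δ ∈ distTriang T →
    (toFunctor.obj ⟨Δ.obj₃⟩ ⊗ toFunctor.obj ⟨Δ.obj₁⟩ ⟶ toFunctor.obj ⟨Δ.obj₂⟩)

variable {T P}

namespace PreDet

/-- The value at an object. -/
abbrev obj (D : PreDet T P) (x : T) : P := D.toFunctor.obj ⟨x⟩

/-- The value at an isomorphism. -/
abbrev map (D : PreDet T P) {x y : T} (e : x ≅ y) : D.obj x ⟶ D.obj y :=
  D.toFunctor.map (CoreHom.mk (X := ⟨x⟩) (Y := ⟨y⟩) e)

end PreDet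

/-- The triangle `y ⟶ x ⊞ y ⟶ x ⟶ Σ y` given by the second injection and the first
projection. -/
def biproductTriangle' (x y : T) : Triangle T :=
  Triangle.mk (biprod.inr : y ⟶ x ⊞ y) biprod.fst 0

lemma biproductTriangle'_distinguished (x y : T) : biproductTriangle' x y ∈ distTriang T :=
  isomorphic_distinguished _ (binaryBiproductTriangle_distinguished y x) _
    (Triangle.isoMk _ _ (Iso.refl _) (biprod.braiding x y) (Iso.refl _)
      (by change biprod.inr ≫ (biprod.braiding x y).hom = 𝟙 y ≫ biprod.inl; ext <;> simp)
      (by change biprod.fst ≫ 𝟙 x = (biprod.braiding x y).hom ≫ biprod.snd; simp)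
      (by change (0 : x ⟶ y⟦(1 : ℤ)⟧) ≫ (shiftFunctor T (1 : ℤ)).map (𝟙 y) = 𝟙 x ≫ 0; simp))

/-- The axioms of a determinant functor. -/
structure PreDet.IsDet [SymmetricCategory P] (D : PreDet T P) : Prop where
  /-- The additivity morphisms are natural with respect to isomorphisms of distinguished
  triangles. -/
  natural : ∀ {Δ Δ' : Triangle T} (hΔ : Δ ∈ distTriang T) (hΔ' : Δ' ∈ distTriang T)
    (e : Δ ≅ Δ'),
    D.add Δ hΔ ≫ D.map (Triangle.π₂.mapIso e) =
      (D.map (Triangle.π₃.mapIso e) ⊗ₘ D.map (Triangle.π₁.mapIso e)) ≫ D.add Δ' hΔ'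
  commutativity : ∀ x y : T,
    D.add (biproductTriangle' x y) (biproductTriangle'_distinguished x y) =
      (β_ (D.obj x) (D.obj y)).hom ≫
        D.add (binaryBiproductTriangle x y) (binaryBiproductTriangle_distinguished x y)
  octahedron : ∀ {x y z z' x' y' : T} {u₁₂ : x ⟶ y} {u₂₃ : y ⟶ z} {u₁₃ : x ⟶ z}
    {comm : u₁₂ ≫ u₂₃ = u₁₃}
    {v₁₂ : y ⟶ z'} {w₁₂ : z' ⟶ x⟦(1 : ℤ)⟧} {h₁₂ : Triangle.mk u₁₂ v₁₂ w₁₂ ∈ distTriang T}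
    {v₂₃ : z ⟶ x'} {w₂₃ : x' ⟶ y⟦(1 : ℤ)⟧} {h₂₃ : Triangle.mk u₂₃ v₂₃ w₂₃ ∈ distTriang T}
    {v₁₃ : z ⟶ y'} {w₁₃ : y' ⟶ x⟦(1 : ℤ)⟧} {h₁₃ : Triangle.mk u₁₃ v₁₃ w₁₃ ∈ distTriang T}
    (O : Octahedron comm h₁₂ h₂₃ h₁₃),
    (D.add _ O.mem ▷ D.obj x) ≫ D.add _ h₁₃ =
      (α_ (D.obj x') (D.obj z') (D.obj x)).hom ≫ (D.obj x' ◁ D.add _ h₁₂) ≫ D.add _ h₂₃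

variable (T P) in
/-- Determinant functors `T ⟶ P`. -/
structure DetFunctor [SymmetricCategory P] extends PreDet T P where
  isDet : toPreDet.IsDet

/-- A natural transformation is a morphism of determinant functors if it is compatible with
the additivity data. -/
def PreDet.IsHom {D D' : PreDet T P} (τ : D.toFunctor ⟶ D'.toFunctor) : Prop :=
  ∀ (Δ : Triangle T) (hΔ : Δ ∈ distTriang T),
    D.add Δ hΔ ≫ τ.app ⟨Δ.obj₂⟩ = (τ.app ⟨Δ.obj₃⟩ ⊗ₘ τ.app ⟨Δ.obj₁⟩) ≫ D'.add Δ hΔ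

/-- The composite `f ∘ D` with a (lax) monoidal functor `f`. -/
def PreDet.compFunctor {P' : Type w} [Category.{w} P'] [MonoidalCategory P'] (D : PreDet T P)
    (f : P ⥤ P') [f.LaxMonoidal] : PreDet T P' where
  toFunctor := D.toFunctor ⋙ f
  add Δ hΔ := Functor.LaxMonoidal.μ f _ _ ≫ f.map (D.add Δ hΔ)

/-- A pair `(f, α)` of a symmetric monoidal functor `f : P ⟶ P'` and a natural transformation
`α : f ∘ det ⟶ D` which is compatible with the additivity data. -/
structure Factorization {P' : Type w} [Category.{w} P'] [MonoidalCategory P']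
    [SymmetricCategory P] [SymmetricCategory P'] (det : PreDet T P) (D : PreDet T P') where
  functor : P ⥤ P'
  braided : functor.Braided
  trans : det.toFunctor ⋙ functor ⟶ D.toFunctor
  isHom : PreDet.IsHom (D := det.compFunctor functor) (D' := D) trans

attribute [instance] Factorization.braided

/-- A determinant functor `det : T ⟶ V` is universal if each determinant functor `D` on `T`
admits a pair `(f, α)` as above which has a unique (monoidal) natural transformation `β` to
any other such pair `(f', α')` with `α' ∘ (β * det) = α`. -/
def DetFunctor.IsUniversal [SymmetricCategory P] (det : DetFunctor T P) : Prop :=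
  ∀ (P' : Type w) [Category.{w} P'] [MonoidalCategory P'] [SymmetricCategory P']
    [PicardGroupoid P'] (D : DetFunctor T P'),
    ∃ c : Factorization det.toPreDet D.toPreDet,
      ∀ c' : Factorization det.toPreDet D.toPreDet,
        ∃! β : c.functor ⟶ c'.functor,
          NatTrans.IsMonoidal β ∧ Functor.whiskerLeft det.toFunctor β ≫ c'.trans = c.trans

end Det

/-! ### Multi-determinant functors -/

section MultiDet

variable {n : ℕ} (T : Fin n → Type u) [∀ i, Category.{v} (T i)] [∀ i, HasZeroObject (T i)]
  [∀ i, Preadditive (T i)] [∀ i, HasShift (T i) ℤ]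
  [∀ i, ∀ k : ℤ, (shiftFunctor (T i) k).Additive] [∀ i, Pretriangulated (T i)]
  (P : Type w) [Category.{w} P] [MonoidalCategory P]

/-- The data of a multi-determinant functor: a functor on `isom(T_1) × ⋯ × isom(T_n)`, which is
the category of isomorphisms of `T_1 × ⋯ × T_n`, with additivity data in each variable. -/
structure PreMultiDet where
  toFunctor : Core (∀ i, T i) ⥤ P
  add : ∀ (a : ∀ i, T i) (i : Fin n) (Δ : Triangle (T i)), Δ ∈ distTriang (T i) →
    (toFunctor.obj ⟨Function.update a i Δ.obj₃⟩ ⊗ toFunctor.obj ⟨Function.update a i Δ.obj₁⟩ ⟶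
      toFunctor.obj ⟨Function.update a i Δ.obj₂⟩)

variable {T P}

namespace PreMultiDet

variable (E : PreMultiDet T P)

/-- The determinant data in the `i`-th variable, the other variables being fixed. -/
def restrict (a : ∀ i, T i) (i : Fin n) : PreDet (T i) P where
  toFunctor := (slot a i).core ⋙ E.toFunctor
  add := E.add a i

/-- The value of `E` with `x` at the place `i` and `y` at the place `j`. -/
abbrev obj₂ (a : ∀ k, T k) (i j : Fin n) (x : T i) (y : T j) : P :=
  E.toFunctor.obj ⟨Function.update (Function.update a i x) j y⟩

/-- The additivity morphism `E(z, y) + E(x, y) ⟶ E(y', y)` for a triangle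
`x ⟶ y' ⟶ z ⟶ Σ x` in the `i`-th variable and an object `y` in the `j`-th variable. -/
def addFst {i j : Fin n} (hij : i ≠ j) (a : ∀ k, T k) (Δ : Triangle (T i))
    (hΔ : Δ ∈ distTriang (T i)) (y : T j) :
    E.obj₂ a i j Δ.obj₃ y ⊗ E.obj₂ a i j Δ.obj₁ y ⟶ E.obj₂ a i j Δ.obj₂ y :=
  (E.toFunctor.map (CoreHom.mk (swap hij a Δ.obj₃ y)) ⊗ₘ
      E.toFunctor.map (CoreHom.mk (swap hij a Δ.obj₁ y))) ≫
    E.add (Function.update a j y) i Δ hΔ ≫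
    E.toFunctor.map (CoreHom.mk (swap hij a Δ.obj₂ y).symm)

/-- The additivity morphism `E(x, z) + E(x, x') ⟶ E(x, y)` for an object `x` in the `i`-th
variable and a triangle `x' ⟶ y ⟶ z ⟶ Σ x'` in the `j`-th variable. -/
def addSnd (i j : Fin n) (a : ∀ k, T k) (x : T i) (Δ : Triangle (T j))
    (hΔ : Δ ∈ distTriang (T j)) :
    E.obj₂ a i j x Δ.obj₃ ⊗ E.obj₂ a i j x Δ.obj₁ ⟶ E.obj₂ a i j x Δ.obj₂ :=
  E.add (Function.update a i x) j Δ hΔ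

/-- The axioms of a multi-determinant functor. -/
structure IsMultiDet [SymmetricCategory P] : Prop where
  isDet : ∀ (a : ∀ i, T i) (i : Fin n), (E.restrict a i).IsDet
  twoTriangles : ∀ {i j : Fin n} (hij : i ≠ j) (a : ∀ k, T k)
    (Δ : Triangle (T i)) (hΔ : Δ ∈ distTriang (T i))
    (Δ' : Triangle (T j)) (hΔ' : Δ' ∈ distTriang (T j)),
    (E.addFst hij a Δ hΔ Δ'.obj₃ ⊗ₘ E.addFst hij a Δ hΔ Δ'.obj₁) ≫
        E.addSnd i j a Δ.obj₂ Δ' hΔ' =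
      tensorμ (E.obj₂ a i j Δ.obj₃ Δ'.obj₃) (E.obj₂ a i j Δ.obj₁ Δ'.obj₃)
          (E.obj₂ a i j Δ.obj₃ Δ'.obj₁) (E.obj₂ a i j Δ.obj₁ Δ'.obj₁) ≫
        (E.addSnd i j a Δ.obj₃ Δ' hΔ' ⊗ₘ E.addSnd i j a Δ.obj₁ Δ' hΔ') ≫
        E.addFst hij a Δ hΔ Δ'.obj₂
  /-- Compatibility of the additivity morphisms in the `j`-th variable with isomorphisms in the
  other variables. -/
  triangleFunction : ∀ {a b : ∀ k, T k} (j : Fin n) (φ : ∀ k, k ≠ j → (a k ≅ b k)),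
    PreDet.IsHom (D := E.restrict a j) (D' := E.restrict b j)
      (Functor.whiskerRight (slotIso j φ).core.hom E.toFunctor)

variable {E}

/-- A natural transformation is a morphism of multi-determinant functors if it is compatible
with the additivity data in each variable. -/
def IsHom {E' : PreMultiDet T P} (τ : E.toFunctor ⟶ E'.toFunctor) : Prop :=
  ∀ (a : ∀ i, T i) (i : Fin n), PreDet.IsHom (D := E.restrict a i) (D' := E'.restrict a i)
    (Functor.whiskerLeft (slot a i).core τ)

end PreMultiDet

section Pairs

variable [SymmetricCategory P]
  {V : Fin n → Type w} [∀ i, Category.{w} (V i)]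
  [∀ i, MonoidalCategory (V i)] [∀ i, SymmetricCategory (V i)]
  (det : ∀ i, DetFunctor (T i) (V i))

/-- The product `isom(T_1) × ⋯ × isom(T_n) ⟶ V_1 × ⋯ × V_n` of determinant functors. -/
def prodDet : Core (∀ i, T i) ⥤ ∀ i, V i :=
  Functor.pi' fun i => (Pi.eval T i).core ⋙ (det i).toFunctor

/-- `prodDet` takes the family with `x` at the place `i` to the family with `det x` at the
place `i`; the two families are equal, and this is the identity morphism. -/
def prodDetUpdate (a : ∀ i, T i) (i : Fin n) (x : T i) :
    (prodDet det).obj ⟨Function.update a i x⟩ ≅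
      Function.update ((prodDet det).obj ⟨a⟩) i ((det i).obj x) :=
  eqToIso (funext fun k => Function.apply_update (fun l y => (det l).obj y) a i x k)

/-- The composite `d ∘ (det_1 × ⋯ × det_n)` for a multiexact functor `d`. -/
def compProdDet (d : MultiexactPic V P) : PreMultiDet T P where
  toFunctor := prodDet det ⋙ d.toFunctor
  add a i Δ hΔ :=
    (d.toFunctor.map (prodDetUpdate det a i Δ.obj₃).hom ⊗ₘ
        d.toFunctor.map (prodDetUpdate det a i Δ.obj₁).hom) ≫
      Functor.LaxMonoidal.μ (slot ((prodDet det).obj ⟨a⟩) i ⋙ d.toFunctor)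
        ((det i).obj Δ.obj₃) ((det i).obj Δ.obj₁) ≫
      (slot ((prodDet det).obj ⟨a⟩) i ⋙ d.toFunctor).map ((det i).add Δ hΔ) ≫
      d.toFunctor.map (prodDetUpdate det a i Δ.obj₂).inv

/-- A pair `(d, τ)` of a multiexact functor `d : V_1 × ⋯ × V_n ⟶ P` and a natural transformation
`τ : d ∘ det ⟶ E` compatible with the additivity data. -/
structure InducedPair (E : PreMultiDet T P) where
  functor : MultiexactPic V P
  trans : prodDet det ⋙ functor.toFunctor ⟶ E.toFunctor
  isHom : PreMultiDet.IsHom (E := compProdDet det functor) (E' := E) trans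

/-- The pair `(d, τ)` is universal if for any other pair `(g, σ)` there is a unique
(monoidal) natural transformation `γ : d ⟶ g` with `τ = σ ∘ (γ * det)`. -/
def InducedPair.IsUniversal {det : ∀ i, DetFunctor (T i) (V i)} {E : PreMultiDet T P}
    (c : InducedPair det E) : Prop :=
  ∀ c' : InducedPair det E, ∃! γ : c.functor.toFunctor ⟶ c'.functor.toFunctor,
    MultiexactPic.IsMonoidal (F := c.functor) (G := c'.functor) γ ∧
      Functor.whiskerLeft (prodDet det) γ ≫ c'.trans = c.trans

end Pairs

end MultiDet

/-! ### Verdier structures -/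

section Verdier

variable (S : Type u) [Category.{v} S] [HasZeroObject S] [Preadditive S] [HasShift S ℤ]
  [∀ k : ℤ, (shiftFunctor S k).Additive] [Pretriangulated S]

/-- The objects and morphisms of a `3 × 3` diagram
```
 x'  --f'->  y'  --g'->  z'  --h'-> Σx'
 |p'         |q'         |r'
 x   --f-->  y   --g-->  z   --h--> Σx
 |p          |q          |r
 x'' --f''-> y'' --g''-> z'' --h''-> Σx''
 |p''        |q''        |r''
 Σx'         Σy'         Σz'
``` -/
structure NineDiagram where
  (x' y' z' x y z x'' y'' z'' : S)
  (f' : x' ⟶ y') (g' : y' ⟶ z') (h' : z' ⟶ x'⟦(1 : ℤ)⟧)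
  (f : x ⟶ y) (g : y ⟶ z) (h : z ⟶ x⟦(1 : ℤ)⟧)
  (f'' : x'' ⟶ y'') (g'' : y'' ⟶ z'') (h'' : z'' ⟶ x''⟦(1 : ℤ)⟧)
  (p' : x' ⟶ x) (p : x ⟶ x'') (p'' : x'' ⟶ x'⟦(1 : ℤ)⟧)
  (q' : y' ⟶ y) (q : y ⟶ y'') (q'' : y'' ⟶ y'⟦(1 : ℤ)⟧)
  (r' : z' ⟶ z) (r : z ⟶ z'') (r'' : z'' ⟶ z'⟦(1 : ℤ)⟧)

variable {S}

/-- The diagram admits a Verdier structure: its rows and columns are distinguished, and there are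
a distinguished triangle `x' ⟶ y ⟶ A ⟶ Σx'` on the diagonal of the upper left square and
* an octahedron `O₁` on `x' ⟶ x ⟶ y`, giving `ε : x'' ⟶ A` and `η : A ⟶ z`,
* an octahedron `O₂` on `x' ⟶ y' ⟶ y`, giving `β : z' ⟶ A` and `γ : A ⟶ y''`,
* an octahedron `O₃` on `x'' ⟶ A ⟶ y''`, whose composite is `f''`,
  giving `r : z ⟶ z''` and `r'' : z'' ⟶ Σz'`, with `β ≫ η = r'`.
In `O₃` the triangle on `A ⟶ y''` is the rotation `A ⟶ y'' ⟶ Σz' ⟶ ΣA` of the triangle obtained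
from `O₂`, its last morphism being `-Σβ`. The squares of the diagram then commute (and the
lower right one anticommutes), and the third column is distinguished. -/
def NineDiagram.HasVerdierStructure (N : NineDiagram S) : Prop :=
  ∃ (A : S) (α : N.y ⟶ A) (v : A ⟶ N.x'⟦(1 : ℤ)⟧)
    (hf' : Triangle.mk N.f' N.g' N.h' ∈ distTriang S)
    (hf : Triangle.mk N.f N.g N.h ∈ distTriang S)
    (hf'' : Triangle.mk N.f'' N.g'' N.h'' ∈ distTriang S)
    (hp : Triangle.mk N.p' N.p N.p'' ∈ distTriang S)
    (hq : Triangle.mk N.q' N.q N.q'' ∈ distTriang S)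
    (hA : Triangle.mk (N.p' ≫ N.f) α v ∈ distTriang S)
    (hsq : N.f' ≫ N.q' = N.p' ≫ N.f)
    (O₁ : Octahedron (rfl : N.p' ≫ N.f = N.p' ≫ N.f) hp hf hA)
    (O₂ : Octahedron hsq hf' hq hA)
    (hεγ : O₁.m₁ ≫ O₂.m₃ = N.f'')
    (hγ : Triangle.mk O₂.m₃ (N.q'' ≫ N.g'⟦(1 : ℤ)⟧') (-O₂.m₁⟦(1 : ℤ)⟧') ∈ distTriang S)
    (O₃ : Octahedron hεγ O₁.mem hγ hf''),
    O₃.m₁ = N.r ∧ O₃.m₃ = N.r'' ∧ O₂.m₁ ≫ O₁.m₃ = N.r'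

end Verdier

/-! ### Multiexact functors of triangulated categories -/

section Multiexact

variable {n : ℕ} (T : Fin n → Type u) [∀ i, Category.{v} (T i)] [∀ i, HasZeroObject (T i)]
  [∀ i, Preadditive (T i)] [∀ i, HasShift (T i) ℤ]
  [∀ i, ∀ k : ℤ, (shiftFunctor (T i) k).Additive] [∀ i, Pretriangulated (T i)]
  (S : Type u₀) [Category.{v₀} S] [HasZeroObject S] [Preadditive S] [HasShift S ℤ]
  [∀ k : ℤ, (shiftFunctor S k).Additive] [Pretriangulated S]

/-- A functor of `n` variables which is triangulated in each variable, with isomorphisms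
`F(…, Σ x, …) ≅ Σ F(…, x, …)` that are natural in all variables. -/
structure PreMultiexact where
  toFunctor : (∀ i, T i) ⥤ S
  commShift : ∀ (a : ∀ i, T i) (i : Fin n), (slot a i ⋙ toFunctor).CommShift ℤ
  natural : ∀ {a b : ∀ i, T i} (i : Fin n) (φ : ∀ j, j ≠ i → (a j ⟶ b j)),
    letI := commShift a i
    letI := commShift b i
    NatTrans.CommShift (Functor.whiskerRight (slotMap i φ) toFunctor) ℤ
  isTriangulated : ∀ (a : ∀ i, T i) (i : Fin n),
    letI := commShift a i
    (slot a i ⋙ toFunctor).IsTriangulated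

attribute [instance] PreMultiexact.commShift PreMultiexact.isTriangulated

variable {T S}

namespace PreMultiexact

variable (F : PreMultiexact T S)

/-- The value of `F` with `x` at the place `i` and `y` at the place `j`. -/
abbrev obj₂ (a : ∀ k, T k) (i j : Fin n) (x : T i) (y : T j) : S :=
  F.toFunctor.obj (Function.update (Function.update a i x) j y)

/-- The morphism `F(f, y) : F(x, y) ⟶ F(x', y)`. -/
def mapFst (a : ∀ k, T k) (i j : Fin n) {x x' : T i} (f : x ⟶ x') (y : T j) :
    F.obj₂ a i j x y ⟶ F.obj₂ a i j x' y :=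
  F.toFunctor.map ((slotMap j fun k _ => (slot a i).map f k).app y)

/-- The isomorphism `F(Σ x, y) ≅ Σ F(x, y)`. -/
def shiftFst {i j : Fin n} (hij : i ≠ j) (a : ∀ k, T k) (x : T i) (y : T j) :
    F.obj₂ a i j (x⟦(1 : ℤ)⟧) y ⟶ (F.obj₂ a i j x y)⟦(1 : ℤ)⟧ :=
  F.toFunctor.map (swap hij a (x⟦(1 : ℤ)⟧) y).hom ≫
    ((slot (Function.update a j y) i ⋙ F.toFunctor).commShiftIso (1 : ℤ)).hom.app x ≫
    (F.toFunctor.map (swap hij a x y).inv)⟦(1 : ℤ)⟧'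

/-- The isomorphism `F(x, Σ y) ≅ Σ F(x, y)`. -/
def shiftSnd (i j : Fin n) (a : ∀ k, T k) (x : T i) (y : T j) :
    F.obj₂ a i j x (y⟦(1 : ℤ)⟧) ⟶ (F.obj₂ a i j x y)⟦(1 : ℤ)⟧ :=
  ((slot (Function.update a i x) j ⋙ F.toFunctor).commShiftIso (1 : ℤ)).hom.app y

/-- The image `F(x, y) ⟶ F(x', y) ⟶ F(x'', y) ⟶ Σ F(x, y)` of a triangle in the `i`-th variable,
for an object `y` in the `j`-th variable. -/
def triangleFst {i j : Fin n} (hij : i ≠ j) (a : ∀ k, T k) (Δ : Triangle (T i)) (y : T j) :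
    Triangle S :=
  Triangle.mk (F.mapFst a i j Δ.mor₁ y) (F.mapFst a i j Δ.mor₂ y)
    (F.mapFst a i j Δ.mor₃ y ≫ F.shiftFst hij a Δ.obj₁ y)

/-- The image `F(x, y) ⟶ F(x, y') ⟶ F(x, y'') ⟶ Σ F(x, y)` of a triangle in the `j`-th variable,
for an object `x` in the `i`-th variable. -/
def triangleSnd (i j : Fin n) (a : ∀ k, T k) (x : T i) (Δ : Triangle (T j)) : Triangle S :=
  (slot (Function.update a i x) j ⋙ F.toFunctor).mapTriangle.obj Δ

/-- The `3 × 3` diagram induced by triangles in the variables `i` and `j`, with rows the images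
of the triangle in the `i`-th variable and columns those of the triangle in the `j`-th. -/
def nineDiagram {i j : Fin n} (hij : i ≠ j) (a : ∀ k, T k) (Δ : Triangle (T i))
    (Δ' : Triangle (T j)) : NineDiagram S where
  x' := F.obj₂ a i j Δ.obj₁ Δ'.obj₁
  y' := F.obj₂ a i j Δ.obj₂ Δ'.obj₁
  z' := F.obj₂ a i j Δ.obj₃ Δ'.obj₁
  x := F.obj₂ a i j Δ.obj₁ Δ'.obj₂
  y := F.obj₂ a i j Δ.obj₂ Δ'.obj₂
  z := F.obj₂ a i j Δ.obj₃ Δ'.obj₂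
  x'' := F.obj₂ a i j Δ.obj₁ Δ'.obj₃
  y'' := F.obj₂ a i j Δ.obj₂ Δ'.obj₃
  z'' := F.obj₂ a i j Δ.obj₃ Δ'.obj₃
  f' := (F.triangleFst hij a Δ Δ'.obj₁).mor₁
  g' := (F.triangleFst hij a Δ Δ'.obj₁).mor₂
  h' := (F.triangleFst hij a Δ Δ'.obj₁).mor₃
  f := (F.triangleFst hij a Δ Δ'.obj₂).mor₁
  g := (F.triangleFst hij a Δ Δ'.obj₂).mor₂
  h := (F.triangleFst hij a Δ Δ'.obj₂).mor₃
  f'' := (F.triangleFst hij a Δ Δ'.obj₃).mor₁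
  g'' := (F.triangleFst hij a Δ Δ'.obj₃).mor₂
  h'' := (F.triangleFst hij a Δ Δ'.obj₃).mor₃
  p' := (F.triangleSnd i j a Δ.obj₁ Δ').mor₁
  p := (F.triangleSnd i j a Δ.obj₁ Δ').mor₂
  p'' := (F.triangleSnd i j a Δ.obj₁ Δ').mor₃
  q' := (F.triangleSnd i j a Δ.obj₂ Δ').mor₁
  q := (F.triangleSnd i j a Δ.obj₂ Δ').mor₂
  q'' := (F.triangleSnd i j a Δ.obj₂ Δ').mor₃
  r' := (F.triangleSnd i j a Δ.obj₃ Δ').mor₁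
  r := (F.triangleSnd i j a Δ.obj₃ Δ').mor₂
  r'' := (F.triangleSnd i j a Δ.obj₃ Δ').mor₃

end PreMultiexact

variable (T S)

/-- A multiexact functor `T_1 × ⋯ × T_n ⟶ S` of triangulated categories: it is triangulated in
each variable, and for any two variables the two isomorphisms
`F(Σ x, Σ y) ≅ Σ Σ F(x, y)` differ by the sign `-1`. -/
structure MultiexactFunctor extends PreMultiexact T S where
  anticomm : ∀ {i j : Fin n} (hij : i ≠ j) (a : ∀ k, T k) (x : T i) (y : T j),
    toPreMultiexact.shiftFst hij a x (y⟦(1 : ℤ)⟧) ≫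
        (toPreMultiexact.shiftSnd i j a x y)⟦(1 : ℤ)⟧' =
      -(toPreMultiexact.shiftSnd i j a (x⟦(1 : ℤ)⟧) y ≫
        (toPreMultiexact.shiftFst hij a x y)⟦(1 : ℤ)⟧')

variable {T S}

namespace MultiexactFunctor

/-- The functor admits a Verdier structure: so do all the `3 × 3` diagrams induced by
distinguished triangles in two variables `i < j`. -/
def AdmitsVerdierStructure (F : MultiexactFunctor T S) : Prop :=
  ∀ {i j : Fin n} (hij : i < j) (a : ∀ k, T k)
    (Δ : Triangle (T i)) (_ : Δ ∈ distTriang (T i))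
    (Δ' : Triangle (T j)) (_ : Δ' ∈ distTriang (T j)),
    (F.nineDiagram hij.ne a Δ Δ').HasVerdierStructure

/-- A natural transformation of multiexact functors is one of the underlying functors which is
compatible with the isomorphisms `F(…, Σ x, …) ≅ Σ F(…, x, …)` in each variable. -/
def IsExactTrans {F G : MultiexactFunctor T S} (α : F.toFunctor ⟶ G.toFunctor) : Prop :=
  ∀ (a : ∀ i, T i) (i : Fin n), NatTrans.CommShift (Functor.whiskerLeft (slot a i) α) ℤ

end MultiexactFunctor

section CompDet

variable {P : Type w} [Category.{w} P] [MonoidalCategory P]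

/-- The composite `D ∘ F` of a determinant functor with a multiexact functor, with its additivity
data: the value of `D` at the image triangles. -/
def PreDet.compMultiexact (D : PreDet S P) (F : MultiexactFunctor T S) : PreMultiDet T P where
  toFunctor := F.toFunctor.core ⋙ D.toFunctor
  add a i Δ hΔ := D.add ((slot a i ⋙ F.toFunctor).mapTriangle.obj Δ)
    ((slot a i ⋙ F.toFunctor).map_distinguished Δ hΔ)

/-- The natural transformation `D * α : D ∘ F ⟶ D ∘ G` induced by a natural isomorphism
`α : F ≅ G`. -/
def PreDet.whisker (D : PreDet S P) {F G : MultiexactFunctor T S}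
    (α : F.toFunctor ≅ G.toFunctor) :
    (D.compMultiexact F).toFunctor ⟶ (D.compMultiexact G).toFunctor :=
  Functor.whiskerRight α.core.hom D.toFunctor

end CompDet

end Multiexact

end MultiDeterminant

end

open MultiDeterminant

universe u₁ v₁ u₂ v₂

noncomputable section

namespace MultiDeterminant

/-! ### Categories with sums -/

/-! Determinant functors and symmetric monoidal functors are two cases of one notion: a functor with
additivity morphisms `F x + F y ⟶ F z`, one for each way in which `z` is a sum of `x` and `y`,
subject to naturality, commutativity and associativity (`SumStr`, `PreMod.IsMod`). For `triStr T` a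
sum is a distinguished triangle `y ⟶ z ⟶ x ⟶ Σy`; for `monStr V` it is a morphism `x ⊗ y ⟶ z`. The
unit constraint of a monoidal functor is not lost, because a Picard groupoid as target determines
it.

Several variables are treated by currying. If `P` is a Picard groupoid, so is the category `Mod σ P`
of these functors with the pointwise tensor product, since objects, morphisms and relations can be
divided pointwise. A functor of `n + 1` variables is a functor of `n` variables with values in `Mod
(σ 0) P`: the interchange relation between the first variable and another one says that additivity
morphisms in the latter are morphisms of `Mod (σ 0) P`. Universality of `det` makes the restriction
from `Mod (monStr V) P` to `Mod (triStr T) P` full, faithful and essentially surjective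
(`DetFunctor.IsUniversal.sumMap`). By induction on `n`, functors of several variables extend along
the universal determinant functors (`exists_extension`), and morphisms extend uniquely
(`exists_hom_extension`, `hom_ext_of_isUniversal`). As morphisms of `P` are invertible, any two
pairs over one multi-determinant functor have exactly one comparison
(`existsUnique_inducedPair_hom`). So every pair is universal, and the third assertion is this
statement for `D ∘ F₂`, with `a₁` composed with `D * α`.

It remains to see that `D ∘ F` is a multi-determinant functor. One variable at a time this holds
because triangulated functors preserve triangles, biproducts and octahedra. For two variables it is
a nine lemma (`PreDet.IsDet.nine`). The octahedra `O₁` and `O₂` of a Verdier structure reduce it to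
the equality of two morphisms `D z'' + D z' + D x'' ⟶ D A`, through `D z` and through `D y''`. After
adding `D (Σz')`, the octahedron `O₃` compares `A` and `z` with `y''` and `z''`. The same pattern
exists for the split model, with `y'' ⊞ z'` and `z'' ⊞ z'` in place of `A` and `z`, and there the
equality follows from commutativity (`PreDet.IsDet.add_sum`). The two situations are linked by a
rotation principle (`PreDet.IsDet.add_rotate`): for a triangle `x ⟶ y ⟶ z ⟶ Σx`, the composite `D
(Σx) + (D z + D x) ⟶ D (Σx) + D y ⟶ D z` does not depend on `y` or on the morphisms. Cancelling `D
(Σz')` ends the argument (`permute_cancel`). -/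

/-- A category with a notion of "sum": `σ.Sum x y z` is the type of ways in which `z` is a sum of
`x` and `y`, and these are related by naturality, commutativity and associativity relations. -/
structure SumStr (C : Type u) [Category.{v} C] where
  Sum : C → C → C → Type v
  IsNat : ∀ {x y z x' y' z' : C}, Sum x y z → Sum x' y' z' → (x ⟶ x') → (y ⟶ y') → (z ⟶ z') → Prop
  isNat_id : ∀ {x y z : C} (s : Sum x y z), IsNat s s (𝟙 x) (𝟙 y) (𝟙 z)
  IsComm : ∀ {x y z : C}, Sum x y z → Sum y x z → Prop
  IsAssoc : ∀ {x y t p q z : C}, Sum x y p → Sum p t z → Sum y t q → Sum x q z → Prop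

/-- A functor with additivity morphisms for the sums. -/
structure PreMod {C : Type u} [Category.{v} C] (σ : SumStr C) (P : Type u₁) [Category.{v₁} P]
    [MonoidalCategory P] where
  F : C ⥤ P
  add : ∀ {x y z : C}, σ.Sum x y z → (F.obj x ⊗ F.obj y ⟶ F.obj z)

section

variable {C : Type u} [Category.{v} C] {σ : SumStr C} {P : Type u₁} [Category.{v₁} P]
    [MonoidalCategory P]

namespace PreMod

/-- The additivity morphisms satisfy the relations between the sums. -/
structure IsMod [SymmetricCategory P] (M : PreMod σ P) : Prop where
  nat : ∀ {x y z x' y' z' : C} {s : σ.Sum x y z} {s' : σ.Sum x' y' z'} {p : x ⟶ x'} {q : y ⟶ y'}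
    {r : z ⟶ z'}, σ.IsNat s s' p q r → M.add s ≫ M.F.map r = (M.F.map p ⊗ₘ M.F.map q) ≫ M.add s'
  comm : ∀ {x y z : C} {s : σ.Sum x y z} {s' : σ.Sum y x z}, σ.IsComm s s' →
    M.add s = (β_ _ _).hom ≫ M.add s'
  assoc : ∀ {x y t p q z : C} {s₁ : σ.Sum x y p} {s₂ : σ.Sum p t z} {s₃ : σ.Sum y t q}
    {s₄ : σ.Sum x q z}, σ.IsAssoc s₁ s₂ s₃ s₄ →
    M.add s₁ ▷ _ ≫ M.add s₂ = (α_ _ _ _).hom ≫ _ ◁ M.add s₃ ≫ M.add s₄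

/-- Compatibility of a natural transformation with the additivity morphisms. -/
def IsHom (M N : PreMod σ P) (τ : M.F ⟶ N.F) : Prop :=
  ∀ {x y z : C} (s : σ.Sum x y z), M.add s ≫ τ.app z = (τ.app x ⊗ₘ τ.app y) ≫ N.add s

lemma IsHom.comp {M N K : PreMod σ P} {τ : M.F ⟶ N.F} {τ' : N.F ⟶ K.F} (h : IsHom M N τ)
    (h' : IsHom N K τ') : IsHom M K (τ ≫ τ') := fun s => by
  simp [reassoc_of% (h s), h' s]

lemma IsHom.inv {M N : PreMod σ P} {τ : M.F ≅ N.F} (h : IsHom M N τ.hom) :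
    IsHom N M τ.inv := fun {x y z} s => by
  have := h s
  rw [← cancel_epi (τ.hom.app x ⊗ₘ τ.hom.app y), ← reassoc_of% this]
  simp

/-- The relations can be transported along natural isomorphisms. -/
lemma IsMod.of_isHom [SymmetricCategory P] {M N : PreMod σ P} (hN : N.IsMod) (τ : M.F ≅ N.F)
    (h : IsHom M N τ.hom) : M.IsMod where
  nat {x y z x' y' z' s s' p q r} H := by
    rw [← cancel_mono (τ.hom.app z'), Category.assoc, Category.assoc, τ.hom.naturality,
      reassoc_of% (h s), hN.nat H, h s']
    simp
  comm {x y z s s'} H := by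
    rw [← cancel_mono (τ.hom.app z), h s, hN.comm H, Category.assoc, h s']
    simp
  assoc {x y t p q z s₁ s₂ s₃ s₄} H := by
    rw [← cancel_mono (τ.hom.app z)]
    simp only [Category.assoc, h s₂, h s₄]
    have e₁ : M.add s₁ ▷ M.F.obj t ≫ (τ.hom.app p ⊗ₘ τ.hom.app t) =
        ((τ.hom.app x ⊗ₘ τ.hom.app y) ⊗ₘ τ.hom.app t) ≫ N.add s₁ ▷ N.F.obj t := by
      rw [← tensorHom_id, ← tensorHom_id, tensorHom_comp_tensorHom, tensorHom_comp_tensorHom, h s₁]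
      simp
    have e₂ : M.F.obj x ◁ M.add s₃ ≫ (τ.hom.app x ⊗ₘ τ.hom.app q) =
        (τ.hom.app x ⊗ₘ τ.hom.app y ⊗ₘ τ.hom.app t) ≫ N.F.obj x ◁ N.add s₃ := by
      rw [← id_tensorHom, ← id_tensorHom, tensorHom_comp_tensorHom, tensorHom_comp_tensorHom, h s₃]
      simp
    rw [reassoc_of% e₁, reassoc_of% e₂, hN.assoc H]
    simp

/-- The pointwise tensor product. -/
@[simps F]
def tensor [BraidedCategory P] (M N : PreMod σ P) : PreMod σ P where
  F :=
    { obj := fun x => M.F.obj x ⊗ N.F.obj x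
      map := fun f => M.F.map f ⊗ₘ N.F.map f }
  add s := tensorμ _ _ _ _ ≫ (M.add s ⊗ₘ N.add s)

end PreMod

/-! ### Coherence of the interchange isomorphism in a symmetric monoidal category. -/

section Coherence

variable [SymmetricCategory P]

/-- The canonical isomorphism `(A + B) + (C + D) ≅ (A + C) + (B + D)` is compatible with the
symmetries of the factors. -/
lemma tensorμ_braiding (X₁ X₂ Y₁ Y₂ : P) :
    tensorμ X₁ X₂ Y₁ Y₂ ≫ ((β_ X₁ Y₁).hom ⊗ₘ (β_ X₂ Y₂).hom) =
      (β_ (X₁ ⊗ X₂) (Y₁ ⊗ Y₂)).hom ≫ tensorμ Y₁ Y₂ X₁ X₂ := by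
  have h : Y₁ ◁ (β_ X₁ Y₂).hom ▷ X₂ ≫ Y₁ ◁ (β_ Y₂ X₁).hom ▷ X₂ = 𝟙 _ := by
    rw [← MonoidalCategory.whiskerLeft_comp, ← comp_whiskerRight]
    simp
  simp only [tensorμ, BraidedCategory.braiding_tensor_left_hom,
    BraidedCategory.braiding_tensor_right_hom, MonoidalCategory.tensorHom_def]
  simp [reassoc_of% h]

lemma tensorμ_braiding' (X₁ X₂ Y₁ Y₂ : P) :
    tensorμ X₁ X₂ Y₁ Y₂ ≫ (β_ (X₁ ⊗ Y₁) (X₂ ⊗ Y₂)).hom =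
      ((β_ X₁ X₂).hom ⊗ₘ (β_ Y₁ Y₂).hom) ≫ tensorμ X₂ X₁ Y₂ Y₁ := by
  have h : X₁ ◁ (β_ X₂ Y₁).hom ▷ Y₂ ≫ X₁ ◁ (β_ Y₁ X₂).hom ▷ Y₂ = 𝟙 _ := by
    rw [← MonoidalCategory.whiskerLeft_comp, ← comp_whiskerRight]
    simp
  simp only [tensorμ, BraidedCategory.braiding_tensor_left_hom,
    BraidedCategory.braiding_tensor_right_hom, MonoidalCategory.tensorHom_def]
  simp [reassoc_of% h]

/-- The inverse `tensorδ` contains the inverse braiding, which by symmetry is the braiding. Being an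
involution, the interchange lets a relation between two variables be read in either order. -/
lemma tensorμ_tensorμ (X₁ X₂ Y₁ Y₂ : P) :
    tensorμ X₁ X₂ Y₁ Y₂ ≫ tensorμ X₁ Y₁ X₂ Y₂ = 𝟙 _ := by
  rw [← tensorμ_tensorδ]
  simp [tensorμ, tensorδ, SymmetricCategory.braiding_swap_eq_inv_braiding X₂ Y₁]

instance (X₁ X₂ Y₁ Y₂ : P) : IsIso (tensorμ X₁ X₂ Y₁ Y₂) :=
  ⟨_, tensorμ_tensorμ _ _ _ _, tensorμ_tensorμ _ _ _ _⟩

end Coherence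
end

section

variable {C : Type u} [Category.{v} C] {σ : SumStr C} {P : Type u₁} [Category.{v₁} P]
    [MonoidalCategory P] [SymmetricCategory P]

namespace PreMod

/-- This lemma and the next four bring the sides of each relation for `M.tensor N` to the form: an
invertible coherence morphism, common to both sides, followed by the tensor product of the
corresponding sides for `M` and `N`. Hence the relations pass from the factors to the product, and
by cancellation from the product and one factor to the other. -/
lemma tensor_nat_left (M N : PreMod σ P) {x y z z' : C} (s : σ.Sum x y z) (r : z ⟶ z') :
    (M.tensor N).add s ≫ (M.tensor N).F.map r =
      tensorμ _ _ _ _ ≫ ((M.add s ≫ M.F.map r) ⊗ₘ (N.add s ≫ N.F.map r)) := by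
  simp [tensor]

lemma tensor_nat_right (M N : PreMod σ P) {x y x' y' z' : C} (s' : σ.Sum x' y' z')
    (p : x ⟶ x') (q : y ⟶ y') :
    ((M.tensor N).F.map p ⊗ₘ (M.tensor N).F.map q) ≫ (M.tensor N).add s' =
      tensorμ _ _ _ _ ≫ (((M.F.map p ⊗ₘ M.F.map q) ≫ M.add s') ⊗ₘ
        ((N.F.map p ⊗ₘ N.F.map q) ≫ N.add s')) := by
  dsimp [tensor]
  rw [tensorμ_natural_assoc, tensorHom_comp_tensorHom]

lemma tensor_comm_right (M N : PreMod σ P) {x y z : C} (s' : σ.Sum y x z) :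
    (β_ ((M.tensor N).F.obj x) ((M.tensor N).F.obj y)).hom ≫ (M.tensor N).add s' =
      tensorμ _ _ _ _ ≫ (((β_ _ _).hom ≫ M.add s') ⊗ₘ ((β_ _ _).hom ≫ N.add s')) := by
  dsimp [tensor]
  rw [← tensorHom_comp_tensorHom, ← Category.assoc, ← tensorμ_braiding, Category.assoc]

lemma tensor_assoc_left (M N : PreMod σ P) {x y t p z : C} (s₁ : σ.Sum x y p)
    (s₂ : σ.Sum p t z) :
    (M.tensor N).add s₁ ▷ (M.tensor N).F.obj t ≫ (M.tensor N).add s₂ =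
      (tensorμ _ _ _ _ ▷ _ ≫ tensorμ _ _ _ _) ≫
        ((M.add s₁ ▷ _ ≫ M.add s₂) ⊗ₘ (N.add s₁ ▷ _ ≫ N.add s₂)) := by
  dsimp [tensor]
  rw [comp_whiskerRight, Category.assoc, tensorμ_natural_left_assoc, tensorHom_comp_tensorHom,
    Category.assoc]

lemma tensor_assoc_right (M N : PreMod σ P) {x y t q z : C} (s₃ : σ.Sum y t q)
    (s₄ : σ.Sum x q z) :
    (α_ _ _ _).hom ≫ (M.tensor N).F.obj x ◁ (M.tensor N).add s₃ ≫ (M.tensor N).add s₄ =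
      (tensorμ _ _ _ _ ▷ _ ≫ tensorμ _ _ _ _) ≫
        (((α_ _ _ _).hom ≫ _ ◁ M.add s₃ ≫ M.add s₄) ⊗ₘ
          ((α_ _ _ _).hom ≫ _ ◁ N.add s₃ ≫ N.add s₄)) := by
  dsimp [tensor]
  rw [MonoidalCategory.whiskerLeft_comp, Category.assoc, tensorμ_natural_right_assoc,
    tensorHom_comp_tensorHom, ← tensorHom_comp_tensorHom (α_ _ _ _).hom, Category.assoc]
  rw [tensor_associativity_assoc]

lemma IsMod.tensor {M N : PreMod σ P} (hM : M.IsMod) (hN : N.IsMod) : (M.tensor N).IsMod where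
  nat H := by rw [tensor_nat_left, tensor_nat_right, hM.nat H, hN.nat H]
  comm {x y z s s'} H := by
    rw [tensor_comm_right, ← hM.comm H, ← hN.comm H]; rfl
  assoc H := by rw [tensor_assoc_left, tensor_assoc_right, hM.assoc H, hN.assoc H]

end PreMod

section Coherence

variable {X₁ X₂ X₃ Y₁ Y₂ Y₃ Z₁ Z₂ Z₃ : P}

/-- With the `fᵢ` read as additivity morphisms, this and the three lemmas below say that the
pointwise associator, unitors and braiding are morphisms of functors with additivity. -/
lemma tensorμ_associator (f₁ : X₁ ⊗ Y₁ ⟶ Z₁) (f₂ : X₂ ⊗ Y₂ ⟶ Z₂) (f₃ : X₃ ⊗ Y₃ ⟶ Z₃) :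
    (tensorμ (X₁ ⊗ X₂) X₃ (Y₁ ⊗ Y₂) Y₃ ≫ ((tensorμ X₁ X₂ Y₁ Y₂ ≫ (f₁ ⊗ₘ f₂)) ⊗ₘ f₃)) ≫
        (α_ Z₁ Z₂ Z₃).hom =
      ((α_ X₁ X₂ X₃).hom ⊗ₘ (α_ Y₁ Y₂ Y₃).hom) ≫
        tensorμ X₁ (X₂ ⊗ X₃) Y₁ (Y₂ ⊗ Y₃) ≫ (f₁ ⊗ₘ (tensorμ X₂ X₃ Y₂ Y₃ ≫ (f₂ ⊗ₘ f₃))) := by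
  have h := associator_monoidal X₁ X₂ X₃ Y₁ Y₂ Y₃
  have e₁ : (tensorμ X₁ X₂ Y₁ Y₂ ≫ (f₁ ⊗ₘ f₂)) ⊗ₘ f₃ =
      tensorμ X₁ X₂ Y₁ Y₂ ▷ _ ≫ ((f₁ ⊗ₘ f₂) ⊗ₘ f₃) := by
    rw [← tensorHom_id, tensorHom_comp_tensorHom, Category.id_comp]
  have e₂ : f₁ ⊗ₘ (tensorμ X₂ X₃ Y₂ Y₃ ≫ (f₂ ⊗ₘ f₃)) =
      _ ◁ tensorμ X₂ X₃ Y₂ Y₃ ≫ (f₁ ⊗ₘ f₂ ⊗ₘ f₃) := by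
    rw [← id_tensorHom, tensorHom_comp_tensorHom, Category.id_comp]
  rw [e₁, e₂, Category.assoc, Category.assoc, associator_naturality, reassoc_of% h]

lemma tensorμ_leftUnitor (f : X₁ ⊗ Y₁ ⟶ Z₁) :
    (tensorμ (𝟙_ P) X₁ (𝟙_ P) Y₁ ≫ ((λ_ (𝟙_ P)).hom ⊗ₘ f)) ≫ (λ_ Z₁).hom =
      ((λ_ X₁).hom ⊗ₘ (λ_ Y₁).hom) ≫ f := by
  rw [leftUnitor_monoidal]
  simp [MonoidalCategory.tensorHom_def]

lemma tensorμ_rightUnitor (f : X₁ ⊗ Y₁ ⟶ Z₁) :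
    (tensorμ X₁ (𝟙_ P) Y₁ (𝟙_ P) ≫ (f ⊗ₘ (λ_ (𝟙_ P)).hom)) ≫ (ρ_ Z₁).hom =
      ((ρ_ X₁).hom ⊗ₘ (ρ_ Y₁).hom) ≫ f := by
  rw [rightUnitor_monoidal]
  simp [MonoidalCategory.tensorHom_def']

lemma tensorμ_braiding_comp (f₁ : X₁ ⊗ Y₁ ⟶ Z₁) (f₂ : X₂ ⊗ Y₂ ⟶ Z₂) :
    (tensorμ X₁ X₂ Y₁ Y₂ ≫ (f₁ ⊗ₘ f₂)) ≫ (β_ Z₁ Z₂).hom =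
      ((β_ X₁ X₂).hom ⊗ₘ (β_ Y₁ Y₂).hom) ≫ tensorμ X₂ X₁ Y₂ Y₁ ≫ (f₂ ⊗ₘ f₁) := by
  rw [← Category.assoc, ← tensorμ_braiding', Category.assoc, Category.assoc,
    BraidedCategory.braiding_naturality]

end Coherence

/-! ### The symmetric monoidal category of functors with additivity morphisms. -/

variable (σ P) in
/-- Functors with additivity morphisms which satisfy the relations. -/
structure Mod extends PreMod σ P where
  isMod : toPreMod.IsMod

namespace Mod

/-- Natural transformations compatible with the additivity morphisms. -/
@[ext]
structure Hom (M N : Mod σ P) where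
  nt : M.F ⟶ N.F
  isHom : PreMod.IsHom M.toPreMod N.toPreMod nt

instance : Category (Mod σ P) where
  Hom := Hom
  id M := ⟨𝟙 _, fun s => by simp⟩
  comp f g := ⟨f.nt ≫ g.nt, PreMod.IsHom.comp f.isHom g.isHom⟩
  id_comp f := Hom.ext (Category.id_comp f.nt)
  comp_id f := Hom.ext (Category.comp_id f.nt)
  assoc f g h := Hom.ext (Category.assoc f.nt g.nt h.nt)

@[simp] lemma id_nt (M : Mod σ P) : Hom.nt (𝟙 M) = 𝟙 M.F := rfl

@[simp] lemma comp_nt {M N K : Mod σ P} (f : M ⟶ N) (g : N ⟶ K) :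
    Hom.nt (f ≫ g) = Hom.nt f ≫ Hom.nt g := rfl

@[ext] lemma hom_ext {M N : Mod σ P} {f g : M ⟶ N}
    (h : ∀ x, (Hom.nt f).app x = (Hom.nt g).app x) : f = g :=
  Hom.ext (NatTrans.ext (funext h))

/-- A natural transformation compatible with the additivity morphisms. -/
abbrev homMk {M N : Mod σ P} (f : M.F ⟶ N.F) (h : PreMod.IsHom M.toPreMod N.toPreMod f) :
    M ⟶ N := Hom.mk f h

/-- A natural isomorphism compatible with the additivity morphisms. -/
@[simps]
def isoMk {M N : Mod σ P} (e : M.F ≅ N.F) (h : PreMod.IsHom M.toPreMod N.toPreMod e.hom) :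
    M ≅ N where
  hom := homMk e.hom h
  inv := homMk e.inv h.inv
  hom_inv_id := Hom.ext e.hom_inv_id
  inv_hom_id := Hom.ext e.inv_hom_id

/-- An isomorphism given by its components. -/
def isoOfComponents {M N : Mod σ P} (e : ∀ x, M.F.obj x ≅ N.F.obj x)
    (h₁ : ∀ {x y : C} (f : x ⟶ y), M.F.map f ≫ (e y).hom = (e x).hom ≫ N.F.map f)
    (h₂ : ∀ {x y z : C} (s : σ.Sum x y z),
      M.add s ≫ (e z).hom = ((e x).hom ⊗ₘ (e y).hom) ≫ N.add s) : M ≅ N :=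
  isoMk (NatIso.ofComponents e h₁) h₂

/-- The pointwise tensor product. -/
def tensor (M N : Mod σ P) : Mod σ P := ⟨M.toPreMod.tensor N.toPreMod, M.isMod.tensor N.isMod⟩

@[simp] lemma tensor_F_obj (M N : Mod σ P) (x : C) :
    (tensor M N).F.obj x = M.F.obj x ⊗ N.F.obj x := rfl

@[simp] lemma tensor_F_map (M N : Mod σ P) {x y : C} (f : x ⟶ y) :
    (tensor M N).F.map f = M.F.map f ⊗ₘ N.F.map f := rfl

lemma tensor_add (M N : Mod σ P) {x y z : C} (s : σ.Sum x y z) :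
    (tensor M N).add s = tensorμ _ _ _ _ ≫ (M.add s ⊗ₘ N.add s) := rfl

variable (σ P) in
/-- The constant functor with value the unit object. -/
def one : Mod σ P where
  F := (Functor.const C).obj (𝟙_ P)
  add _ := (λ_ _).hom
  isMod :=
    { nat := fun _ => by simp
      comm := fun _ => by simp [← unitors_equal]
      assoc := fun _ => by simp; monoidal }

@[simp] lemma one_F_obj (x : C) : (one σ P).F.obj x = 𝟙_ P := rfl

@[simp] lemma one_F_map {x y : C} (f : x ⟶ y) : (one σ P).F.map f = 𝟙 (𝟙_ P) := rfl

/-- The pointwise tensor product of morphisms. -/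
def tensorHom {M M' N N' : Mod σ P} (f : M ⟶ M') (g : N ⟶ N') : tensor M N ⟶ tensor M' N' :=
  homMk
    { app := fun x => (Hom.nt f).app x ⊗ₘ (Hom.nt g).app x
      naturality := fun x y h => by simp [tensorHom_comp_tensorHom] } fun {x y z} s => by
    dsimp only [tensor_F_obj]
    rw [tensor_add, tensor_add, Category.assoc, tensorHom_comp_tensorHom, f.isHom, g.isHom,
      ← tensorHom_comp_tensorHom, tensorμ_natural_assoc]

/-- The pointwise associator. -/
def assoc (M N K : Mod σ P) : tensor (tensor M N) K ≅ tensor M (tensor N K) :=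
  isoOfComponents (fun x => α_ _ _ _) (fun f => associator_naturality _ _ _)
    (fun s => tensorμ_associator (M.add s) (N.add s) (K.add s))

/-- The pointwise left unitor. -/
def leftUnitor (M : Mod σ P) : tensor (one σ P) M ≅ M :=
  isoOfComponents (fun x => λ_ _) (fun f => by simp) (fun s => tensorμ_leftUnitor (M.add s))

/-- The pointwise right unitor. -/
def rightUnitor (M : Mod σ P) : tensor M (one σ P) ≅ M :=
  isoOfComponents (fun x => ρ_ _) (fun f => by simp) (fun s => tensorμ_rightUnitor (M.add s))

/-- The pointwise braiding. -/
def braiding (M N : Mod σ P) : tensor M N ≅ tensor N M :=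
  isoOfComponents (fun x => β_ _ _) (fun f => by simp)
    (fun s => tensorμ_braiding_comp (M.add s) (N.add s))

@[simp] lemma braiding_hom_nt_app (M N : Mod σ P) (x : C) : (Hom.nt (braiding M N).hom).app x =
    (β_ (M.F.obj x) (N.F.obj x)).hom := rfl

instance : MonoidalCategoryStruct (Mod σ P) where
  tensorObj := tensor
  tensorUnit := one σ P
  tensorHom := tensorHom
  whiskerLeft M _ _ f := tensorHom (𝟙 M) f
  whiskerRight f N := tensorHom f (𝟙 N)
  associator := assoc
  leftUnitor := leftUnitor
  rightUnitor := rightUnitor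

section

variable {M M' N N' : Mod σ P} (f : M ⟶ M') (g : N ⟶ N') (K L : Mod σ P) {x y z : C}

@[simp] lemma tensorObj_F_obj : (M ⊗ N).F.obj x = M.F.obj x ⊗ N.F.obj x := rfl

@[simp] lemma tensorObj_F_map (h : x ⟶ y) : (M ⊗ N).F.map h = M.F.map h ⊗ₘ N.F.map h := rfl

@[simp] lemma tensorHom_app :
    (Hom.nt (f ⊗ₘ g)).app x = (Hom.nt f).app x ⊗ₘ (Hom.nt g).app x := rfl

@[simp] lemma whiskerLeft_app : (Hom.nt (K ◁ f)).app x = K.F.obj x ◁ (Hom.nt f).app x :=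
  id_tensorHom _ _

@[simp] lemma whiskerRight_app : (Hom.nt (f ▷ K)).app x = (Hom.nt f).app x ▷ K.F.obj x :=
  tensorHom_id _ _

@[simp] lemma associator_hom_app : (Hom.nt (α_ M N K).hom).app x =
    (α_ (M.F.obj x) (N.F.obj x) (K.F.obj x)).hom := rfl

@[simp] lemma associator_inv_app : (Hom.nt (α_ M N K).inv).app x =
    (α_ (M.F.obj x) (N.F.obj x) (K.F.obj x)).inv := rfl

@[simp] lemma leftUnitor_hom_app : (Hom.nt (λ_ M).hom).app x = (λ_ (M.F.obj x)).hom := rfl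

@[simp] lemma rightUnitor_hom_app : (Hom.nt (ρ_ M).hom).app x = (ρ_ (M.F.obj x)).hom := rfl

@[simp] lemma tensorUnit_F_obj : (𝟙_ (Mod σ P)).F.obj x = 𝟙_ P := rfl

end

instance : MonoidalCategory (Mod σ P) where
  tensorHom_def f g := by ext x; simp [MonoidalCategory.tensorHom_def]
  id_tensorHom_id M N := by ext x; simp
  tensorHom_comp_tensorHom f g h k := by ext x; simp
  whiskerLeft_id M N := by ext x; simp
  id_whiskerRight M N := by ext x; simp
  associator_naturality f g h := by ext x; simp
  leftUnitor_naturality f := by ext x; simp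
  rightUnitor_naturality f := by ext x; simp
  pentagon M N K L := by ext x; simp
  triangle M N := by ext x; simp

instance : BraidedCategory (Mod σ P) where
  braiding := braiding
  braiding_naturality_right M N K f := by ext x; simp
  braiding_naturality_left f K := by ext x; simp
  hexagon_forward M N K := by ext x; simp
  hexagon_reverse M N K := by ext x; simp

@[simp] lemma braiding_hom_app (M N : Mod σ P) (x : C) : (Hom.nt (β_ M N).hom).app x =
    (β_ (M.F.obj x) (N.F.obj x)).hom := rfl

instance : SymmetricCategory (Mod σ P) where
  symmetry M N := by ext x; simp

@[simp] lemma tensorμ_app (M N K L : Mod σ P) (x : C) : (Hom.nt (tensorμ M N K L)).app x =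
    tensorμ (M.F.obj x) (N.F.obj x) (K.F.obj x) (L.F.obj x) := by
  simp [tensorμ]

section

variable {X Y Z W U V X' Y' : Mod σ P}

/-- Tensor products and coherence morphisms of `Mod σ P` are pointwise, so its relations can be
checked at each object. Both directions serve in passing between curried and uncurried functors. -/
lemma assoc_eq_iff {a : X ⊗ Y ⟶ U} {b : U ⊗ Z ⟶ W} {c : Y ⊗ Z ⟶ V} {d : X ⊗ V ⟶ W} :
    a ▷ Z ≫ b = (α_ X Y Z).hom ≫ X ◁ c ≫ d ↔
      ∀ x, (Hom.nt a).app x ▷ Z.F.obj x ≫ (Hom.nt b).app x =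
        (α_ (X.F.obj x) (Y.F.obj x) (Z.F.obj x)).hom ≫
          X.F.obj x ◁ (Hom.nt c).app x ≫ (Hom.nt d).app x := by
  refine ⟨fun h x => ?_, fun h => ?_⟩
  · simpa using congr_arg (fun f => (Hom.nt f).app x) h
  · ext x
    simpa using h x

lemma inter_eq_iff {X₁ X₂ X₃ Y₁ Y₂ Y₃ Z₁ Z₂ Z₃ : Mod σ P} {a₁ : X₁ ⊗ Y₁ ⟶ Z₁}
    {a₂ : X₂ ⊗ Y₂ ⟶ Z₂} {a₃ : X₃ ⊗ Y₃ ⟶ Z₃} {b₁ : X₁ ⊗ X₂ ⟶ X₃} {b₂ : Y₁ ⊗ Y₂ ⟶ Y₃}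
    {b₃ : Z₁ ⊗ Z₂ ⟶ Z₃} :
    (a₁ ⊗ₘ a₂) ≫ b₃ = tensorμ X₁ Y₁ X₂ Y₂ ≫ (b₁ ⊗ₘ b₂) ≫ a₃ ↔
      ∀ x, ((Hom.nt a₁).app x ⊗ₘ (Hom.nt a₂).app x) ≫ (Hom.nt b₃).app x =
        tensorμ (X₁.F.obj x) (Y₁.F.obj x) (X₂.F.obj x) (Y₂.F.obj x) ≫
          ((Hom.nt b₁).app x ⊗ₘ (Hom.nt b₂).app x) ≫ (Hom.nt a₃).app x := by
  refine ⟨fun h x => ?_, fun h => ?_⟩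
  · simpa using congr_arg (fun f => (Hom.nt f).app x) h
  · ext x
    simpa using h x

end

end Mod

end

attribute [instance] PicardGroupoid.isEquivalence_tensorLeft

/-! ### Cancellation and division in a Picard groupoid. -/

section Cancel

variable {P : Type w} [Category.{w} P] [MonoidalCategory P] [SymmetricCategory P]
  [PicardGroupoid P]

lemma whiskerLeft_cancel (X : P) {Y Z : P} {f g : Y ⟶ Z} (h : X ◁ f = X ◁ g) : f = g :=
  (tensorLeft X).map_injective h

lemma tensorHom_cancel_left {X Y Z W : P} (f : X ⟶ Y) {g g' : Z ⟶ W} (h : f ⊗ₘ g = f ⊗ₘ g') :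
    g = g' := by
  rw [MonoidalCategory.tensorHom_def, MonoidalCategory.tensorHom_def, cancel_epi] at h
  exact whiskerLeft_cancel _ h

lemma whiskerRight_cancel {Y Z : P} (X : P) {f g : Y ⟶ Z} (h : f ▷ X = g ▷ X) : f = g := by
  refine whiskerLeft_cancel X ?_
  rw [← cancel_mono (β_ X Z).hom]
  simp [h]

lemma exists_whiskerLeft_eq (X : P) {Y Z : P} (f : X ⊗ Y ⟶ X ⊗ Z) : ∃ g : Y ⟶ Z, X ◁ g = f :=
  (tensorLeft X).map_surjective f

/-- Division of morphisms: `f` is invertible and `X ⊗ -` is full, so `h` can be stripped of `f`. -/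
lemma exists_tensorHom_eq {X Y Z W : P} (f : X ⟶ Y) (h : X ⊗ Z ⟶ Y ⊗ W) :
    ∃ g : Z ⟶ W, f ⊗ₘ g = h := by
  obtain ⟨g, hg⟩ := exists_whiskerLeft_eq X (h ≫ inv f ▷ W)
  exact ⟨g, by rw [MonoidalCategory.tensorHom_def', hg]; simp⟩

end Cancel

/-! ### Functors with values in a Picard groupoid form a Picard groupoid. -/

section

variable {C : Type u} [Category.{v} C] {σ : SumStr C}
  {P : Type w} [Category.{w} P] [MonoidalCategory P] [SymmetricCategory P] [PicardGroupoid P]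

namespace PreMod

/-- If `M` and `M ⊗ N` satisfy the relations, then so does `N`. -/
lemma IsMod.of_tensor {M N : PreMod σ P} (hM : M.IsMod) (h : (M.tensor N).IsMod) : N.IsMod where
  nat H := by
    have := h.nat H
    rw [tensor_nat_left, tensor_nat_right, hM.nat H] at this
    exact tensorHom_cancel_left _ ((cancel_epi _).1 this)
  comm {x y z s s'} H := by
    have := h.comm H
    rw [tensor_comm_right, ← hM.comm H] at this
    exact tensorHom_cancel_left _ ((cancel_epi _).1 this)
  assoc H := by
    have := h.assoc H
    rw [tensor_assoc_left, tensor_assoc_right, hM.assoc H] at this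
    exact tensorHom_cancel_left _ ((cancel_epi _).1 this)

end PreMod

namespace Mod

instance : IsGroupoid (Mod σ P) where
  all_isIso {M N} f := by
    have : IsIso (Hom.nt f) := NatIso.isIso_of_isIso_app _
    exact (isoMk (asIso (Hom.nt f)) f.isHom).isIso_hom

instance (M : Mod σ P) : (tensorLeft M).Faithful where
  map_injective {N K f g} h := by
    ext x
    exact whiskerLeft_cancel (M.F.obj x) (by simpa using congr_arg (fun t => (Hom.nt t).app x) h)

/-- Preimages are chosen object by object. Naturality and additivity need no further choice: they
hold after tensoring with the structure morphisms of `M`, which can be cancelled. -/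
instance (M : Mod σ P) : (tensorLeft M).Full where
  map_surjective {N K} τ := by
    let τ' (x : C) : M.F.obj x ⊗ N.F.obj x ⟶ M.F.obj x ⊗ K.F.obj x := (Hom.nt τ).app x
    choose t ht using fun x => exists_whiskerLeft_eq (M.F.obj x) (τ' x)
    have h₁ {x y : C} (f : x ⟶ y) : N.F.map f ≫ t y = t x ≫ K.F.map f := by
      have h : (M.F.map f ⊗ₘ N.F.map f) ≫ τ' y = τ' x ≫ (M.F.map f ⊗ₘ K.F.map f) :=
        (Hom.nt τ).naturality f
      rw [← ht, ← ht, ← id_tensorHom, ← id_tensorHom, tensorHom_comp_tensorHom,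
        tensorHom_comp_tensorHom, Category.id_comp, Category.comp_id] at h
      exact tensorHom_cancel_left _ h
    have h₂ {x y z : C} (s : σ.Sum x y z) : N.add s ≫ t z = (t x ⊗ₘ t y) ≫ K.add s := by
      have h : (tensorμ _ _ _ _ ≫ (M.add s ⊗ₘ N.add s)) ≫ τ' z =
        (τ' x ⊗ₘ τ' y) ≫ tensorμ _ _ _ _ ≫ (M.add s ⊗ₘ K.add s) := Hom.isHom τ s
      rw [← ht, ← ht, ← ht, ← id_tensorHom, ← id_tensorHom, ← id_tensorHom, tensorμ_natural_assoc,
        Category.assoc, tensorHom_comp_tensorHom, tensorHom_comp_tensorHom, cancel_epi] at h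
      simp only [id_tensorHom_id, Category.id_comp, Category.comp_id] at h
      exact tensorHom_cancel_left _ h
    refine ⟨homMk { app := t, naturality := fun _ _ => h₁ } h₂, ?_⟩
    ext x
    exact (whiskerLeft_app _ _).trans (ht x)

/-- The quotient of `N` by `M` is built pointwise: objects by essential surjectivity of `M.F.obj x ⊗
-`, morphisms and additivity by dividing those of `N` by those of `M`. -/
instance (M : Mod σ P) : (tensorLeft M).EssSurj where
  mem_essImage N := by
    let H (x : C) : P := (tensorLeft (M.F.obj x)).objPreimage (N.F.obj x)
    let e (x : C) : M.F.obj x ⊗ H x ≅ N.F.obj x :=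
      (tensorLeft (M.F.obj x)).objObjPreimageIso (N.F.obj x)
    choose m hm using fun {x y : C} (f : x ⟶ y) =>
      exists_tensorHom_eq (M.F.map f) ((e x).hom ≫ N.F.map f ≫ (e y).inv)
    -- The additivity of `M ⊗ K` is an interchange followed by `M.add s ⊗ₘ a s`; the `tensorμ`
    -- placed here is the inverse of that interchange.
    choose a ha using fun {x y z : C} (s : σ.Sum x y z) =>
      exists_tensorHom_eq (M.add s) (tensorμ _ _ _ _ ≫
        ((e x).hom ⊗ₘ (e y).hom) ≫ N.add s ≫ (e z).inv)
    let K : PreMod σ P :=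
      { F :=
          { obj := H
            map := m
            map_id := fun x => by
              refine tensorHom_cancel_left (M.F.map (𝟙 x)) ?_
              rw [hm]
              simp
            map_comp := fun {x y z} f g => by
              refine tensorHom_cancel_left (M.F.map (f ≫ g)) ?_
              rw [hm, M.F.map_comp, ← tensorHom_comp_tensorHom, hm, hm]
              simp }
        add := a }
    let τ : (M.toPreMod.tensor K).F ≅ N.F := NatIso.ofComponents e fun {x y} f => by
      change (M.F.map f ⊗ₘ m f) ≫ (e y).hom = (e x).hom ≫ N.F.map f
      simp [hm]
    have hτ : PreMod.IsHom (M.toPreMod.tensor K) N.toPreMod τ.hom := fun {x y z} s => by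
      change (tensorμ _ _ _ _ ≫ (M.add s ⊗ₘ a s)) ≫ (e z).hom =
        ((e x).hom ⊗ₘ (e y).hom) ≫ N.add s
      rw [ha]
      simp only [Category.assoc, Iso.inv_hom_id, Category.comp_id]
      exact (reassoc_of% tensorμ_tensorμ (M.F.obj x) (H x) (M.F.obj y) (H y)) _
    -- `M ⊗ K` inherits the relations from `N` along `τ`, and those of `M` cancel.
    have hK : K.IsMod := M.isMod.of_tensor (N.isMod.of_isHom τ hτ)
    exact ⟨⟨K, hK⟩, ⟨isoMk τ hτ⟩⟩

end Mod

end

/-- With source and target both in the universe `w`, the new Picard groupoid stays in `w`; this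
allows it to be the target in an induction on the number of variables. -/
instance {C : Type w} [Category.{w} C] {σ : SumStr C} {P : Type w} [Category.{w} P]
    [MonoidalCategory P] [SymmetricCategory P] [PicardGroupoid P] : PicardGroupoid (Mod σ P) where
  isEquivalence_tensorLeft M := {}

/-! ### Functors of several variables with additivity morphisms in each variable -/

section Pi

variable {n : ℕ} {C : Fin n → Type u} [∀ i, Category.{v} (C i)]

/-- A sum in the `i`-th variable: the other entries of the summands are mapped to those of the
sum. -/
structure PiSum (σ : ∀ i, SumStr (C i)) (i : Fin n) (X Y Z : ∀ j, C j) where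
  s : (σ i).Sum (X i) (Y i) (Z i)
  f : ∀ j, j ≠ i → (X j ⟶ Z j)
  g : ∀ j, j ≠ i → (Y j ⟶ Z j)

/-- The sums in the `i`-th variable. -/
def piStr (σ : ∀ i, SumStr (C i)) (i : Fin n) : SumStr (∀ j, C j) where
  Sum X Y Z := PiSum σ i X Y Z
  IsNat s s' p q r := (σ i).IsNat s.s s'.s (p i) (q i) (r i) ∧
    (∀ j h, s.f j h ≫ r j = p j ≫ s'.f j h) ∧ (∀ j h, s.g j h ≫ r j = q j ≫ s'.g j h)
  isNat_id s := ⟨(σ i).isNat_id s.s, fun _ _ => (Category.comp_id _).trans (Category.id_comp _).symm,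
    fun _ _ => (Category.comp_id _).trans (Category.id_comp _).symm⟩
  IsComm s s' := (σ i).IsComm s.s s'.s ∧ (∀ j h, s.f j h = s'.g j h) ∧
    (∀ j h, s.g j h = s'.f j h)
  IsAssoc s₁ s₂ s₃ s₄ := (σ i).IsAssoc s₁.s s₂.s s₃.s s₄.s ∧
    (∀ j h, s₁.f j h ≫ s₂.f j h = s₄.f j h) ∧
    (∀ j h, s₁.g j h ≫ s₂.f j h = s₃.f j h ≫ s₄.g j h) ∧
    (∀ j h, s₂.g j h = s₃.g j h ≫ s₄.g j h)

/-- A `3 × 3` grid of objects, whose rows are sums in the `i`-th variable and whose columns are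
sums in the `j`-th variable. -/
structure IsGrid (σ : ∀ i, SumStr (C i)) (i j : Fin n) (hij : i ≠ j)
    {X₁ X₂ X₃ Y₁ Y₂ Y₃ Z₁ Z₂ Z₃ : ∀ k, C k}
    (s₁ : PiSum σ i X₁ Y₁ Z₁) (s₂ : PiSum σ i X₂ Y₂ Z₂) (s₃ : PiSum σ i X₃ Y₃ Z₃)
    (sX : PiSum σ j X₁ X₂ X₃) (sY : PiSum σ j Y₁ Y₂ Y₃) (sZ : PiSum σ j Z₁ Z₂ Z₃) : Prop where
  nat_f : (σ i).IsNat s₁.s s₃.s (sX.f i hij) (sY.f i hij) (sZ.f i hij)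
  nat_g : (σ i).IsNat s₂.s s₃.s (sX.g i hij) (sY.g i hij) (sZ.g i hij)
  nat_f' : (σ j).IsNat sX.s sZ.s (s₁.f j hij.symm) (s₂.f j hij.symm) (s₃.f j hij.symm)
  nat_g' : (σ j).IsNat sY.s sZ.s (s₁.g j hij.symm) (s₂.g j hij.symm) (s₃.g j hij.symm)
  ff : ∀ k (hi : k ≠ i) (hj : k ≠ j), s₁.f k hi ≫ sZ.f k hj = sX.f k hj ≫ s₃.f k hi
  gf : ∀ k (hi : k ≠ i) (hj : k ≠ j), s₁.g k hi ≫ sZ.f k hj = sY.f k hj ≫ s₃.g k hi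
  fg : ∀ k (hi : k ≠ i) (hj : k ≠ j), s₂.f k hi ≫ sZ.g k hj = sX.g k hj ≫ s₃.f k hi
  gg : ∀ k (hi : k ≠ i) (hj : k ≠ j), s₂.g k hi ≫ sZ.g k hj = sY.g k hj ≫ s₃.g k hi

lemma IsGrid.symm {i j : Fin n} {hij : i ≠ j} {X₁ X₂ X₃ Y₁ Y₂ Y₃ Z₁ Z₂ Z₃ : ∀ k, C k} {σ : ∀ i, SumStr (C i)}
    {s₁ : PiSum σ i X₁ Y₁ Z₁} {s₂ : PiSum σ i X₂ Y₂ Z₂} {s₃ : PiSum σ i X₃ Y₃ Z₃}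
    {sX : PiSum σ j X₁ X₂ X₃} {sY : PiSum σ j Y₁ Y₂ Y₃} {sZ : PiSum σ j Z₁ Z₂ Z₃}
    (h : IsGrid σ i j hij s₁ s₂ s₃ sX sY sZ) : IsGrid σ j i hij.symm sX sY sZ s₁ s₂ s₃ where
  nat_f := h.nat_f'
  nat_g := h.nat_g'
  nat_f' := h.nat_f
  nat_g' := h.nat_g
  ff k hi hj := (h.ff k hj hi).symm
  gf k hi hj := (h.fg k hj hi).symm
  fg k hi hj := (h.gf k hj hi).symm
  gg k hi hj := (h.gg k hj hi).symm

/-- A functor of several variables with additivity morphisms in each variable. -/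
structure PreMulti (σ : ∀ i, SumStr (C i)) (P : Type u₁) [Category.{v₁} P]
    [MonoidalCategory P] where
  F : (∀ i, C i) ⥤ P
  add : ∀ (i : Fin n) {X Y Z : ∀ j, C j}, PiSum σ i X Y Z → (F.obj X ⊗ F.obj Y ⟶ F.obj Z)

namespace PreMulti

variable {σ : ∀ i, SumStr (C i)} {P : Type u₁} [Category.{v₁} P] [MonoidalCategory P]

/-- The additivity morphisms in the `i`-th variable. -/
@[simps]
def proj (M : PreMulti σ P) (i : Fin n) : PreMod (piStr σ i) P where
  F := M.F
  add s := M.add i s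

/-- Compatibility of a natural transformation with the additivity morphisms. -/
def IsHom (M N : PreMulti σ P) (τ : M.F ⟶ N.F) : Prop :=
  ∀ (i : Fin n) {X Y Z : ∀ j, C j} (s : PiSum σ i X Y Z),
    M.add i s ≫ τ.app Z = (τ.app X ⊗ₘ τ.app Y) ≫ N.add i s

lemma IsHom.comp {M N K : PreMulti σ P} {τ : M.F ⟶ N.F} {τ' : N.F ⟶ K.F} (h : IsHom M N τ)
    (h' : IsHom N K τ') : IsHom M K (τ ≫ τ') := fun i _ _ _ s => by
  simp [reassoc_of% (h i s), h' i s]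

variable [SymmetricCategory P]

/-- The two ways to add the four corners of a grid agree. -/
def Inter (M : PreMulti σ P) {i j : Fin n} {X₁ X₂ X₃ Y₁ Y₂ Y₃ Z₁ Z₂ Z₃ : ∀ k, C k}
    (s₁ : PiSum σ i X₁ Y₁ Z₁) (s₂ : PiSum σ i X₂ Y₂ Z₂) (s₃ : PiSum σ i X₃ Y₃ Z₃)
    (sX : PiSum σ j X₁ X₂ X₃) (sY : PiSum σ j Y₁ Y₂ Y₃) (sZ : PiSum σ j Z₁ Z₂ Z₃) : Prop :=
  (M.add i s₁ ⊗ₘ M.add i s₂) ≫ M.add j sZ =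
    tensorμ _ _ _ _ ≫ (M.add j sX ⊗ₘ M.add j sY) ≫ M.add i s₃

/-- The additivity morphisms satisfy all relations. -/
structure IsMulti (M : PreMulti σ P) : Prop where
  isMod : ∀ i, (M.proj i).IsMod
  inter : ∀ {i j : Fin n} {hij : i ≠ j} {X₁ X₂ X₃ Y₁ Y₂ Y₃ Z₁ Z₂ Z₃ : ∀ k, C k}
    {s₁ : PiSum σ i X₁ Y₁ Z₁} {s₂ : PiSum σ i X₂ Y₂ Z₂} {s₃ : PiSum σ i X₃ Y₃ Z₃}
    {sX : PiSum σ j X₁ X₂ X₃} {sY : PiSum σ j Y₁ Y₂ Y₃} {sZ : PiSum σ j Z₁ Z₂ Z₃},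
    IsGrid σ i j hij s₁ s₂ s₃ sX sY sZ → M.Inter s₁ s₂ s₃ sX sY sZ

/-- Transposing the grid exchanges the two sides up to the interchange, which is an involution. -/
lemma Inter.symm {M : PreMulti σ P} {i j : Fin n} {X₁ X₂ X₃ Y₁ Y₂ Y₃ Z₁ Z₂ Z₃ : ∀ k, C k}
    {s₁ : PiSum σ i X₁ Y₁ Z₁} {s₂ : PiSum σ i X₂ Y₂ Z₂} {s₃ : PiSum σ i X₃ Y₃ Z₃}
    {sX : PiSum σ j X₁ X₂ X₃} {sY : PiSum σ j Y₁ Y₂ Y₃} {sZ : PiSum σ j Z₁ Z₂ Z₃}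
    (h : M.Inter s₁ s₂ s₃ sX sY sZ) : M.Inter sX sY sZ s₁ s₂ s₃ := by
  unfold Inter at h ⊢
  rw [h, reassoc_of% tensorμ_tensorμ]

/-- The relations can be transported along natural isomorphisms. -/
lemma IsMulti.of_isHom {M N : PreMulti σ P} (hN : N.IsMulti) (τ : M.F ≅ N.F)
    (h : IsHom M N τ.hom) : M.IsMulti where
  isMod i := (hN.isMod i).of_isHom (M := M.proj i) τ (fun s => h i s)
  inter {i j hij X₁ X₂ X₃ Y₁ Y₂ Y₃ Z₁ Z₂ Z₃ s₁ s₂ s₃ sX sY sZ} H := by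
    unfold Inter
    rw [← cancel_mono (τ.hom.app Z₃)]
    have := hN.inter H
    unfold Inter at this
    simp only [Category.assoc, h i s₃, h j sZ]
    rw [tensorHom_comp_tensorHom_assoc, tensorHom_comp_tensorHom_assoc, h, h, h, h,
      ← tensorHom_comp_tensorHom_assoc, ← tensorHom_comp_tensorHom_assoc, this,
      tensorμ_natural_assoc]

end PreMulti

end Pi

/-! ### Change of the target category -/

section Target

open Functor.LaxMonoidal

variable {P : Type u₁} [Category.{v₁} P] [MonoidalCategory P] [SymmetricCategory P]
  {Q : Type u₂} [Category.{v₂} Q] [MonoidalCategory Q] [SymmetricCategory Q]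

/-- The composite with a lax monoidal functor. -/
@[simps]
def PreMod.mapTarget {C : Type u} [Category.{v} C] {σ : SumStr C} (M : PreMod σ Q) (R : Q ⥤ P)
    [R.LaxMonoidal] : PreMod σ P where
  F := M.F ⋙ R
  add s := μ R _ _ ≫ R.map (M.add s)

/-- The relations are equations of morphisms. Once the coherence isomorphisms of `R` are moved to
the front and cancelled, each becomes the image under `R` of the desired equation, and `R` is
faithful. -/
lemma PreMod.IsMod.of_mapTarget {C : Type u} [Category.{v} C] {σ : SumStr C} {M : PreMod σ Q}
    (R : Q ⥤ P) [R.Braided] [R.Faithful] (h : (M.mapTarget R).IsMod) : M.IsMod where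
  nat {x y z x' y' z' s s' p q r} H := by
    have : (μ R _ _ ≫ R.map (M.add s)) ≫ R.map (M.F.map r) =
      (R.map (M.F.map p) ⊗ₘ R.map (M.F.map q)) ≫ μ R _ _ ≫ R.map (M.add s') := h.nat H
    rw [μ_natural_assoc, Category.assoc, cancel_epi, ← R.map_comp, ← R.map_comp] at this
    exact R.map_injective this
  comm {x y z s s'} H := by
    have : μ R _ _ ≫ R.map (M.add s) = (β_ _ _).hom ≫ μ R _ _ ≫ R.map (M.add s') := h.comm H
    rw [← Functor.LaxBraided.braided_assoc, cancel_epi, ← R.map_comp] at this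
    exact R.map_injective this
  assoc {x y t p q z s₁ s₂ s₃ s₄} H := by
    have : (μ R _ _ ≫ R.map (M.add s₁)) ▷ _ ≫ μ R _ _ ≫ R.map (M.add s₂) =
      (α_ _ _ _).hom ≫ _ ◁ (μ R _ _ ≫ R.map (M.add s₃)) ≫ μ R _ _ ≫ R.map (M.add s₄) :=
      h.assoc H
    rw [comp_whiskerRight, MonoidalCategory.whiskerLeft_comp, Category.assoc, Category.assoc,
      μ_natural_left_assoc, μ_natural_right_assoc, ← Functor.LaxMonoidal.associativity_assoc,
      cancel_epi, cancel_epi] at this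
    simp only [← R.map_comp] at this
    exact R.map_injective this

variable {n : ℕ} {C : Fin n → Type u} [∀ i, Category.{v} (C i)] {σ : ∀ i, SumStr (C i)}

namespace PreMulti

/-- The composite with a lax monoidal functor. -/
@[simps]
def mapTarget (M : PreMulti σ Q) (R : Q ⥤ P) [R.LaxMonoidal] : PreMulti σ P where
  F := M.F ⋙ R
  add i _ _ _ s := μ R _ _ ≫ R.map (M.add i s)

lemma IsMulti.of_mapTarget {M : PreMulti σ Q} (R : Q ⥤ P) [R.Braided] [R.Faithful]
    (h : (M.mapTarget R).IsMulti) : M.IsMulti where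
  isMod i := PreMod.IsMod.of_mapTarget (M := M.proj i) R (h.isMod i)
  inter {i j hij X₁ X₂ X₃ Y₁ Y₂ Y₃ Z₁ Z₂ Z₃ s₁ s₂ s₃ sX sY sZ} H := by
    have : ((μ R _ _ ≫ R.map (M.add i s₁)) ⊗ₘ (μ R _ _ ≫ R.map (M.add i s₂))) ≫
        μ R _ _ ≫ R.map (M.add j sZ) =
      tensorμ _ _ _ _ ≫ ((μ R _ _ ≫ R.map (M.add j sX)) ⊗ₘ (μ R _ _ ≫ R.map (M.add j sY))) ≫
        μ R _ _ ≫ R.map (M.add i s₃) := h.inter H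
    rw [← tensorHom_comp_tensorHom_assoc, ← tensorHom_comp_tensorHom_assoc, μ_natural_assoc,
      μ_natural_assoc, reassoc_of% tensorμ_comp_μ_tensorHom_μ_comp_μ R, cancel_epi,
      cancel_epi] at this
    simp only [← R.map_comp] at this
    exact R.map_injective this

/-- Functors of several variables with additivity morphisms can be lifted along equivalences of
symmetric monoidal categories. -/
lemma exists_lift {M : PreMulti σ P} (hM : M.IsMulti) (R : Q ⥤ P) [R.Braided] [R.Full]
    [R.Faithful] [R.EssSurj] :
    ∃ (N : PreMulti σ Q) (_ : N.IsMulti) (τ : N.F ⋙ R ≅ M.F),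
      IsHom (N.mapTarget R) M τ.hom := by
  -- Transport of structure: `N` has chosen preimages as objects, and the preimages of the
  -- conjugates of the morphisms of `M` as morphisms and additivity. The relations hold because `R`
  -- reflects them.
  let e (X : ∀ i, C i) : R.obj (R.objPreimage (M.F.obj X)) ≅ M.F.obj X :=
    R.objObjPreimageIso _
  let N : PreMulti σ Q :=
    { F :=
        { obj := fun X => R.objPreimage (M.F.obj X)
          map := fun {X Y} f => R.preimage ((e X).hom ≫ M.F.map f ≫ (e Y).inv)
          map_id := fun X => R.map_injective (by simp)
          map_comp := fun f g => R.map_injective (by simp) }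
      add := fun i X Y Z s => R.preimage (Functor.OplaxMonoidal.δ R _ _ ≫
        ((e X).hom ⊗ₘ (e Y).hom) ≫ M.add i s ≫ (e Z).inv) }
  let τ : N.F ⋙ R ≅ M.F := NatIso.ofComponents e (fun {X Y} f => by simp [N])
  have hτ : IsHom (N.mapTarget R) M τ.hom := fun i X Y Z s => by
    simp only [N, τ, mapTarget_add, Functor.map_preimage, Category.assoc,
      Functor.Monoidal.μ_δ_assoc, NatIso.ofComponents_hom_app]
    have h {A B : P} (f : A ⟶ B) (g : B ⟶ M.F.obj Z) :
        (f ≫ g ≫ (e Z).inv) ≫ (e Z).hom = f ≫ g := by simp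
    exact h ((e X).hom ⊗ₘ (e Y).hom) (M.add i s)
  exact ⟨N, .of_mapTarget R (hM.of_isHom τ hτ), τ, hτ⟩

end PreMulti

end Target

/-! ### Separating the first variable -/

section Curry

variable {n : ℕ} {C : Fin (n + 1) → Type u} [∀ i, Category.{v} (C i)]

/-- The family with first entry `x` and other entries `t`. -/
def pcons (x : C 0) (t : ∀ i : Fin n, C i.succ) : ∀ i, C i := fun i => Fin.cases x t i

/-- Morphisms between families given by the first and the other components. -/
def consHom {X Y : ∀ i, C i} (p : X 0 ⟶ Y 0) (q : ∀ i : Fin n, X i.succ ⟶ Y i.succ) : X ⟶ Y :=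
  fun i => Fin.cases (motive := fun i => X i ⟶ Y i) p q i

lemma pi_hom_ext_cons {X Y : ∀ i, C i} {f g : X ⟶ Y} (h₀ : f 0 = g 0)
    (h : ∀ i : Fin n, f i.succ = g i.succ) : f = g :=
  funext fun i => Fin.cases h₀ h i

variable {σ : ∀ i, SumStr (C i)}

/-- The sums in the variables other than the first. -/
abbrev tailStr (σ : ∀ i, SumStr (C i)) : ∀ i : Fin n, SumStr (C i.succ) := fun i => σ i.succ

/-- The morphism between families with the same first entry. -/
abbrev tailMap (x : C 0) {t t' : ∀ i : Fin n, C i.succ} (f : t ⟶ t') : pcons x t ⟶ pcons x t' :=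
  consHom (𝟙 x) f

/-- The morphism between families with the same other entries. -/
abbrev headMap {x y : C 0} (f : x ⟶ y) (t : ∀ i : Fin n, C i.succ) : pcons x t ⟶ pcons y t :=
  consHom f (𝟙 t)

lemma tailMap_id (x : C 0) (t : ∀ i : Fin n, C i.succ) : tailMap x (𝟙 t) = 𝟙 (pcons x t) :=
  pi_hom_ext_cons rfl (fun _ => rfl)

lemma tailMap_comp (x : C 0) {t t' t'' : ∀ i : Fin n, C i.succ} (f : t ⟶ t') (g : t' ⟶ t'') :
    tailMap x (f ≫ g) = tailMap x f ≫ tailMap x g :=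
  pi_hom_ext_cons (Category.id_comp (𝟙 x)).symm (fun _ => rfl)

lemma headMap_id (x : C 0) (t : ∀ i : Fin n, C i.succ) : headMap (𝟙 x) t = 𝟙 (pcons x t) :=
  pi_hom_ext_cons rfl (fun _ => rfl)

lemma headMap_comp {x y z : C 0} (f : x ⟶ y) (g : y ⟶ z) (t : ∀ i : Fin n, C i.succ) :
    headMap (f ≫ g) t = headMap f t ≫ headMap g t :=
  pi_hom_ext_cons rfl (fun i => (Category.id_comp (𝟙 (t i))).symm)

lemma headMap_tailMap {x y : C 0} (f : x ⟶ y) {t t' : ∀ i : Fin n, C i.succ} (g : t ⟶ t') :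
    headMap f t ≫ tailMap y g = tailMap x g ≫ headMap f t' :=
  pi_hom_ext_cons ((Category.comp_id f).trans (Category.id_comp f).symm)
    (fun i => (Category.id_comp (g i)).trans (Category.comp_id (g i)).symm)

/-- A sum in the first variable. -/
def headSum {x y z : C 0} (s : (σ 0).Sum x y z) (t : ∀ i : Fin n, C i.succ) :
    PiSum σ 0 (pcons x t) (pcons y t) (pcons z t) where
  s := s
  f j := Fin.cases (fun h => absurd rfl h) (fun i _ => 𝟙 (t i)) j
  g j := Fin.cases (fun h => absurd rfl h) (fun i _ => 𝟙 (t i)) j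

/-- A sum in another variable. -/
def tailSum (x : C 0) {i : Fin n} {t t' t'' : ∀ i : Fin n, C i.succ}
    (s : PiSum (tailStr σ) i t t' t'') :
    PiSum σ i.succ (pcons x t) (pcons x t') (pcons x t'') where
  s := s.s
  f j := Fin.cases (fun _ => 𝟙 x) (fun j h => s.f j (fun e => h (e ▸ rfl))) j
  g j := Fin.cases (fun _ => 𝟙 x) (fun j h => s.g j (fun e => h (e ▸ rfl))) j

section

variable {x y z x' y' z' p q r : C 0} {t t' t'' t₁ t₁' t₁'' : ∀ i : Fin n, C i.succ}

lemma headSum_isNat {s : (σ 0).Sum x y z} {s' : (σ 0).Sum x' y' z'} {p : x ⟶ x'} {q : y ⟶ y'}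
    {r : z ⟶ z'} (h : (σ 0).IsNat s s' p q r) (t : ∀ i : Fin n, C i.succ) :
    (piStr σ 0).IsNat (headSum s t) (headSum s' t) (headMap p t) (headMap q t) (headMap r t) :=
  ⟨h, fun j => Fin.cases (fun h => absurd rfl h) (fun _ _ => rfl) j,
    fun j => Fin.cases (fun h => absurd rfl h) (fun _ _ => rfl) j⟩

lemma headSum_isNat_tailMap (s : (σ 0).Sum x y z) (g : t ⟶ t') :
    (piStr σ 0).IsNat (headSum s t) (headSum s t') (tailMap x g) (tailMap y g) (tailMap z g) :=
  ⟨(σ 0).isNat_id s, fun j => Fin.cases (fun h => absurd rfl h)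
      (fun i _ => (Category.id_comp (g i)).trans (Category.comp_id (g i)).symm) j,
    fun j => Fin.cases (fun h => absurd rfl h)
      (fun i _ => (Category.id_comp (g i)).trans (Category.comp_id (g i)).symm) j⟩

lemma headSum_isComm {s : (σ 0).Sum x y z} {s' : (σ 0).Sum y x z} (h : (σ 0).IsComm s s')
    (t : ∀ i : Fin n, C i.succ) : (piStr σ 0).IsComm (headSum s t) (headSum s' t) :=
  ⟨h, fun j => Fin.cases (fun h => absurd rfl h) (fun _ _ => rfl) j,
    fun j => Fin.cases (fun h => absurd rfl h) (fun _ _ => rfl) j⟩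

lemma headSum_isAssoc {s₁ : (σ 0).Sum x y p} {s₂ : (σ 0).Sum p z r} {s₃ : (σ 0).Sum y z q}
    {s₄ : (σ 0).Sum x q r} (h : (σ 0).IsAssoc s₁ s₂ s₃ s₄) (t : ∀ i : Fin n, C i.succ) :
    (piStr σ 0).IsAssoc (headSum s₁ t) (headSum s₂ t) (headSum s₃ t) (headSum s₄ t) :=
  ⟨h, fun j => Fin.cases (fun h => absurd rfl h) (fun i _ => Category.id_comp (𝟙 (t i))) j,
    fun j => Fin.cases (fun h => absurd rfl h) (fun _ _ => rfl) j,
    fun j => Fin.cases (fun h => absurd rfl h) (fun i _ => (Category.id_comp (𝟙 (t i))).symm) j⟩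

lemma tailSum_isNat {i : Fin n} {s : PiSum (tailStr σ) i t t' t''}
    {s' : PiSum (tailStr σ) i t₁ t₁' t₁''} {p : t ⟶ t₁} {q : t' ⟶ t₁'} {r : t'' ⟶ t₁''}
    (h : (piStr (tailStr σ) i).IsNat s s' p q r) (x : C 0) :
    (piStr σ i.succ).IsNat (tailSum x s) (tailSum x s') (tailMap x p) (tailMap x q)
      (tailMap x r) :=
  ⟨h.1, fun j => Fin.cases (fun _ => rfl) (fun _ _ => h.2.1 _ _) j,
    fun j => Fin.cases (fun _ => rfl) (fun _ _ => h.2.2 _ _) j⟩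

lemma tailSum_isNat_headMap {i : Fin n} (s : PiSum (tailStr σ) i t t' t'') (f : x ⟶ y) :
    (piStr σ i.succ).IsNat (tailSum x s) (tailSum y s) (headMap f t) (headMap f t')
      (headMap f t'') :=
  ⟨(σ i.succ).isNat_id s.s, fun j => Fin.cases (fun _ => (Category.id_comp f).trans (Category.comp_id f).symm)
      (fun _ _ => (Category.comp_id _).trans (Category.id_comp _).symm) j,
    fun j => Fin.cases (fun _ => (Category.id_comp f).trans (Category.comp_id f).symm)
      (fun _ _ => (Category.comp_id _).trans (Category.id_comp _).symm) j⟩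

lemma tailSum_isComm {i : Fin n} {s : PiSum (tailStr σ) i t t' t''}
    {s' : PiSum (tailStr σ) i t' t t''}
    (h : (piStr (tailStr σ) i).IsComm s s') (x : C 0) :
    (piStr σ i.succ).IsComm (tailSum x s) (tailSum x s') :=
  ⟨h.1, fun j => Fin.cases (fun _ => rfl) (fun _ _ => h.2.1 _ _) j,
    fun j => Fin.cases (fun _ => rfl) (fun _ _ => h.2.2 _ _) j⟩

lemma tailSum_isAssoc {i : Fin n} {s₁ : PiSum (tailStr σ) i t t' t₁}
    {s₂ : PiSum (tailStr σ) i t₁ t'' t₁''} {s₃ : PiSum (tailStr σ) i t' t'' t₁'}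
    {s₄ : PiSum (tailStr σ) i t t₁' t₁''}
    (h : (piStr (tailStr σ) i).IsAssoc s₁ s₂ s₃ s₄) (x : C 0) :
    (piStr σ i.succ).IsAssoc (tailSum x s₁) (tailSum x s₂) (tailSum x s₃) (tailSum x s₄) :=
  ⟨h.1, fun j => Fin.cases (fun _ => Category.id_comp (𝟙 x)) (fun _ _ => h.2.1 _ _) j,
    fun j => Fin.cases (fun _ => rfl) (fun _ _ => h.2.2.1 _ _) j,
    fun j => Fin.cases (fun _ => (Category.id_comp (𝟙 x)).symm) (fun _ _ => h.2.2.2 _ _) j⟩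

/-- For this grid the interchange relation says that additivity in a later variable is compatible
with additivity in the first, as required of a morphism of `Mod (σ 0) P`. -/
lemma isGrid_tailSum_headSum {i : Fin n} (s : PiSum (tailStr σ) i t t' t'')
    (s' : (σ 0).Sum x y z) :
    IsGrid σ i.succ 0 (Fin.succ_ne_zero i) (tailSum x s) (tailSum y s) (tailSum z s)
      (headSum s' t) (headSum s' t') (headSum s' t'') where
  nat_f := (σ i.succ).isNat_id s.s
  nat_g := (σ i.succ).isNat_id s.s
  nat_f' := (σ 0).isNat_id s'
  nat_g' := (σ 0).isNat_id s'
  ff k := Fin.cases (fun _ h => absurd rfl h)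
    (fun _ _ _ => (Category.comp_id _).trans (Category.id_comp _).symm) k
  fg k := Fin.cases (fun _ h => absurd rfl h)
    (fun _ _ _ => (Category.comp_id _).trans (Category.id_comp _).symm) k
  gf k := Fin.cases (fun _ h => absurd rfl h)
    (fun _ _ _ => (Category.comp_id _).trans (Category.id_comp _).symm) k
  gg k := Fin.cases (fun _ h => absurd rfl h)
    (fun _ _ _ => (Category.comp_id _).trans (Category.id_comp _).symm) k

lemma isGrid_tailSum {i j : Fin n} {hij : i ≠ j}
    {X₁ X₂ X₃ Y₁ Y₂ Y₃ Z₁ Z₂ Z₃ : ∀ k : Fin n, C k.succ}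
    {s₁ : PiSum (tailStr σ) i X₁ Y₁ Z₁} {s₂ : PiSum (tailStr σ) i X₂ Y₂ Z₂}
    {s₃ : PiSum (tailStr σ) i X₃ Y₃ Z₃} {sX : PiSum (tailStr σ) j X₁ X₂ X₃}
    {sY : PiSum (tailStr σ) j Y₁ Y₂ Y₃} {sZ : PiSum (tailStr σ) j Z₁ Z₂ Z₃}
    (h : IsGrid (tailStr σ) i j hij s₁ s₂ s₃ sX sY sZ) (x : C 0) :
    IsGrid σ i.succ j.succ (fun e => hij (Fin.succ_injective _ e)) (tailSum x s₁) (tailSum x s₂)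
      (tailSum x s₃) (tailSum x sX) (tailSum x sY) (tailSum x sZ) where
  nat_f := h.nat_f
  nat_g := h.nat_g
  nat_f' := h.nat_f'
  nat_g' := h.nat_g'
  ff k := Fin.cases (fun _ _ => rfl) (fun _ _ _ => h.ff _ _ _) k
  gf k := Fin.cases (fun _ _ => rfl) (fun _ _ _ => h.gf _ _ _) k
  fg k := Fin.cases (fun _ _ => rfl) (fun _ _ _ => h.fg _ _ _) k
  gg k := Fin.cases (fun _ _ => rfl) (fun _ _ _ => h.gg _ _ _) k

end

variable {P : Type u₁} [Category.{v₁} P] [MonoidalCategory P] [SymmetricCategory P]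

namespace PreMulti

/-- The restriction to the first variable. -/
@[simps F_obj F_map add]
def head (M : PreMulti σ P) (t : ∀ i : Fin n, C i.succ) : PreMod (σ 0) P where
  F :=
    { obj := fun x => M.F.obj (pcons x t)
      map := fun f => M.F.map (headMap f t)
      map_id := fun x => by rw [headMap_id, M.F.map_id]
      map_comp := fun f g => by rw [headMap_comp, M.F.map_comp] }
  add s := M.add 0 (headSum s t)

lemma IsMulti.head {M : PreMulti σ P} (h : M.IsMulti) (t : ∀ i : Fin n, C i.succ) :
    (M.head t).IsMod where
  nat H := (h.isMod 0).nat (headSum_isNat H t)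
  comm H := (h.isMod 0).comm (headSum_isComm H t)
  assoc H := (h.isMod 0).assoc (headSum_isAssoc H t)

/-- A functor of `n + 1` variables as a functor of `n` variables with values in functors of the
first variable. -/
def curry (M : PreMulti σ P) (h : M.IsMulti) : PreMulti (tailStr σ) (Mod (σ 0) P) where
  F :=
    { obj := fun t => ⟨M.head t, h.head t⟩
      map := fun {t t'} g => Mod.homMk
        { app := fun x => M.F.map (tailMap x g)
          naturality := fun x y f => (M.F.map_comp _ _).symm.trans
            ((congr_arg M.F.map (headMap_tailMap f g)).trans (M.F.map_comp _ _)) }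
        (fun s => (h.isMod 0).nat (headSum_isNat_tailMap s g))
      map_id := fun t => Mod.hom_ext fun x =>
        (congr_arg M.F.map (tailMap_id x t)).trans (M.F.map_id _)
      map_comp := fun f g => Mod.hom_ext fun x =>
        (congr_arg M.F.map (tailMap_comp x f g)).trans (M.F.map_comp _ _) }
  add i {t t' t''} s := Mod.homMk
    { app := fun x => M.add i.succ (tailSum x s)
      naturality := fun x y f => ((h.isMod i.succ).nat (tailSum_isNat_headMap s f)).symm }
    (fun s' => by
      -- The interchange relation with the first variable makes the family over `x` a morphism of
      -- `Mod (σ 0) P`.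
      have := h.inter (isGrid_tailSum_headSum s s')
      unfold Inter at this
      exact ((Category.assoc _ _ _).trans this.symm))

lemma curry_isMulti {M : PreMulti σ P} (h : M.IsMulti) : (M.curry h).IsMulti where
  isMod i :=
    { nat := fun H => Mod.hom_ext fun x => (h.isMod i.succ).nat (tailSum_isNat H x)
      comm := fun H => Mod.hom_ext fun x => (h.isMod i.succ).comm (tailSum_isComm H x)
      assoc := fun H => Mod.assoc_eq_iff.2 fun x => (h.isMod i.succ).assoc (tailSum_isAssoc H x) }
  inter H := Mod.inter_eq_iff.2 fun x => h.inter (isGrid_tailSum H x)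

end PreMulti

end Curry

/-- Associativity survives precomposition with morphisms into the summands. It serves additivity
morphisms defined by first moving the other entries of the summands to those of the sum. -/
lemma tensor_assoc_comp {P : Type u₁} [Category.{v₁} P] [MonoidalCategory P] 
    {x y t p q z x' y' t' : P} {a₁ : x ⊗ y ⟶ p} {a₂ : p ⊗ t ⟶ z}
    {a₃ : y ⊗ t ⟶ q} {a₄ : x ⊗ q ⟶ z} (h : a₁ ▷ t ≫ a₂ = (α_ x y t).hom ≫ x ◁ a₃ ≫ a₄)
    (f : x' ⟶ x) (g : y' ⟶ y) (k : t' ⟶ t) :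
    (((f ⊗ₘ g) ≫ a₁) ⊗ₘ k) ≫ a₂ = (α_ x' y' t').hom ≫ (f ⊗ₘ ((g ⊗ₘ k) ≫ a₃)) ≫ a₄ := by
  have e₁ : (((f ⊗ₘ g) ≫ a₁) ⊗ₘ k) = ((f ⊗ₘ g) ⊗ₘ k) ≫ a₁ ▷ t := by
    rw [← tensorHom_id, tensorHom_comp_tensorHom, Category.comp_id]
  have e₂ : (f ⊗ₘ ((g ⊗ₘ k) ≫ a₃)) = (f ⊗ₘ (g ⊗ₘ k)) ≫ x ◁ a₃ := by
    rw [← id_tensorHom, tensorHom_comp_tensorHom, Category.comp_id]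
  rw [e₁, e₂, Category.assoc, h, associator_naturality_assoc, Category.assoc]

/-! ### Recombining the first variable with the others. -/

section Uncurry

variable {n : ℕ} {C : Fin (n + 1) → Type u} [∀ i, Category.{v} (C i)] {σ : ∀ i, SumStr (C i)}
  {P : Type u₁} [Category.{v₁} P] [MonoidalCategory P] [SymmetricCategory P]

namespace PreMulti

section Values

variable (G : PreMulti (tailStr σ) (Mod (σ 0) P))

/-- The value of a functor with values in functors. -/
def val (t : ∀ i : Fin n, C i.succ) (x : C 0) : P := (G.F.obj t).F.obj x

/-- The action of morphisms in the first variable. -/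
def hmap (t : ∀ i : Fin n, C i.succ) {x y : C 0} (f : x ⟶ y) : G.val t x ⟶ G.val t y :=
  (G.F.obj t).F.map f

/-- The action of morphisms in the other variables. -/
def tmap {t t' : ∀ i : Fin n, C i.succ} (f : t ⟶ t') (x : C 0) : G.val t x ⟶ G.val t' x :=
  (Mod.Hom.nt (G.F.map f)).app x

/-- The additivity morphism in the first variable. -/
def hadd (t : ∀ i : Fin n, C i.succ) {x y z : C 0} (s : (σ 0).Sum x y z) :
    G.val t x ⊗ G.val t y ⟶ G.val t z :=
  (G.F.obj t).add s

/-- The additivity morphism in another variable. -/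
def tadd {i : Fin n} {t t' t'' : ∀ i : Fin n, C i.succ} (s : PiSum (tailStr σ) i t t' t'')
    (x : C 0) : G.val t x ⊗ G.val t' x ⟶ G.val t'' x :=
  (Mod.Hom.nt (G.add i s)).app x

variable {t t' t'' t₁ t₁' t₁'' : ∀ i : Fin n, C i.succ} {x y z x' y' z' : C 0}

lemma hmap_id : G.hmap t (𝟙 x) = 𝟙 _ := (G.F.obj t).F.map_id x

lemma hmap_comp (f : x ⟶ y) (g : y ⟶ z) : G.hmap t (f ≫ g) = G.hmap t f ≫ G.hmap t g :=
  (G.F.obj t).F.map_comp f g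

lemma tmap_id : G.tmap (𝟙 t) x = 𝟙 _ := by
  unfold tmap
  rw [G.F.map_id]
  rfl

lemma tmap_comp (f : t ⟶ t') (g : t' ⟶ t'') : G.tmap (f ≫ g) x = G.tmap f x ≫ G.tmap g x := by
  unfold tmap
  rw [G.F.map_comp]
  rfl

lemma tmap_comp_assoc (f : t ⟶ t') (g : t' ⟶ t'') {A : P} (k : G.val t'' x ⟶ A) :
    G.tmap (f ≫ g) x ≫ k = G.tmap f x ≫ G.tmap g x ≫ k := by
  rw [tmap_comp, Category.assoc]

lemma hmap_tmap (f : x ⟶ y) (g : t ⟶ t') :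
    G.hmap t f ≫ G.tmap g y = G.tmap g x ≫ G.hmap t' f :=
  (Mod.Hom.nt (G.F.map g)).naturality f

lemma hmap_tmap_assoc (f : x ⟶ y) (g : t ⟶ t') {A : P} (k : G.val t' y ⟶ A) :
    G.hmap t f ≫ G.tmap g y ≫ k = G.tmap g x ≫ G.hmap t' f ≫ k := by
  rw [← Category.assoc, hmap_tmap, Category.assoc]

lemma hadd_tmap (s : (σ 0).Sum x y z) (g : t ⟶ t') :
    G.hadd t s ≫ G.tmap g z = (G.tmap g x ⊗ₘ G.tmap g y) ≫ G.hadd t' s :=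
  (G.F.map g).isHom s

lemma hadd_tmap_assoc (s : (σ 0).Sum x y z) (g : t ⟶ t') {A : P} (k : G.val t' z ⟶ A) :
    G.hadd t s ≫ G.tmap g z ≫ k = (G.tmap g x ⊗ₘ G.tmap g y) ≫ G.hadd t' s ≫ k := by
  rw [← Category.assoc, hadd_tmap, Category.assoc]

lemma tadd_hmap {i : Fin n} (s : PiSum (tailStr σ) i t t' t'') (f : x ⟶ y) :
    G.tadd s x ≫ G.hmap t'' f = (G.hmap t f ⊗ₘ G.hmap t' f) ≫ G.tadd s y :=
  ((Mod.Hom.nt (G.add i s)).naturality f).symm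

/-- Additivity in a later variable is a morphism of `Mod (σ 0) P`; read backwards, this is the
interchange relation with the first variable. -/
lemma tadd_hadd {i : Fin n} (s : PiSum (tailStr σ) i t t' t'') (s' : (σ 0).Sum x y z) :
    (G.tadd s x ⊗ₘ G.tadd s y) ≫ G.hadd t'' s' =
      tensorμ _ _ _ _ ≫ (G.hadd t s' ⊗ₘ G.hadd t' s') ≫ G.tadd s z :=
  ((G.add i s).isHom s').symm.trans (Category.assoc _ _ _)

lemma hadd_hmap {s : (σ 0).Sum x y z} {s' : (σ 0).Sum x' y' z'} {p : x ⟶ x'} {q : y ⟶ y'}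
    {r : z ⟶ z'} (H : (σ 0).IsNat s s' p q r) :
    G.hadd t s ≫ G.hmap t r = (G.hmap t p ⊗ₘ G.hmap t q) ≫ G.hadd t s' :=
  (G.F.obj t).isMod.nat H

lemma IsMulti.tadd_tmap {G : PreMulti (tailStr σ) (Mod (σ 0) P)} (hG : G.IsMulti) {i : Fin n}
    {s : PiSum (tailStr σ) i t t' t''} {s' : PiSum (tailStr σ) i t₁ t₁' t₁''} {p : t ⟶ t₁}
    {q : t' ⟶ t₁'} {r : t'' ⟶ t₁''} (H : (piStr (tailStr σ) i).IsNat s s' p q r) :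
    G.tadd s x ≫ G.tmap r x = (G.tmap p x ⊗ₘ G.tmap q x) ≫ G.tadd s' x :=
  congr_arg (fun f => (Mod.Hom.nt f).app x) ((hG.isMod i).nat H)

lemma IsMulti.tadd_tmap_assoc {G : PreMulti (tailStr σ) (Mod (σ 0) P)} (hG : G.IsMulti) {i : Fin n}
    {s : PiSum (tailStr σ) i t t' t''} {s' : PiSum (tailStr σ) i t₁ t₁' t₁''} {p : t ⟶ t₁}
    {q : t' ⟶ t₁'} {r : t'' ⟶ t₁''} (H : (piStr (tailStr σ) i).IsNat s s' p q r) {A : P}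
    (k : G.val t₁'' x ⟶ A) :
    G.tadd s x ≫ G.tmap r x ≫ k = (G.tmap p x ⊗ₘ G.tmap q x) ≫ G.tadd s' x ≫ k := by
  rw [← Category.assoc, hG.tadd_tmap H, Category.assoc]

lemma hadd_comm {s : (σ 0).Sum x y z} {s' : (σ 0).Sum y x z} (H : (σ 0).IsComm s s') :
    G.hadd t s = (β_ _ _).hom ≫ G.hadd t s' :=
  (G.F.obj t).isMod.comm H

lemma hadd_assoc {p q w : C 0} {s₁ : (σ 0).Sum x y p} {s₂ : (σ 0).Sum p w z}
    {s₃ : (σ 0).Sum y w q} {s₄ : (σ 0).Sum x q z} (H : (σ 0).IsAssoc s₁ s₂ s₃ s₄) :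
    G.hadd t s₁ ▷ _ ≫ G.hadd t s₂ = (α_ _ _ _).hom ≫ _ ◁ G.hadd t s₃ ≫ G.hadd t s₄ :=
  (G.F.obj t).isMod.assoc H

lemma IsMulti.tadd_comm {G : PreMulti (tailStr σ) (Mod (σ 0) P)} (hG : G.IsMulti) {i : Fin n}
    {s : PiSum (tailStr σ) i t t' t''} {s' : PiSum (tailStr σ) i t' t t''}
    (H : (piStr (tailStr σ) i).IsComm s s') :
    G.tadd s x = (β_ _ _).hom ≫ G.tadd s' x :=
  congr_arg (fun f => (Mod.Hom.nt f).app x) ((hG.isMod i).comm H)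

lemma IsMulti.tadd_assoc {G : PreMulti (tailStr σ) (Mod (σ 0) P)} (hG : G.IsMulti) {i : Fin n}
    {s₁ : PiSum (tailStr σ) i t t' t₁}
    {s₂ : PiSum (tailStr σ) i t₁ t'' t₁''} {s₃ : PiSum (tailStr σ) i t' t'' t₁'}
    {s₄ : PiSum (tailStr σ) i t t₁' t₁''}
    (H : (piStr (tailStr σ) i).IsAssoc s₁ s₂ s₃ s₄) :
    G.tadd s₁ x ▷ _ ≫ G.tadd s₂ x = (α_ _ _ _).hom ≫ _ ◁ G.tadd s₃ x ≫ G.tadd s₄ x :=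
  Mod.assoc_eq_iff.1 ((hG.isMod i).assoc H) x

end Values

/-- The families of the entries other than the first. -/
abbrev tl (X : ∀ i, C i) : ∀ i : Fin n, C i.succ := fun i => X i.succ

/-- The components of a morphism other than the first. -/
abbrev tlMap {X Y : ∀ i, C i} (f : X ⟶ Y) : tl X ⟶ tl Y := fun i => f i.succ

/-- The sum in the other variables given by a sum in such a variable. -/
def untail {i : Fin n} {X Y Z : ∀ i, C i} (s : PiSum σ i.succ X Y Z) :
    PiSum (tailStr σ) i (tl X) (tl Y) (tl Z) where
  s := s.s
  f j h := s.f j.succ (fun e => h (Fin.succ_injective _ e))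
  g j h := s.g j.succ (fun e => h (Fin.succ_injective _ e))

/-- The morphism from the first summand to a sum in the first variable. -/
abbrev headF {X Y Z : ∀ i, C i} (s : PiSum σ 0 X Y Z) : tl X ⟶ tl Z :=
  fun i => s.f i.succ (Fin.succ_ne_zero i)

/-- The morphism from the second summand to a sum in the first variable. -/
abbrev headG {X Y Z : ∀ i, C i} (s : PiSum σ 0 X Y Z) : tl Y ⟶ tl Z :=
  fun i => s.g i.succ (Fin.succ_ne_zero i)

/-- The functor of `n + 1` variables given by a functor of `n` variables with values in functors
of the first variable. -/
def uncurry (G : PreMulti (tailStr σ) (Mod (σ 0) P)) : PreMulti σ P where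
  F :=
    { obj := fun X => G.val (tl X) (X 0)
      map := fun {X Y} f => G.tmap (tlMap f) (X 0) ≫ G.hmap (tl Y) (f 0)
      map_id := fun X => by
        refine (congr_arg₂ _ (G.tmap_id (t := tl X)) G.hmap_id).trans (Category.comp_id _)
      map_comp := fun {X Y Z} f g => by
        refine (congr_arg₂ _ (G.tmap_comp (tlMap f) (tlMap g))
          (G.hmap_comp (f 0) (g 0))).trans ?_
        rw [Category.assoc, Category.assoc, hmap_tmap_assoc] }
  add i := Fin.cases
    (motive := fun i => ∀ {X Y Z : ∀ j, C j}, PiSum σ i X Y Z →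
      (G.val (tl X) (X 0) ⊗ G.val (tl Y) (Y 0) ⟶ G.val (tl Z) (Z 0)))
    (fun {X Y Z} s =>
      (G.tmap (headF s) (X 0) ⊗ₘ
        G.tmap (headG s) (Y 0)) ≫ G.hadd (tl Z) s.s)
    (fun i {X Y Z} s =>
      (G.hmap (tl X) (s.f 0 (Fin.succ_ne_zero i).symm) ⊗ₘ
        G.hmap (tl Y) (s.g 0 (Fin.succ_ne_zero i).symm)) ≫ G.tadd (untail s) (Z 0)) i

/-- All entries are pushed forward to those of the last corner `Z₃` by naturality. What is left is
`tadd_hadd`. -/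
lemma uncurry_inter {G : PreMulti (tailStr σ) (Mod (σ 0) P)} (hG : G.IsMulti) {i : Fin n}
    {X₁ X₂ X₃ Y₁ Y₂ Y₃ Z₁ Z₂ Z₃ : ∀ k, C k}
    {s₁ : PiSum σ i.succ X₁ Y₁ Z₁} {s₂ : PiSum σ i.succ X₂ Y₂ Z₂} {s₃ : PiSum σ i.succ X₃ Y₃ Z₃}
    {sX : PiSum σ 0 X₁ X₂ X₃} {sY : PiSum σ 0 Y₁ Y₂ Y₃} {sZ : PiSum σ 0 Z₁ Z₂ Z₃}
    (H : IsGrid σ i.succ 0 (Fin.succ_ne_zero i) s₁ s₂ s₃ sX sY sZ) :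
    G.uncurry.Inter s₁ s₂ s₃ sX sY sZ := by
  have h₁ : (piStr (tailStr σ) i).IsNat (untail s₁) (untail s₃)
      (headF sX) (headF sY)
      (headF sZ) :=
    ⟨H.nat_f, fun _ _ => H.ff _ _ _, fun _ _ => H.gf _ _ _⟩
  have h₂ : (piStr (tailStr σ) i).IsNat (untail s₂) (untail s₃)
      (headG sX) (headG sY)
      (headG sZ) :=
    ⟨H.nat_g, fun _ _ => H.fg _ _ _, fun _ _ => H.gg _ _ _⟩
  change (((G.hmap (tl X₁) _ ⊗ₘ G.hmap (tl Y₁) _) ≫ G.tadd (untail s₁) (Z₁ 0)) ⊗ₘ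
      ((G.hmap (tl X₂) _ ⊗ₘ G.hmap (tl Y₂) _) ≫ G.tadd (untail s₂) (Z₂ 0))) ≫
      (G.tmap _ _ ⊗ₘ G.tmap _ _) ≫ G.hadd (tl Z₃) sZ.s =
    tensorμ (G.val (tl X₁) (X₁ 0)) (G.val (tl Y₁) (Y₁ 0)) (G.val (tl X₂) (X₂ 0))
      (G.val (tl Y₂) (Y₂ 0)) ≫ (((G.tmap _ _ ⊗ₘ G.tmap _ _) ≫ G.hadd (tl X₃) sX.s) ⊗ₘ
      ((G.tmap _ _ ⊗ₘ G.tmap _ _) ≫ G.hadd (tl Y₃) sY.s)) ≫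
      (G.hmap _ _ ⊗ₘ G.hmap _ _) ≫ G.tadd (untail s₃) (Z₃ 0)
  rw [tensorHom_comp_tensorHom_assoc, Category.assoc, Category.assoc, hG.tadd_tmap h₁,
    hG.tadd_tmap h₂, tensorHom_comp_tensorHom_assoc, tensorHom_comp_tensorHom_assoc,
    ← tensorHom_comp_tensorHom_assoc, tadd_hadd, tensorμ_natural_assoc,
    tensorHom_comp_tensorHom_assoc, tensorHom_comp_tensorHom_assoc, Category.assoc,
    Category.assoc, G.hadd_hmap H.nat_f', G.hadd_hmap H.nat_g', tensorHom_comp_tensorHom_assoc,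
    tensorHom_comp_tensorHom_assoc]
  simp only [hmap_tmap]

/-- Uncurried additivity first moves the tails of both summands to the tail of the sum, then adds.
The relations in the first variable thus combine those of the single functor `G.F.obj (tl Z)` with
the compatibilities between the transition morphisms, here `e₁` and `e₂`. -/
lemma uncurry_nat_zero (G : PreMulti (tailStr σ) (Mod (σ 0) P)) {X Y Z X' Y' Z' : ∀ i, C i}
    {s : PiSum σ 0 X Y Z} {s' : PiSum σ 0 X' Y' Z'} {p : X ⟶ X'} {q : Y ⟶ Y'} {r : Z ⟶ Z'}
    (H : (piStr σ 0).IsNat s s' p q r) :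
    ((G.tmap (headF s) _ ⊗ₘ
        G.tmap (headG s) _) ≫ G.hadd (tl Z) s.s) ≫
        G.tmap (tlMap r) (Z 0) ≫ G.hmap (tl Z') (r 0) =
      ((G.tmap (tlMap p) _ ≫ G.hmap (tl X') (p 0)) ⊗ₘ
          (G.tmap (tlMap q) _ ≫ G.hmap (tl Y') (q 0))) ≫
        (G.tmap (headF s') _ ⊗ₘ
        G.tmap (headG s') _) ≫ G.hadd (tl Z') s'.s := by
  have e₁ : ((headF s) ≫ tlMap r) =
      tlMap p ≫ (headF s') :=
    funext fun i => H.2.1 i.succ (Fin.succ_ne_zero i)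
  have e₂ : ((headG s) ≫ tlMap r) =
      tlMap q ≫ (headG s') :=
    funext fun i => H.2.2 i.succ (Fin.succ_ne_zero i)
  rw [tensorHom_comp_tensorHom_assoc, Category.assoc, hadd_tmap_assoc, G.hadd_hmap H.1,
    tensorHom_comp_tensorHom_assoc, tensorHom_comp_tensorHom_assoc]
  simp only [Category.assoc, hmap_tmap]
  rw [← tmap_comp_assoc, ← tmap_comp_assoc, ← tmap_comp_assoc, ← tmap_comp_assoc, e₁, e₂]

lemma uncurry_comm_zero (G : PreMulti (tailStr σ) (Mod (σ 0) P)) {X Y Z : ∀ i, C i}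
    {s : PiSum σ 0 X Y Z} {s' : PiSum σ 0 Y X Z} (H : (piStr σ 0).IsComm s s') :
    ((G.tmap (headF s) _ ⊗ₘ
        G.tmap (headG s) _) ≫ G.hadd (tl Z) s.s) =
      (β_ _ _).hom ≫ (G.tmap (headF s') _ ⊗ₘ
        G.tmap (headG s') _) ≫ G.hadd (tl Z) s'.s := by
  have e₁ : (headF s) =
      (headG s') :=
    funext fun i => H.2.1 i.succ (Fin.succ_ne_zero i)
  have e₂ : (headG s) =
      (headF s') :=
    funext fun i => H.2.2 i.succ (Fin.succ_ne_zero i)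
  rw [G.hadd_comm H.1, BraidedCategory.braiding_naturality_assoc, e₁, e₂]

lemma uncurry_assoc_zero (G : PreMulti (tailStr σ) (Mod (σ 0) P)) {X Y T U V Z : ∀ i, C i}
    {s₁ : PiSum σ 0 X Y U} {s₂ : PiSum σ 0 U T Z} {s₃ : PiSum σ 0 Y T V} {s₄ : PiSum σ 0 X V Z}
    (H : (piStr σ 0).IsAssoc s₁ s₂ s₃ s₄) :
    ((G.tmap (headF s₁) (X 0) ⊗ₘ
        G.tmap (headG s₁) (Y 0)) ≫ G.hadd (tl U) s₁.s) ▷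
        G.val (tl T) (T 0) ≫
      (G.tmap (headF s₂) _ ⊗ₘ
        G.tmap (headG s₂) _) ≫ G.hadd (tl Z) s₂.s =
      (α_ _ _ _).hom ≫ G.val (tl X) (X 0) ◁
        ((G.tmap (headF s₃) _ ⊗ₘ
        G.tmap (headG s₃) _) ≫ G.hadd (tl V) s₃.s) ≫
      (G.tmap (headF s₄) _ ⊗ₘ
        G.tmap (headG s₄) _) ≫ G.hadd (tl Z) s₄.s := by
  have e₁ : ((headF s₁) ≫
      (headF s₂)) =
      (headF s₄) :=
    funext fun i => H.2.1 i.succ (Fin.succ_ne_zero i)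
  have e₂ : ((headG s₁) ≫
      (headF s₂)) =
      (headF s₃) ≫
      (headG s₄) :=
    funext fun i => H.2.2.1 i.succ (Fin.succ_ne_zero i)
  have e₃ : (headG s₂) =
      (headG s₃) ≫
      (headG s₄) :=
    funext fun i => H.2.2.2 i.succ (Fin.succ_ne_zero i)
  rw [whiskerRight_comp_tensorHom_assoc, whiskerLeft_comp_tensorHom_assoc, Category.assoc,
    Category.assoc, hadd_tmap, hadd_tmap, tensorHom_comp_tensorHom_assoc,
    tensorHom_comp_tensorHom_assoc, ← tmap_comp, ← tmap_comp, ← tmap_comp, ← tmap_comp,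
    tensor_assoc_comp (G.hadd_assoc H.1), e₁, e₂, e₃]

/-- For a later variable the roles are reversed: the first entries are moved to that of the sum, and
the relation of `G` is used pointwise there. -/
lemma uncurry_nat_succ {G : PreMulti (tailStr σ) (Mod (σ 0) P)} (hG : G.IsMulti) {i : Fin n}
    {X Y Z X' Y' Z' : ∀ i, C i}
    {s : PiSum σ i.succ X Y Z} {s' : PiSum σ i.succ X' Y' Z'} {p : X ⟶ X'} {q : Y ⟶ Y'}
    {r : Z ⟶ Z'} (H : (piStr σ i.succ).IsNat s s' p q r) :
    ((G.hmap (tl X) (s.f 0 (Fin.succ_ne_zero i).symm) ⊗ₘ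
        G.hmap (tl Y) (s.g 0 (Fin.succ_ne_zero i).symm)) ≫ G.tadd (untail s) (Z 0)) ≫
        G.tmap (tlMap r) (Z 0) ≫ G.hmap (tl Z') (r 0) =
      ((G.tmap (tlMap p) _ ≫ G.hmap (tl X') (p 0)) ⊗ₘ
          (G.tmap (tlMap q) _ ≫ G.hmap (tl Y') (q 0))) ≫
        (G.hmap (tl X') (s'.f 0 (Fin.succ_ne_zero i).symm) ⊗ₘ
        G.hmap (tl Y') (s'.g 0 (Fin.succ_ne_zero i).symm)) ≫ G.tadd (untail s') (Z' 0) := by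
  have h : (piStr (tailStr σ) i).IsNat (untail s) (untail s') (tlMap p) (tlMap q) (tlMap r) :=
    ⟨H.1, fun _ _ => H.2.1 _ _, fun _ _ => H.2.2 _ _⟩
  rw [Category.assoc, tensorHom_comp_tensorHom_assoc, Category.assoc, Category.assoc,
    hG.tadd_tmap_assoc h, tadd_hmap, tensorHom_comp_tensorHom_assoc,
    tensorHom_comp_tensorHom_assoc]
  simp only [Category.assoc, hmap_tmap_assoc, ← hmap_comp, H.2.1, H.2.2]

lemma uncurry_comm_succ {G : PreMulti (tailStr σ) (Mod (σ 0) P)} (hG : G.IsMulti) {i : Fin n}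
    {X Y Z : ∀ i, C i} {s : PiSum σ i.succ X Y Z} {s' : PiSum σ i.succ Y X Z}
    (H : (piStr σ i.succ).IsComm s s') :
    ((G.hmap (tl X) (s.f 0 (Fin.succ_ne_zero i).symm) ⊗ₘ
        G.hmap (tl Y) (s.g 0 (Fin.succ_ne_zero i).symm)) ≫ G.tadd (untail s) (Z 0)) =
      (β_ _ _).hom ≫ (G.hmap (tl Y) (s'.f 0 (Fin.succ_ne_zero i).symm) ⊗ₘ
        G.hmap (tl X) (s'.g 0 (Fin.succ_ne_zero i).symm)) ≫ G.tadd (untail s') (Z 0) := by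
  have h : (piStr (tailStr σ) i).IsComm (untail s) (untail s') :=
    ⟨H.1, fun _ _ => H.2.1 _ _, fun _ _ => H.2.2 _ _⟩
  rw [hG.tadd_comm h, BraidedCategory.braiding_naturality_assoc, H.2.1, H.2.2]

lemma uncurry_assoc_succ {G : PreMulti (tailStr σ) (Mod (σ 0) P)} (hG : G.IsMulti) {i : Fin n}
    {X Y T U V Z : ∀ i, C i}
    {s₁ : PiSum σ i.succ X Y U} {s₂ : PiSum σ i.succ U T Z} {s₃ : PiSum σ i.succ Y T V}
    {s₄ : PiSum σ i.succ X V Z} (H : (piStr σ i.succ).IsAssoc s₁ s₂ s₃ s₄) :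
    ((G.hmap (tl X) (s₁.f 0 (Fin.succ_ne_zero i).symm) ⊗ₘ
        G.hmap (tl Y) (s₁.g 0 (Fin.succ_ne_zero i).symm)) ≫ G.tadd (untail s₁) (U 0)) ▷
        G.val (tl T) (T 0) ≫
      (G.hmap (tl U) (s₂.f 0 (Fin.succ_ne_zero i).symm) ⊗ₘ
        G.hmap (tl T) (s₂.g 0 (Fin.succ_ne_zero i).symm)) ≫ G.tadd (untail s₂) (Z 0) =
      (α_ _ _ _).hom ≫ G.val (tl X) (X 0) ◁
        ((G.hmap (tl Y) (s₃.f 0 (Fin.succ_ne_zero i).symm) ⊗ₘ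
        G.hmap (tl T) (s₃.g 0 (Fin.succ_ne_zero i).symm)) ≫ G.tadd (untail s₃) (V 0)) ≫
      (G.hmap (tl X) (s₄.f 0 (Fin.succ_ne_zero i).symm) ⊗ₘ
        G.hmap (tl V) (s₄.g 0 (Fin.succ_ne_zero i).symm)) ≫ G.tadd (untail s₄) (Z 0) := by
  have h : (piStr (tailStr σ) i).IsAssoc (untail s₁) (untail s₂) (untail s₃) (untail s₄) :=
    ⟨H.1, fun _ _ => H.2.1 _ _, fun _ _ => H.2.2.1 _ _, fun _ _ => H.2.2.2 _ _⟩
  rw [whiskerRight_comp_tensorHom_assoc, whiskerLeft_comp_tensorHom_assoc, Category.assoc,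
    Category.assoc, tadd_hmap, tadd_hmap, tensorHom_comp_tensorHom_assoc,
    tensorHom_comp_tensorHom_assoc, ← hmap_comp, ← hmap_comp, ← hmap_comp, ← hmap_comp,
    tensor_assoc_comp (hG.tadd_assoc h), H.2.1, H.2.2.1, H.2.2.2]

/-- Everything is moved to the first entry of the last corner, where the relation is the value at
`Z₃ 0` of the interchange relation in `Mod (σ 0) P`. -/
lemma uncurry_inter_succ {G : PreMulti (tailStr σ) (Mod (σ 0) P)} (hG : G.IsMulti) {i j : Fin n}
    {hij : i.succ ≠ j.succ} {X₁ X₂ X₃ Y₁ Y₂ Y₃ Z₁ Z₂ Z₃ : ∀ k, C k}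
    {s₁ : PiSum σ i.succ X₁ Y₁ Z₁} {s₂ : PiSum σ i.succ X₂ Y₂ Z₂} {s₃ : PiSum σ i.succ X₃ Y₃ Z₃}
    {sX : PiSum σ j.succ X₁ X₂ X₃} {sY : PiSum σ j.succ Y₁ Y₂ Y₃} {sZ : PiSum σ j.succ Z₁ Z₂ Z₃}
    (H : IsGrid σ i.succ j.succ hij s₁ s₂ s₃ sX sY sZ) :
    G.uncurry.Inter s₁ s₂ s₃ sX sY sZ := by
  have hij' : i ≠ j := fun e => hij (e ▸ rfl)
  have h : IsGrid (tailStr σ) i j hij' (untail s₁) (untail s₂) (untail s₃) (untail sX)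
      (untail sY) (untail sZ) :=
    ⟨H.nat_f, H.nat_g, H.nat_f', H.nat_g', fun _ _ _ => H.ff _ _ _, fun _ _ _ => H.gf _ _ _,
      fun _ _ _ => H.fg _ _ _, fun _ _ _ => H.gg _ _ _⟩
  have e := Mod.inter_eq_iff.1 (hG.inter h) (Z₃ 0)
  change (G.tadd (untail s₁) (Z₃ 0) ⊗ₘ G.tadd (untail s₂) (Z₃ 0)) ≫ G.tadd (untail sZ) (Z₃ 0) =
    tensorμ _ _ _ _ ≫ (G.tadd (untail sX) (Z₃ 0) ⊗ₘ G.tadd (untail sY) (Z₃ 0)) ≫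
      G.tadd (untail s₃) (Z₃ 0) at e
  change (((G.hmap (tl X₁) _ ⊗ₘ G.hmap (tl Y₁) _) ≫ G.tadd (untail s₁) (Z₁ 0)) ⊗ₘ
      ((G.hmap (tl X₂) _ ⊗ₘ G.hmap (tl Y₂) _) ≫ G.tadd (untail s₂) (Z₂ 0))) ≫
      (G.hmap _ _ ⊗ₘ G.hmap _ _) ≫ G.tadd (untail sZ) (Z₃ 0) =
    tensorμ (G.val (tl X₁) (X₁ 0)) (G.val (tl Y₁) (Y₁ 0)) (G.val (tl X₂) (X₂ 0))
      (G.val (tl Y₂) (Y₂ 0)) ≫ (((G.hmap _ _ ⊗ₘ G.hmap _ _) ≫ G.tadd (untail sX) (X₃ 0)) ⊗ₘ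
      ((G.hmap _ _ ⊗ₘ G.hmap _ _) ≫ G.tadd (untail sY) (Y₃ 0))) ≫
      (G.hmap _ _ ⊗ₘ G.hmap _ _) ≫ G.tadd (untail s₃) (Z₃ 0)
  rw [tensorHom_comp_tensorHom_assoc, tensorHom_comp_tensorHom_assoc, Category.assoc,
    Category.assoc, Category.assoc, Category.assoc, tadd_hmap, tadd_hmap, tadd_hmap, tadd_hmap,
    tensorHom_comp_tensorHom_assoc, tensorHom_comp_tensorHom_assoc,
    tensorHom_comp_tensorHom_assoc, tensorHom_comp_tensorHom_assoc,
    ← tensorHom_comp_tensorHom_assoc, e, ← tensorHom_comp_tensorHom_assoc _ _ (G.tadd (untail sX) _),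
    tensorμ_natural_assoc]
  simp only [← hmap_comp, H.ff _ (Fin.succ_ne_zero i).symm (Fin.succ_ne_zero j).symm,
    H.gf _ (Fin.succ_ne_zero i).symm (Fin.succ_ne_zero j).symm,
    H.fg _ (Fin.succ_ne_zero i).symm (Fin.succ_ne_zero j).symm,
    H.gg _ (Fin.succ_ne_zero i).symm (Fin.succ_ne_zero j).symm]

lemma uncurry_isMulti {G : PreMulti (tailStr σ) (Mod (σ 0) P)} (hG : G.IsMulti) :
    G.uncurry.IsMulti where
  isMod i := by
    induction i using Fin.cases with
    | zero => exact ⟨G.uncurry_nat_zero, G.uncurry_comm_zero, G.uncurry_assoc_zero⟩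
    | succ i =>
      exact ⟨uncurry_nat_succ hG, uncurry_comm_succ hG, uncurry_assoc_succ hG⟩
  inter {i j hij X₁ X₂ X₃ Y₁ Y₂ Y₃ Z₁ Z₂ Z₃ s₁ s₂ s₃ sX sY sZ} H := by
    induction i using Fin.cases with
    | zero =>
      induction j using Fin.cases with
      | zero => exact absurd rfl hij
      -- Only the order with the first variable second was treated; transposing the grid covers the
      -- other.
      | succ j => exact (uncurry_inter hG H.symm).symm
    | succ i =>
      induction j using Fin.cases with
      | zero => exact uncurry_inter hG H
      | succ j => exact uncurry_inter_succ hG H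

end PreMulti

end Uncurry

/-! ### Functors preserving sums -/

/-- A functor which preserves sums. -/
structure SumMap {C : Type u} [Category.{v} C] {C' : Type u₂} [Category.{v₂} C'] (σ : SumStr C)
    (σ' : SumStr C') where
  F : C ⥤ C'
  map : ∀ {x y z : C}, σ.Sum x y z → σ'.Sum (F.obj x) (F.obj y) (F.obj z)
  isNat : ∀ {x y z x' y' z' : C} {s : σ.Sum x y z} {s' : σ.Sum x' y' z'} {p : x ⟶ x'} {q : y ⟶ y'}
    {r : z ⟶ z'}, σ.IsNat s s' p q r → σ'.IsNat (map s) (map s') (F.map p) (F.map q) (F.map r)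
  isComm : ∀ {x y z : C} {s : σ.Sum x y z} {s' : σ.Sum y x z}, σ.IsComm s s' →
    σ'.IsComm (map s) (map s')
  isAssoc : ∀ {x y t p q z : C} {s₁ : σ.Sum x y p} {s₂ : σ.Sum p t z} {s₃ : σ.Sum y t q}
    {s₄ : σ.Sum x q z}, σ.IsAssoc s₁ s₂ s₃ s₄ → σ'.IsAssoc (map s₁) (map s₂) (map s₃) (map s₄)

section

variable {C : Type u} [Category.{v} C] {C' : Type u₂} [Category.{v₂} C'] {σ : SumStr C}
  {σ' : SumStr C'} {P : Type u₁} [Category.{v₁} P] [MonoidalCategory P]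

/-- The composite with a functor which preserves sums. -/
@[simps]
def PreMod.precomp (M : PreMod σ' P) (Φ : SumMap σ σ') : PreMod σ P where
  F := Φ.F ⋙ M.F
  add s := M.add (Φ.map s)

lemma PreMod.IsMod.precomp [SymmetricCategory P] {M : PreMod σ' P} (h : M.IsMod)
    (Φ : SumMap σ σ') : (M.precomp Φ).IsMod where
  nat H := h.nat (Φ.isNat H)
  comm H := h.comm (Φ.isComm H)
  assoc H := h.assoc (Φ.isAssoc H)

variable [SymmetricCategory P]

namespace SumMap

variable (P) in
/-- The restriction along a functor which preserves sums. -/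
def res (Φ : SumMap σ σ') : Mod σ' P ⥤ Mod σ P where
  obj M := ⟨M.toPreMod.precomp Φ, M.isMod.precomp Φ⟩
  map f := Mod.homMk (Functor.whiskerLeft Φ.F (Mod.Hom.nt f)) (fun s => Mod.Hom.isHom f (Φ.map s))

@[simp] lemma res_obj_F_obj (Φ : SumMap σ σ') (M : Mod σ' P) (x : C) :
    ((Φ.res P).obj M).F.obj x = M.F.obj (Φ.F.obj x) := rfl

@[simp] lemma res_obj_F_map (Φ : SumMap σ σ') (M : Mod σ' P) {x y : C} (f : x ⟶ y) :
    ((Φ.res P).obj M).F.map f = M.F.map (Φ.F.map f) := rfl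

@[simp] lemma res_map_app (Φ : SumMap σ σ') {M N : Mod σ' P} (f : M ⟶ N) (x : C) :
    (Mod.Hom.nt ((Φ.res P).map f)).app x = (Mod.Hom.nt f).app (Φ.F.obj x) := rfl

/-- The restriction is strictly monoidal. -/
def resμIso (Φ : SumMap σ σ') (M N : Mod σ' P) :
    (Φ.res P).obj M ⊗ (Φ.res P).obj N ≅ (Φ.res P).obj (M ⊗ N) :=
  Mod.isoOfComponents (fun x => Iso.refl (M.F.obj (Φ.F.obj x) ⊗ N.F.obj (Φ.F.obj x)))
    (fun {x y} f => (Category.comp_id _).trans (Category.id_comp _).symm)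
    (fun {x y z} s => (Category.comp_id _).trans (by
      have : ((𝟙 (M.F.obj (Φ.F.obj x) ⊗ N.F.obj (Φ.F.obj x)) ⊗ₘ
          𝟙 (M.F.obj (Φ.F.obj y) ⊗ N.F.obj (Φ.F.obj y))) ≫ (M ⊗ N).add (Φ.map s)) =
          (M ⊗ N).add (Φ.map s) := by
        rw [id_tensorHom_id]
        exact Category.id_comp _
      exact this.symm))

/-- The restriction preserves the unit. -/
def resεIso (Φ : SumMap σ σ') : 𝟙_ (Mod σ P) ≅ (Φ.res P).obj (𝟙_ (Mod σ' P)) :=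
  Mod.isoOfComponents (fun x => Iso.refl (𝟙_ P))
    (fun {x y} f => (Category.comp_id _).trans (Category.id_comp _).symm)
    (fun {x y z} s => (Category.comp_id _).trans (by
      have : ((𝟙 (𝟙_ P) ⊗ₘ 𝟙 (𝟙_ P)) ≫ (λ_ (𝟙_ P)).hom) = (λ_ (𝟙_ P)).hom := by
        rw [id_tensorHom_id, Category.id_comp]
      exact this.symm))

/-- Tensor products are pointwise, so all structure morphisms have identity components. The axioms
reduce to identities in `P`, stated separately for arbitrary objects. -/
instance (Φ : SumMap σ σ') : (Φ.res P).Monoidal :=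
  Functor.CoreMonoidal.toMonoidal
    { εIso := Φ.resεIso
      μIso := Φ.resμIso
      μIso_hom_natural_left := fun f K => Mod.hom_ext fun x =>
        (Category.comp_id _).trans (Category.id_comp _).symm
      μIso_hom_natural_right := fun K f => Mod.hom_ext fun x =>
        (Category.comp_id _).trans (Category.id_comp _).symm
      associativity := fun M N K => Mod.hom_ext fun x => by
        have h (A B D : P) : (𝟙 (A ⊗ B) ⊗ₘ 𝟙 D) ≫ 𝟙 ((A ⊗ B) ⊗ D) ≫ (α_ A B D).hom =
          (α_ A B D).hom ≫ (𝟙 A ⊗ₘ 𝟙 (B ⊗ D)) ≫ 𝟙 (A ⊗ B ⊗ D) := by simp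
        exact h (M.F.obj (Φ.F.obj x)) (N.F.obj (Φ.F.obj x)) (K.F.obj (Φ.F.obj x))
      left_unitality := fun M => Mod.hom_ext fun x => by
        have h (A : P) : (λ_ A).hom = (𝟙 (𝟙_ P) ⊗ₘ 𝟙 A) ≫ 𝟙 (𝟙_ P ⊗ A) ≫ (λ_ A).hom := by simp
        exact h (M.F.obj (Φ.F.obj x))
      right_unitality := fun M => Mod.hom_ext fun x => by
        have h (A : P) : (ρ_ A).hom = (𝟙 A ⊗ₘ 𝟙 (𝟙_ P)) ≫ 𝟙 (A ⊗ 𝟙_ P) ≫ (ρ_ A).hom := by simp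
        exact h (M.F.obj (Φ.F.obj x)) }

instance (Φ : SumMap σ σ') : (Φ.res P).Braided where
  braided M N := Mod.hom_ext fun x => (Category.id_comp _).trans (Category.comp_id _).symm

/-- A functor which preserves sums is universal for functors with additivity morphisms to Picard
groupoids if the restriction along it is an equivalence. -/
structure IsUniversal {C : Type u} [Category.{v} C] {C' : Type w} [Category.{w} C']
    {σ : SumStr C} {σ' : SumStr C'} (Φ : SumMap σ σ') : Prop where
  full : ∀ (P : Type w) [Category.{w} P] [MonoidalCategory P] [SymmetricCategory P]
    [PicardGroupoid P], (Φ.res P).Full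
  faithful : ∀ (P : Type w) [Category.{w} P] [MonoidalCategory P] [SymmetricCategory P]
    [PicardGroupoid P], (Φ.res P).Faithful
  essSurj : ∀ (P : Type w) [Category.{w} P] [MonoidalCategory P] [SymmetricCategory P]
    [PicardGroupoid P], (Φ.res P).EssSurj

end SumMap

end

section

variable {n : ℕ} {C : Fin n → Type u} [∀ i, Category.{v} (C i)] {C' : Fin n → Type u₂}
  [∀ i, Category.{v₂} (C' i)] {σ : ∀ i, SumStr (C i)} {σ' : ∀ i, SumStr (C' i)}
  {P : Type u₁} [Category.{v₁} P] [MonoidalCategory P]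

/-- The product of functors which preserve sums preserves sums in each variable. -/
@[simps]
def PiSum.map (Φ : ∀ i, SumMap (σ i) (σ' i)) {i : Fin n} {X Y Z : ∀ j, C j} (s : PiSum σ i X Y Z) :
    PiSum σ' i ((Functor.pi fun i => (Φ i).F).obj X) ((Functor.pi fun i => (Φ i).F).obj Y)
      ((Functor.pi fun i => (Φ i).F).obj Z) where
  s := (Φ i).map s.s
  f j h := (Φ j).F.map (s.f j h)
  g j h := (Φ j).F.map (s.g j h)

/-- The composite with a product of functors which preserve sums. -/
@[simps]
def PreMulti.precomp (M : PreMulti σ' P) (Φ : ∀ i, SumMap (σ i) (σ' i)) : PreMulti σ P where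
  F := Functor.pi (fun i => (Φ i).F) ⋙ M.F
  add i _ _ _ s := M.add i (s.map Φ)

lemma piStr_isNat_map (Φ : ∀ i, SumMap (σ i) (σ' i)) {i : Fin n} {X Y Z X' Y' Z' : ∀ j, C j}
    {s : PiSum σ i X Y Z} {s' : PiSum σ i X' Y' Z'} {p : X ⟶ X'} {q : Y ⟶ Y'} {r : Z ⟶ Z'}
    (H : (piStr σ i).IsNat s s' p q r) :
    (piStr σ' i).IsNat (s.map Φ) (s'.map Φ) ((Functor.pi fun i => (Φ i).F).map p)
      ((Functor.pi fun i => (Φ i).F).map q) ((Functor.pi fun i => (Φ i).F).map r) :=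
  ⟨(Φ i).isNat H.1,
    fun j h => ((Φ j).F.map_comp _ _).symm.trans
      ((congr_arg (Φ j).F.map (H.2.1 j h)).trans ((Φ j).F.map_comp _ _)),
    fun j h => ((Φ j).F.map_comp _ _).symm.trans
      ((congr_arg (Φ j).F.map (H.2.2 j h)).trans ((Φ j).F.map_comp _ _))⟩

lemma PreMulti.IsMulti.precomp [SymmetricCategory P] {M : PreMulti σ' P} (hM : M.IsMulti)
    (Φ : ∀ i, SumMap (σ i) (σ' i)) : (M.precomp Φ).IsMulti where
  isMod i :=
    { nat := fun H => (hM.isMod i).nat (piStr_isNat_map Φ H)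
      comm := fun H => (hM.isMod i).comm
        ⟨(Φ i).isComm H.1, fun j h => congr_arg (Φ j).F.map (H.2.1 j h),
          fun j h => congr_arg (Φ j).F.map (H.2.2 j h)⟩
      assoc := fun H => (hM.isMod i).assoc
        ⟨(Φ i).isAssoc H.1, fun j h => ((Φ j).F.map_comp _ _).symm.trans
          (congr_arg (Φ j).F.map (H.2.1 j h)),
          fun j h => ((Φ j).F.map_comp _ _).symm.trans
            ((congr_arg (Φ j).F.map (H.2.2.1 j h)).trans ((Φ j).F.map_comp _ _)),
          fun j h => (congr_arg (Φ j).F.map (H.2.2.2 j h)).trans ((Φ j).F.map_comp _ _)⟩ }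
  inter {i j hij} _ _ _ _ _ _ _ _ _ _ _ _ _ _ _ H := by
    have e (k : Fin n) {A B B' D : ∀ k, C k} {a : A k ⟶ B k} {b : B k ⟶ D k} {a' : A k ⟶ B' k}
        {b' : B' k ⟶ D k} (h : a ≫ b = a' ≫ b') :
        (Φ k).F.map a ≫ (Φ k).F.map b = (Φ k).F.map a' ≫ (Φ k).F.map b' := by
      rw [← Functor.map_comp, h, Functor.map_comp]
    exact hM.inter (hij := hij) ⟨(Φ i).isNat H.nat_f, (Φ i).isNat H.nat_g, (Φ j).isNat H.nat_f',
      (Φ j).isNat H.nat_g', fun k hi hj => e k (H.ff k hi hj), fun k hi hj => e k (H.gf k hi hj),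
      fun k hi hj => e k (H.fg k hi hj), fun k hi hj => e k (H.gg k hi hj)⟩

end

/-! ### Extension of functors of several variables along universal functors -/

namespace PreMulti

section

variable {n : ℕ} {C : Fin n → Type u} [∀ i, Category.{v} (C i)] {C' : Fin n → Type u₂}
  [∀ i, Category.{v₂} (C' i)] {σ : ∀ i, SumStr (C i)} {σ' : ∀ i, SumStr (C' i)}
  {P : Type u₁} [Category.{v₁} P] [MonoidalCategory P] [SymmetricCategory P]

lemma IsHom.precomp {M N : PreMulti σ' P} {τ : M.F ⟶ N.F} (h : IsHom M N τ)
    (Φ : ∀ i, SumMap (σ i) (σ' i)) :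
    IsHom (M.precomp Φ) (N.precomp Φ) (Functor.whiskerLeft _ τ) :=
  fun i _ _ _ s => h i (s.map Φ)

lemma IsHom.mapTarget {Q : Type u₂} [Category.{v₂} Q] [MonoidalCategory Q] [SymmetricCategory Q]
    {M N : PreMulti σ P} {τ : M.F ⟶ N.F} (h : IsHom M N τ) (R : P ⥤ Q) [R.LaxMonoidal] :
    IsHom (M.mapTarget R) (N.mapTarget R) (Functor.whiskerRight τ R) := fun i X Y Z s => by
  change (Functor.LaxMonoidal.μ R _ _ ≫ R.map (M.add i s)) ≫ R.map (τ.app Z) =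
    (R.map (τ.app X) ⊗ₘ R.map (τ.app Y)) ≫ Functor.LaxMonoidal.μ R _ _ ≫ R.map (N.add i s)
  rw [Functor.LaxMonoidal.μ_natural_assoc, Category.assoc, ← R.map_comp, ← R.map_comp, h i s]

/-- It suffices to check compatibility with a sum after passing to an isomorphic one. -/
lemma add_comp_app {M N : PreMulti σ P} (hM : M.IsMulti) (hN : N.IsMulti) (γ : M.F ⟶ N.F)
    {i : Fin n} {X Y Z X' Y' Z' : ∀ j, C j} {s : PiSum σ i X Y Z} {s' : PiSum σ i X' Y' Z'}
    {p : X ⟶ X'} {q : Y ⟶ Y'} {r : Z ⟶ Z'} [IsIso r] (H : (piStr σ i).IsNat s s' p q r)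
    (h : M.add i s' ≫ γ.app Z' = (γ.app X' ⊗ₘ γ.app Y') ≫ N.add i s') :
    M.add i s ≫ γ.app Z = (γ.app X ⊗ₘ γ.app Y) ≫ N.add i s := by
  have h₁ : M.add i s ≫ M.F.map r = (M.F.map p ⊗ₘ M.F.map q) ≫ M.add i s' := (hM.isMod i).nat H
  have h₂ : N.add i s ≫ N.F.map r = (N.F.map p ⊗ₘ N.F.map q) ≫ N.add i s' := (hN.isMod i).nat H
  rw [← cancel_mono (N.F.map r), Category.assoc, Category.assoc, ← γ.naturality, reassoc_of% h₁,
    h, h₂, tensorHom_comp_tensorHom_assoc, tensorHom_comp_tensorHom_assoc, γ.naturality,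
    γ.naturality]

end

section

variable {n : ℕ} {C : Fin (n + 1) → Type u} [∀ i, Category.{v} (C i)] {C' : Fin (n + 1) → Type u₂}
  [∀ i, Category.{v₂} (C' i)] {σ : ∀ i, SumStr (C i)} {σ' : ∀ i, SumStr (C' i)}
  {P : Type u₁} [Category.{v₁} P] [MonoidalCategory P] [SymmetricCategory P]

/-- The natural transformation between functors with values in functors of the first variable
induced by a natural transformation of functors of several variables. -/
def curryHom {M N : PreMulti σ P} (hM : M.IsMulti) (hN : N.IsMulti) (γ : M.F ⟶ N.F)
    (h : IsHom M N γ) : (M.curry hM).F ⟶ (N.curry hN).F where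
  app t := Mod.homMk
    { app := fun x => γ.app (pcons x t)
      naturality := fun _ _ f => γ.naturality (headMap f t) } (fun s => h 0 (headSum s t))
  naturality t t' g := Mod.hom_ext fun x => γ.naturality (tailMap x g)

lemma curryHom_isHom {M N : PreMulti σ P} (hM : M.IsMulti) (hN : N.IsMulti) (γ : M.F ⟶ N.F)
    (h : IsHom M N γ) : IsHom (M.curry hM) (N.curry hN) (curryHom hM hN γ h) :=
  fun i _ _ _ s => Mod.hom_ext fun x => h i.succ (tailSum x s)

/-- A family is isomorphic to the family given by its first entry and its other entries. -/
def consIso (X : ∀ i, C i) : X ≅ pcons (X 0) (tl X) where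
  hom := consHom (𝟙 _) (𝟙 (tl X))
  inv := consHom (𝟙 _) (𝟙 (tl X))
  hom_inv_id := pi_hom_ext_cons (Category.comp_id (𝟙 (X 0)))
    (fun i => Category.comp_id (𝟙 (X i.succ)))
  inv_hom_id := pi_hom_ext_cons (Category.comp_id (𝟙 (X 0)))
    (fun i => Category.comp_id (𝟙 (X i.succ)))

lemma consIso_pcons (x : C 0) (t : ∀ i : Fin n, C i.succ) :
    (consIso (pcons x t)).hom = 𝟙 (pcons x t) :=
  pi_hom_ext_cons rfl (fun _ => rfl)

lemma consIso_naturality {X Y : ∀ i, C i} (f : X ⟶ Y) :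
    f ≫ (consIso Y).hom = (consIso X).hom ≫ tailMap (X 0) (tlMap f) ≫ headMap (f 0) (tl Y) :=
  pi_hom_ext_cons
    (by
      change f 0 ≫ 𝟙 _ = 𝟙 _ ≫ 𝟙 _ ≫ f 0
      simp)
    (fun i => by
      change f i.succ ≫ 𝟙 _ = 𝟙 _ ≫ f i.succ ≫ 𝟙 _
      simp)

/-- Every family is isomorphic, through `consIso`, to one of the form `pcons x t`, so naturality
determines the remaining components. -/
lemma hom_ext_pcons {M N : PreMulti σ P} {γ γ' : M.F ⟶ N.F}
    (h : ∀ x t, γ.app (pcons x t) = γ'.app (pcons x t)) : γ = γ' := by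
  ext X
  rw [← cancel_mono (N.F.map (consIso X).hom), ← γ.naturality, ← γ'.naturality, h]

/-- The components of a natural transformation between functors with values in functors of the
first variable. -/
def homApp {M N : PreMulti σ P} {hM : M.IsMulti} {hN : N.IsMulti}
    (κ : (M.curry hM).F ⟶ (N.curry hN).F) (t : ∀ i : Fin n, C i.succ) (x : C 0) :
    M.F.obj (pcons x t) ⟶ N.F.obj (pcons x t) :=
  (Mod.Hom.nt (κ.app t)).app x

/-- The natural transformation of functors of several variables given by a natural transformation
between functors with values in functors of the first variable. -/
def uncurryHom {M N : PreMulti σ P} {hM : M.IsMulti} {hN : N.IsMulti}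
    (κ : (M.curry hM).F ⟶ (N.curry hN).F) : M.F ⟶ N.F where
  app X := M.F.map (consIso X).hom ≫ homApp κ (tl X) (X 0) ≫
    N.F.map (consIso X).inv
  naturality X Y f := by
    have h₁ : M.F.map (tailMap (X 0) (tlMap f)) ≫ homApp κ (tl Y) (X 0) =
        homApp κ (tl X) (X 0) ≫ N.F.map (tailMap (X 0) (tlMap f)) :=
      congr_arg (fun g => (Mod.Hom.nt g).app (X 0)) (κ.naturality (tlMap f))
    have h₂ : M.F.map (headMap (f 0) (tl Y)) ≫ homApp κ (tl Y) (Y 0) =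
        homApp κ (tl Y) (X 0) ≫ N.F.map (headMap (f 0) (tl Y)) :=
      (Mod.Hom.nt (κ.app (tl Y))).naturality (f 0)
    have e : tailMap (X 0) (tlMap f) ≫ headMap (f 0) (tl Y) ≫ (consIso Y).inv =
        (consIso X).inv ≫ f := by
      rw [Iso.eq_inv_comp, ← Category.assoc, ← Category.assoc, Iso.comp_inv_eq,
        consIso_naturality, Category.assoc]
    rw [← Functor.map_comp_assoc, consIso_naturality, Functor.map_comp_assoc,
      Functor.map_comp_assoc, reassoc_of% h₂, reassoc_of% h₁, ← N.F.map_comp, ← N.F.map_comp, e,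
      Category.assoc, Category.assoc, ← N.F.map_comp]

lemma uncurryHom_app_pcons {M N : PreMulti σ P} {hM : M.IsMulti} {hN : N.IsMulti}
    (κ : (M.curry hM).F ⟶ (N.curry hN).F) (x : C 0) (t : ∀ i : Fin n, C i.succ) :
    (uncurryHom κ).app (pcons x t) = homApp κ t x := by
  have h₁ : M.F.map (consIso (pcons x t)).hom = 𝟙 (M.F.obj (pcons x t)) :=
    (congr_arg M.F.map (consIso_pcons x t)).trans (M.F.map_id _)
  have h₂ : N.F.map (consIso (pcons x t)).inv = 𝟙 (N.F.obj (pcons x t)) :=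
    (congr_arg N.F.map (consIso_pcons x t)).trans (N.F.map_id _)
  have e {A B : P} (f : A ⟶ B) : 𝟙 _ ≫ f ≫ 𝟙 _ = f := by simp
  exact (congr_arg₂ (fun a b => a ≫ homApp κ t x ≫ b) h₁ h₂).trans (e _)

/-- Every sum maps, with an isomorphism on the total object, to one of the standard sums `headSum`
or `tailSum`. By `add_comp_app` those suffice, and there the components of `uncurryHom κ` are those
of `κ`. -/
lemma uncurryHom_isHom {M N : PreMulti σ P} {hM : M.IsMulti} {hN : N.IsMulti}
    (κ : (M.curry hM).F ⟶ (N.curry hN).F) (h : IsHom (M.curry hM) (N.curry hN) κ) :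
    IsHom M N (uncurryHom κ) := fun i X Y Z s => by
  induction i using Fin.cases with
  | zero =>
    have H : (piStr σ 0).IsNat s (headSum s.s (tl Z)) 
        (consHom (𝟙 (X 0)) (fun i => s.f i.succ (Fin.succ_ne_zero i)) : X ⟶ pcons (X 0) (tl Z))
        (consHom (𝟙 (Y 0)) (fun i => s.g i.succ (Fin.succ_ne_zero i)) : Y ⟶ pcons (Y 0) (tl Z)) (consIso Z).hom :=
      ⟨(σ 0).isNat_id s.s, fun j => Fin.cases (fun h => absurd rfl h) (fun _ _ => rfl) j,
        fun j => Fin.cases (fun h => absurd rfl h) (fun _ _ => rfl) j⟩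
    refine add_comp_app hM hN (uncurryHom κ) H ?_
    rw [uncurryHom_app_pcons, uncurryHom_app_pcons, uncurryHom_app_pcons]
    exact Mod.Hom.isHom (κ.app (tl Z)) s.s
  | succ i =>
    have H : (piStr σ i.succ).IsNat s (tailSum (Z 0) (untail s))
        (consHom (s.f 0 (Fin.succ_ne_zero i).symm) (𝟙 (tl X)) : X ⟶ pcons (Z 0) (tl X))
        (consHom (s.g 0 (Fin.succ_ne_zero i).symm) (𝟙 (tl Y)) : Y ⟶ pcons (Z 0) (tl Y)) (consIso Z).hom :=
      ⟨(σ i.succ).isNat_id s.s,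
        fun j => Fin.cases (fun _ => rfl)
          (fun _ _ => (Category.comp_id _).trans (Category.id_comp _).symm) j,
        fun j => Fin.cases (fun _ => rfl)
          (fun _ _ => (Category.comp_id _).trans (Category.id_comp _).symm) j⟩
    refine add_comp_app hM hN (uncurryHom κ) H ?_
    rw [uncurryHom_app_pcons, uncurryHom_app_pcons, uncurryHom_app_pcons]
    exact congr_arg (fun g => (Mod.Hom.nt g).app (Z 0)) (h i (untail s))

end

end PreMulti

namespace PreMulti

section

variable {n : ℕ} {C : Fin n → Type u} [∀ i, Category.{v} (C i)] {σ : ∀ i, SumStr (C i)}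
  {P : Type u₁} [Category.{v₁} P] [MonoidalCategory P]

lemma IsHom.inv {M N : PreMulti σ P} {τ : M.F ≅ N.F} (h : IsHom M N τ.hom) :
    IsHom N M τ.inv := fun i X Y Z s => by
  have := h i s
  rw [← cancel_epi (τ.hom.app X ⊗ₘ τ.hom.app Y), ← reassoc_of% this]
  simp

/-- Faithful monoidal functors reflect compatibility with additivity, since their structure
morphisms `μ` can be cancelled. -/
lemma IsHom.of_mapTarget {Q : Type u₂} [Category.{v₂} Q] [MonoidalCategory Q]
    {M N : PreMulti σ P} {τ : M.F ⟶ N.F} (R : P ⥤ Q) [R.Monoidal] [R.Faithful]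
    {τ' : M.F ⋙ R ⟶ N.F ⋙ R} (h : IsHom (M.mapTarget R) (N.mapTarget R) τ')
    (hτ : ∀ X, τ'.app X = R.map (τ.app X)) : IsHom M N τ := fun i X Y Z s => by
  have := h i s
  rw [hτ, hτ, hτ] at this
  replace this : (Functor.LaxMonoidal.μ R _ _ ≫ R.map (M.add i s)) ≫ R.map (τ.app Z) =
    (R.map (τ.app X) ⊗ₘ R.map (τ.app Y)) ≫ Functor.LaxMonoidal.μ R _ _ ≫ R.map (N.add i s) := this
  rw [Functor.LaxMonoidal.μ_natural_assoc, Category.assoc, cancel_epi, ← R.map_comp,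
    ← R.map_comp] at this
  exact R.map_injective this

end

section

variable {n : ℕ} {C : Fin (n + 1) → Type u} [∀ i, Category.{v} (C i)] {C' : Fin (n + 1) → Type u₂}
  [∀ i, Category.{v₂} (C' i)] {σ : ∀ i, SumStr (C i)} {σ' : ∀ i, SumStr (C' i)}
  {P : Type u₁} [Category.{v₁} P] [MonoidalCategory P] [SymmetricCategory P]

/-- A product of functors is compatible with separating the first variable. -/
def piConsIso (Φ : ∀ i, SumMap (σ i) (σ' i)) (x : C 0) (t : ∀ i : Fin n, C i.succ) :
    pcons ((Φ 0).F.obj x) ((Functor.pi fun i : Fin n => (Φ i.succ).F).obj t) ≅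
      (Functor.pi fun i => (Φ i).F).obj (pcons x t) where
  hom := consHom (𝟙 _) (fun i => 𝟙 ((Φ i.succ).F.obj (t i)))
  inv := consHom (𝟙 _) (fun i => 𝟙 ((Φ i.succ).F.obj (t i)))
  hom_inv_id := pi_hom_ext_cons (Category.comp_id (𝟙 ((Φ 0).F.obj x)))
    (fun i => Category.comp_id (𝟙 ((Φ i.succ).F.obj (t i))))
  inv_hom_id := pi_hom_ext_cons (Category.comp_id (𝟙 ((Φ 0).F.obj x)))
    (fun i => Category.comp_id (𝟙 ((Φ i.succ).F.obj (t i))))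

lemma headMap_piConsIso (Φ : ∀ i, SumMap (σ i) (σ' i)) {x y : C 0} (f : x ⟶ y)
    (t : ∀ i : Fin n, C i.succ) :
    headMap ((Φ 0).F.map f) ((Functor.pi fun i : Fin n => (Φ i.succ).F).obj t) ≫
        (piConsIso Φ y t).hom =
      (piConsIso Φ x t).hom ≫ (Functor.pi fun i => (Φ i).F).map (headMap f t) :=
  pi_hom_ext_cons ((Category.comp_id _).trans (Category.id_comp _).symm)
    (fun i => (congr_arg _ ((Φ i.succ).F.map_id (t i)).symm))

lemma tailMap_piConsIso (Φ : ∀ i, SumMap (σ i) (σ' i)) (x : C 0)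
    {t t' : ∀ i : Fin n, C i.succ} (f : t ⟶ t') :
    tailMap ((Φ 0).F.obj x) ((Functor.pi fun i : Fin n => (Φ i.succ).F).map f) ≫
        (piConsIso Φ x t').hom =
      (piConsIso Φ x t).hom ≫ (Functor.pi fun i => (Φ i).F).map (tailMap x f) :=
  pi_hom_ext_cons (congr_arg _ ((Φ 0).F.map_id x).symm)
    (fun i => (Category.comp_id _).trans (Category.id_comp _).symm)

lemma headSum_piConsIso (Φ : ∀ i, SumMap (σ i) (σ' i)) {x y z : C 0} (s : (σ 0).Sum x y z)
    (t : ∀ i : Fin n, C i.succ) :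
    (piStr σ' 0).IsNat
      (headSum ((Φ 0).map s) ((Functor.pi fun i : Fin n => (Φ i.succ).F).obj t))
      ((headSum s t).map Φ) (piConsIso Φ x t).hom (piConsIso Φ y t).hom (piConsIso Φ z t).hom :=
  ⟨(σ' 0).isNat_id _,
    fun j => Fin.cases (fun h => absurd rfl h)
      (fun i _ => congr_arg (𝟙 ((Φ i.succ).F.obj (t i)) ≫ ·) ((Φ i.succ).F.map_id (t i)).symm) j,
    fun j => Fin.cases (fun h => absurd rfl h)
      (fun i _ => congr_arg (𝟙 ((Φ i.succ).F.obj (t i)) ≫ ·) ((Φ i.succ).F.map_id (t i)).symm) j⟩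

lemma tailSum_piConsIso (Φ : ∀ i, SumMap (σ i) (σ' i)) (x : C 0) {i : Fin n}
    {t t' t'' : ∀ i : Fin n, C i.succ} (s : PiSum (tailStr σ) i t t' t'') :
    (piStr σ' i.succ).IsNat
      (tailSum ((Φ 0).F.obj x) (s.map (fun i : Fin n => Φ i.succ)))
      ((tailSum x s).map Φ) (piConsIso Φ x t).hom (piConsIso Φ x t').hom (piConsIso Φ x t'').hom :=
  ⟨(σ' i.succ).isNat_id _,
    fun j => Fin.cases
      (fun _ => congr_arg (𝟙 ((Φ 0).F.obj x) ≫ ·) ((Φ 0).F.map_id x).symm)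
      (fun _ _ => (Category.comp_id _).trans (Category.id_comp _).symm) j,
    fun j => Fin.cases
      (fun _ => congr_arg (𝟙 ((Φ 0).F.obj x) ≫ ·) ((Φ 0).F.map_id x).symm)
      (fun _ _ => (Category.comp_id _).trans (Category.id_comp _).symm) j⟩

/-- Separating the first variable is compatible with composition with functors preserving sums. -/
def curryPrecompIso {G : PreMulti σ' P} (hG : G.IsMulti) (Φ : ∀ i, SumMap (σ i) (σ' i)) :
    (((G.curry hG).precomp (fun i : Fin n => Φ i.succ)).mapTarget ((Φ 0).res P)).F ≅
      ((G.precomp Φ).curry (hG.precomp Φ)).F :=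
  NatIso.ofComponents
    (fun t => Mod.isoOfComponents (fun x => G.F.mapIso (piConsIso Φ x t))
      (fun {x y} f => (G.F.map_comp _ _).symm.trans
        ((congr_arg G.F.map (headMap_piConsIso Φ f t)).trans (G.F.map_comp _ _)))
      (fun {x y z} s => (hG.isMod 0).nat (headSum_piConsIso Φ s t)))
    (fun {t t'} f => Mod.hom_ext fun x => (G.F.map_comp _ _).symm.trans
        ((congr_arg G.F.map (tailMap_piConsIso Φ x f)).trans (G.F.map_comp _ _)))

lemma curryPrecompIso_isHom {G : PreMulti σ' P} (hG : G.IsMulti)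
    (Φ : ∀ i, SumMap (σ i) (σ' i)) :
    IsHom (((G.curry hG).precomp (fun i : Fin n => Φ i.succ)).mapTarget ((Φ 0).res P))
      ((G.precomp Φ).curry (hG.precomp Φ)) (curryPrecompIso hG Φ).hom :=
  fun i t t' t'' s => Mod.hom_ext fun x => by
    -- The leading identity is the structure morphism `μ` of the restriction functor.
    have h : (𝟙 (G.F.obj (pcons ((Φ 0).F.obj x) ((Functor.pi fun i : Fin n => (Φ i.succ).F).obj t))
        ⊗ G.F.obj (pcons ((Φ 0).F.obj x) ((Functor.pi fun i : Fin n => (Φ i.succ).F).obj t')))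
        ≫ G.add i.succ (tailSum ((Φ 0).F.obj x) (s.map (fun i : Fin n => Φ i.succ)))) ≫
        G.F.map (piConsIso Φ x t'').hom =
      (G.F.map (piConsIso Φ x t).hom ⊗ₘ G.F.map (piConsIso Φ x t').hom) ≫
        G.add i.succ ((tailSum x s).map Φ) := by
      rw [Category.id_comp]
      exact (hG.isMod i.succ).nat (tailSum_piConsIso Φ x s)
    exact h

/-- Combining and separating the variables gives the original functor. -/
def curryUncurryIso {G : PreMulti (tailStr σ) (Mod (σ 0) P)} (hG : G.IsMulti) :
    (G.uncurry.curry (uncurry_isMulti hG)).F ≅ G.F :=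
  NatIso.ofComponents
    (fun t => Mod.isoOfComponents (fun x => Iso.refl (G.val t x))
      (fun {x y} f => by
        have h : (G.tmap (𝟙 t) x ≫ G.hmap t f) ≫ 𝟙 (G.val t y) = 𝟙 (G.val t x) ≫ G.hmap t f := by
          rw [tmap_id, Category.comp_id]
        exact h)
      (fun {x y z} s => by
        have h : ((G.tmap (𝟙 t) x ⊗ₘ G.tmap (𝟙 t) y) ≫ G.hadd t s) ≫ 𝟙 (G.val t z) =
            (𝟙 (G.val t x) ⊗ₘ 𝟙 (G.val t y)) ≫ G.hadd t s := by
          rw [tmap_id, tmap_id, Category.comp_id]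
        exact h))
    (fun {t t'} f => Mod.hom_ext fun x => by
      have h : (G.tmap f x ≫ G.hmap t' (𝟙 x)) ≫ 𝟙 (G.val t' x) = 𝟙 (G.val t x) ≫ G.tmap f x := by
        rw [hmap_id, Category.comp_id, Category.comp_id, Category.id_comp]
      exact h)

lemma curryUncurryIso_isHom {G : PreMulti (tailStr σ) (Mod (σ 0) P)} (hG : G.IsMulti) :
    IsHom (G.uncurry.curry (uncurry_isMulti hG)) G (curryUncurryIso hG).hom :=
  fun i t t' t'' s => Mod.hom_ext fun x => by
    have h : ((G.hmap t (𝟙 x) ⊗ₘ G.hmap t' (𝟙 x)) ≫ G.tadd s x) ≫ 𝟙 (G.val t'' x) =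
        (𝟙 (G.val t x) ⊗ₘ 𝟙 (G.val t' x)) ≫ G.tadd s x := by
      rw [hmap_id, hmap_id, Category.comp_id]
    exact h

end

/-- Functors of several variables on the sources of universal functors extend to the targets. -/
theorem exists_extension : ∀ (n : ℕ) {C : Fin n → Type u} [∀ i, Category.{v} (C i)]
    {C' : Fin n → Type w} [∀ i, Category.{w} (C' i)] {σ : ∀ i, SumStr (C i)}
    {σ' : ∀ i, SumStr (C' i)} {Φ : ∀ i, SumMap (σ i) (σ' i)} (_ : ∀ i, (Φ i).IsUniversal)
    {P : Type w} [Category.{w} P] [MonoidalCategory P] [SymmetricCategory P] [PicardGroupoid P]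
    {E : PreMulti σ P} (_ : E.IsMulti),
    ∃ (G : PreMulti σ' P) (_ : G.IsMulti) (τ : (G.precomp Φ).F ⟶ E.F), IsHom (G.precomp Φ) E τ
  | 0, C, _, C', _, σ, σ', Φ, hΦ, P, _, _, _, _, E, hE => by
    -- Without variables there is a single family and no additivity: the value of `E` there is a
    -- constant extension.
    let G : PreMulti σ' P :=
      { F := (Functor.const _).obj (E.F.obj fun i => i.elim0)
        add := fun i => i.elim0 }
    exact ⟨G, ⟨fun i => i.elim0, fun {i} => i.elim0⟩,
      { app := fun X => E.F.map (fun i => i.elim0)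
        naturality := fun X Y f => by
          refine (Category.id_comp _).trans (Eq.trans ?_ (E.F.map_comp _ _))
          exact congr_arg E.F.map (funext fun i => i.elim0) }, fun i => i.elim0⟩
  | n + 1, C, _, C', _, σ, σ', Φ, hΦ, P, _, _, _, _, E, hE => by
    have := (hΦ 0).full P
    have := (hΦ 0).faithful P
    have := (hΦ 0).essSurj P
    -- The curried functor is lifted along the equivalence `Mod (σ' 0) P ⥤ Mod (σ 0) P`. This
    -- extends it in the first variable, and also brings the target into the universe `w`, so that
    -- the induction hypothesis applies.
    obtain ⟨N, hN, τ₁, hτ₁⟩ := exists_lift (E.curry_isMulti hE) ((Φ 0).res P)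
    obtain ⟨G, hG, τ₂, hτ₂⟩ := exists_extension n (fun i : Fin n => hΦ i.succ) hN
    have h₁ := (curryPrecompIso_isHom (uncurry_isMulti hG) Φ).inv
    have h₂ := ((curryUncurryIso_isHom hG).precomp (fun i : Fin n => Φ i.succ)).mapTarget
      ((Φ 0).res P)
    have h₃ := hτ₂.mapTarget ((Φ 0).res P)
    -- The comparison is assembled in curried form: undo the currying of the restriction, recover
    -- `G`, apply `τ₂` restricted in the first variable, then `τ₁`.
    exact ⟨G.uncurry, uncurry_isMulti hG, _,
      uncurryHom_isHom _ (((h₁.comp h₂).comp h₃).comp hτ₁)⟩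

end PreMulti

namespace PreMulti

/-- Natural transformations on the targets of universal functors are determined by their
restrictions. -/
theorem hom_ext_of_isUniversal : ∀ (n : ℕ) {C : Fin n → Type u} [∀ i, Category.{v} (C i)]
    {C' : Fin n → Type w} [∀ i, Category.{w} (C' i)] {σ : ∀ i, SumStr (C i)}
    {σ' : ∀ i, SumStr (C' i)} {Φ : ∀ i, SumMap (σ i) (σ' i)} (_ : ∀ i, (Φ i).IsUniversal)
    {P : Type w} [Category.{w} P] [MonoidalCategory P] [SymmetricCategory P] [PicardGroupoid P]
    {G G' : PreMulti σ' P} (_ : G.IsMulti) (_ : G'.IsMulti) {γ γ' : G.F ⟶ G'.F}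
    (_ : IsHom G G' γ) (_ : IsHom G G' γ')
    (_ : ∀ X, γ.app ((Functor.pi fun i => (Φ i).F).obj X) =
      γ'.app ((Functor.pi fun i => (Φ i).F).obj X)), γ = γ'
  | 0, C, _, C', _, σ, σ', Φ, hΦ, P, _, _, _, _, G, G', hG, hG', γ, γ', hγ, hγ', h => by
    ext X
    obtain rfl : (Functor.pi fun i => (Φ i).F).obj (fun i => i.elim0) = X :=
      funext fun i => i.elim0
    exact h _
  | n + 1, C, _, C', _, σ, σ', Φ, hΦ, P, _, _, _, _, G, G', hG, hG', γ, γ', hγ, hγ', h => by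
    have := (hΦ 0).faithful P
    -- By induction the curried transformations may be compared on tails in the image of the `Φ
    -- i.succ`. There they are morphisms of `Mod (σ' 0) P`, which the faithful restriction along `Φ
    -- 0` tells apart.
    have key : curryHom hG hG' γ hγ = curryHom hG hG' γ' hγ' :=
      hom_ext_of_isUniversal n (fun i : Fin n => hΦ i.succ) (curry_isMulti hG) (curry_isMulti hG')
        (curryHom_isHom hG hG' γ hγ) (curryHom_isHom hG hG' γ' hγ') fun t =>
        ((Φ 0).res P).map_injective (Mod.hom_ext fun x => by
          have e : γ.app (pcons ((Φ 0).F.obj x)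
              ((Functor.pi fun i : Fin n => (Φ i.succ).F).obj t)) = γ'.app _ := by
            rw [← cancel_mono (G'.F.map (piConsIso Φ x t).hom), ← γ.naturality, ← γ'.naturality, h]
          exact e)
    exact hom_ext_pcons fun x t =>
      congr_arg (fun κ => (Mod.Hom.nt (NatTrans.app κ t)).app x) key

/-- Natural transformations on the sources of universal functors extend to the targets. -/
theorem exists_hom_extension : ∀ (n : ℕ) {C : Fin n → Type u} [∀ i, Category.{v} (C i)]
    {C' : Fin n → Type w} [∀ i, Category.{w} (C' i)] {σ : ∀ i, SumStr (C i)}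
    {σ' : ∀ i, SumStr (C' i)} {Φ : ∀ i, SumMap (σ i) (σ' i)} (_ : ∀ i, (Φ i).IsUniversal)
    {P : Type w} [Category.{w} P] [MonoidalCategory P] [SymmetricCategory P] [PicardGroupoid P]
    {G G' : PreMulti σ' P} (_ : G.IsMulti) (_ : G'.IsMulti)
    {δ : (G.precomp Φ).F ⟶ (G'.precomp Φ).F} (_ : IsHom (G.precomp Φ) (G'.precomp Φ) δ),
    ∃ γ : G.F ⟶ G'.F, IsHom G G' γ ∧
      ∀ X, γ.app ((Functor.pi fun i => (Φ i).F).obj X) = δ.app X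
  | 0, C, _, C', _, σ, σ', Φ, hΦ, P, _, _, _, _, G, G', hG, hG', δ, hδ => by
    have e (X : ∀ i, C' i) : (Functor.pi fun i => (Φ i).F).obj (fun i => i.elim0) = X :=
      funext fun i => i.elim0
    let c (X Y : ∀ i, C' i) : X ⟶ Y := fun i => i.elim0
    have hc {X Y : ∀ i, C' i} (f g : X ⟶ Y) : f = g := funext fun i => i.elim0
    let X₀ : ∀ i, C i := fun i => i.elim0
    let d : G.F.obj ((Functor.pi fun i => (Φ i).F).obj X₀) ⟶
      G'.F.obj ((Functor.pi fun i => (Φ i).F).obj X₀) := δ.app X₀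
    -- All families indexed by the empty type agree propositionally but not definitionally, so the
    -- one given component is conjugated by the unique morphisms between them.
    refine ⟨
      { app := fun X => G.F.map (c _ _) ≫ d ≫ G'.F.map (c _ _)
        naturality := fun X Y f => ?_ }, fun i => i.elim0, fun X => ?_⟩
    · rw [← Functor.map_comp_assoc, Category.assoc, Category.assoc, ← Functor.map_comp, hc (f ≫ _) (c _ _),
        hc (_ ≫ f) (c _ _)]
    · obtain rfl : X₀ = X := funext fun i => i.elim0
      change G.F.map (c _ _) ≫ d ≫ G'.F.map (c _ _) = d
      rw [hc (c _ _) (𝟙 ((Functor.pi fun i => (Φ i).F).obj X₀)), G.F.map_id, G'.F.map_id,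
        Category.comp_id, Category.id_comp]
  | n + 1, C, _, C', _, σ, σ', Φ, hΦ, P, _, _, _, _, G, G', hG, hG', δ, hδ => by
    have := (hΦ 0).full P
    have := (hΦ 0).faithful P
    -- `δ`, curried and conjugated so that its source and target become restrictions along `Φ 0`.
    let K : ((G.curry hG).precomp (fun i : Fin n => Φ i.succ)).F ⋙ (Φ 0).res P ⟶
        ((G'.curry hG').precomp (fun i : Fin n => Φ i.succ)).F ⋙ (Φ 0).res P := (curryPrecompIso hG Φ).hom ≫ curryHom (hG.precomp Φ) (hG'.precomp Φ) δ hδ ≫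
      (curryPrecompIso hG' Φ).inv
    have hK : IsHom (((G.curry hG).precomp (fun i : Fin n => Φ i.succ)).mapTarget ((Φ 0).res P))
        (((G'.curry hG').precomp (fun i : Fin n => Φ i.succ)).mapTarget ((Φ 0).res P)) K :=
      (curryPrecompIso_isHom hG Φ).comp ((curryHom_isHom (hG.precomp Φ) (hG'.precomp Φ) δ hδ).comp
        (curryPrecompIso_isHom hG' Φ).inv)
    let K' (t : ∀ i : Fin n, C i.succ) : ((Φ 0).res P).obj
        (((G.curry hG).precomp (fun i : Fin n => Φ i.succ)).F.obj t) ⟶ ((Φ 0).res P).obj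
        (((G'.curry hG').precomp (fun i : Fin n => Φ i.succ)).F.obj t) := K.app t
    -- Fullness extends the components of `K` in the first variable; faithfulness then gives
    -- naturality and compatibility with additivity.
    let ε : ((G.curry hG).precomp (fun i : Fin n => Φ i.succ)).F ⟶
        ((G'.curry hG').precomp (fun i : Fin n => Φ i.succ)).F :=
      { app := fun t => ((Φ 0).res P).preimage (K' t)
        naturality := fun t t' f => ((Φ 0).res P).map_injective (by
          rw [Functor.map_comp, Functor.map_comp, Functor.map_preimage, Functor.map_preimage]
          exact K.naturality f) }
    have hε : IsHom _ _ ε := hK.of_mapTarget _ fun t => (((Φ 0).res P).map_preimage _).symm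
    obtain ⟨γ, hγ, hγ'⟩ := exists_hom_extension n (fun i : Fin n => hΦ i.succ)
      (curry_isMulti hG) (curry_isMulti hG') hε
    refine ⟨uncurryHom γ, uncurryHom_isHom γ hγ, fun X => ?_⟩
    let d (X : ∀ i, C i) : G.F.obj ((Functor.pi fun i => (Φ i).F).obj X) ⟶
      G'.F.obj ((Functor.pi fun i => (Φ i).F).obj X) := δ.app X
    have h₁ (x : C 0) (t : ∀ i : Fin n, C i.succ) :
        homApp γ ((Functor.pi fun i : Fin n => (Φ i.succ).F).obj t) ((Φ 0).F.obj x) =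
          G.F.map (piConsIso Φ x t).hom ≫ d (pcons x t) ≫
            G'.F.map (piConsIso Φ x t).inv := by
      have : ((Φ 0).res P).map (γ.app ((Functor.pi fun i : Fin n => (Φ i.succ).F).obj t)) =
          K.app t := by
        rw [hγ']
        exact Functor.map_preimage _ _
      exact congr_arg (fun g => (Mod.Hom.nt g).app x) this
    have h₂ (x : C 0) (t : ∀ i : Fin n, C i.succ) :
        (uncurryHom γ).app ((Functor.pi fun i => (Φ i).F).obj (pcons x t)) =
          d (pcons x t) := by
      rw [← cancel_epi (G.F.map (piConsIso Φ x t).hom), (uncurryHom γ).naturality,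
        uncurryHom_app_pcons, h₁, Category.assoc, Category.assoc, ← Functor.map_comp,
        Iso.inv_hom_id, CategoryTheory.Functor.map_id, Category.comp_id]
    -- The components are known at families `pcons x t`; naturality of both sides along `consIso X`
    -- gives them at `X`.
    have h₃ := (uncurryHom γ).naturality
      ((Functor.pi fun i => (Φ i).F).map (consIso X).hom)
    have h₄ : G.F.map ((Functor.pi fun i => (Φ i).F).map (consIso X).hom) ≫ d _ = d X ≫
      G'.F.map ((Functor.pi fun i => (Φ i).F).map (consIso X).hom) := δ.naturality (consIso X).hom
    rw [h₂] at h₃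
    exact (cancel_mono (G'.F.map ((Functor.pi fun i => (Φ i).F).map (consIso X).hom))).1
      (h₃.symm.trans h₄)

end PreMulti

/-! ### Sums in symmetric monoidal categories -/

section Monoidal

variable (V : Type u) [Category.{v} V] [MonoidalCategory V] [SymmetricCategory V]

/-- The sums in a symmetric monoidal category: morphisms `x ⊗ y ⟶ z`. -/
def monStr : SumStr V where
  Sum x y z := x ⊗ y ⟶ z
  IsNat s s' p q r := s ≫ r = (p ⊗ₘ q) ≫ s'
  isNat_id s := by simp
  IsComm s s' := s = (β_ _ _).hom ≫ s'
  IsAssoc s₁ s₂ s₃ s₄ := s₁ ▷ _ ≫ s₂ = (α_ _ _ _).hom ≫ _ ◁ s₃ ≫ s₄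

variable {V}

/-- A functor with additivity morphisms to a symmetric monoidal category preserves sums. -/
@[simps]
def PreMod.IsMod.sumMap {C : Type u₁} [Category.{v₁} C] {σ : SumStr C} {M : PreMod σ V}
    (hM : M.IsMod) : SumMap σ (monStr V) where
  F := M.F
  map s := M.add s
  isNat H := hM.nat H
  isComm H := hM.comm H
  isAssoc H := hM.assoc H

variable {P : Type u₁} [Category.{v₁} P] [MonoidalCategory P]

/-- The additivity morphisms given by a lax monoidal functor. -/
@[simps]
def PreMod.ofLax (F : V ⥤ P) [F.LaxMonoidal] : PreMod (monStr V) P where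
  F := F
  add s := Functor.LaxMonoidal.μ F _ _ ≫ F.map s

lemma PreMod.isHom_ofLax {F G : V ⥤ P} [F.LaxMonoidal] [G.LaxMonoidal] (γ : F ⟶ G)
    [NatTrans.IsMonoidal γ] : PreMod.IsHom (.ofLax F) (.ofLax G) γ := fun {x y z} s => by
  have h (s : x ⊗ y ⟶ z) : (Functor.LaxMonoidal.μ F x y ≫ F.map s) ≫ γ.app z =
      (γ.app x ⊗ₘ γ.app y) ≫ Functor.LaxMonoidal.μ G x y ≫ G.map s := by
    rw [Category.assoc, γ.naturality, ← Category.assoc, NatTrans.IsMonoidal.tensor, Category.assoc]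
  exact h s

variable [SymmetricCategory P]

open Functor.LaxMonoidal in
lemma PreMod.isMod_ofLax (F : V ⥤ P) [F.LaxBraided] : (PreMod.ofLax F).IsMod := by
  have h₁ {x y z x' y' z' : V} {s : x ⊗ y ⟶ z} {s' : x' ⊗ y' ⟶ z'} {p : x ⟶ x'} {q : y ⟶ y'}
      {r : z ⟶ z'} (H : s ≫ r = (p ⊗ₘ q) ≫ s') :
      (μ F x y ≫ F.map s) ≫ F.map r = (F.map p ⊗ₘ F.map q) ≫ μ F x' y' ≫ F.map s' := by
    rw [Category.assoc, ← F.map_comp, H, F.map_comp, μ_natural_assoc]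
  have h₂ {x y z : V} {s : x ⊗ y ⟶ z} {s' : y ⊗ x ⟶ z} (H : s = (β_ x y).hom ≫ s') :
      μ F x y ≫ F.map s = (β_ _ _).hom ≫ μ F y x ≫ F.map s' := by
    rw [H, F.map_comp, Functor.LaxBraided.braided_assoc]
  have h₃ {x y t p q z : V} {s₁ : x ⊗ y ⟶ p} {s₂ : p ⊗ t ⟶ z} {s₃ : y ⊗ t ⟶ q} {s₄ : x ⊗ q ⟶ z}
      (H : s₁ ▷ t ≫ s₂ = (α_ x y t).hom ≫ x ◁ s₃ ≫ s₄) :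
      (μ F x y ≫ F.map s₁) ▷ _ ≫ μ F p t ≫ F.map s₂ =
        (α_ _ _ _).hom ≫ _ ◁ (μ F y t ≫ F.map s₃) ≫ μ F x q ≫ F.map s₄ := by
    rw [comp_whiskerRight, MonoidalCategory.whiskerLeft_comp, Category.assoc, Category.assoc,
      μ_natural_left_assoc, μ_natural_right_assoc, ← associativity_assoc, ← F.map_comp,
      ← F.map_comp, ← F.map_comp, H]
  exact ⟨h₁, h₂, h₃⟩

namespace PreMod

variable (M : PreMod (monStr V) P)

/-- The additivity morphism of a morphism `x ⊗ y ⟶ z`. -/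
def addHom {x y z : V} (s : x ⊗ y ⟶ z) : M.F.obj x ⊗ M.F.obj y ⟶ M.F.obj z :=
  M.add (σ := monStr V) s

variable {M} (hM : M.IsMod)

include hM

lemma IsMod.addHom_nat {x y z x' y' z' : V} {s : x ⊗ y ⟶ z} {s' : x' ⊗ y' ⟶ z'} {p : x ⟶ x'}
    {q : y ⟶ y'} {r : z ⟶ z'} (H : s ≫ r = (p ⊗ₘ q) ≫ s') :
    M.addHom s ≫ M.F.map r = (M.F.map p ⊗ₘ M.F.map q) ≫ M.addHom s' :=
  hM.nat H

lemma IsMod.addHom_comm {x y z : V} {s : x ⊗ y ⟶ z} {s' : y ⊗ x ⟶ z} (H : s = (β_ x y).hom ≫ s') :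
    M.addHom s = (β_ _ _).hom ≫ M.addHom s' :=
  hM.comm H

lemma IsMod.addHom_assoc {x y t p q z : V} {s₁ : x ⊗ y ⟶ p} {s₂ : p ⊗ t ⟶ z} {s₃ : y ⊗ t ⟶ q}
    {s₄ : x ⊗ q ⟶ z} (H : s₁ ▷ t ≫ s₂ = (α_ x y t).hom ≫ x ◁ s₃ ≫ s₄) :
    M.addHom s₁ ▷ _ ≫ M.addHom s₂ = (α_ _ _ _).hom ≫ _ ◁ M.addHom s₃ ≫ M.addHom s₄ :=
  hM.assoc H

/-- By naturality all additivity morphisms come from those of the identities `𝟙 (x ⊗ y)`, which play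
the role of `μ`. -/
lemma IsMod.addHom_id {x y z : V} (s : x ⊗ y ⟶ z) :
    M.addHom (𝟙 (x ⊗ y)) ≫ M.F.map s = M.addHom s := by
  rw [hM.addHom_nat (s' := s) (p := 𝟙 x) (q := 𝟙 y) (by simp)]
  simp

end PreMod

end Monoidal

/-! ### Functors with additivity to a Picard groupoid are symmetric monoidal. -/

section Picard

variable {V : Type u} [Category.{v} V] [MonoidalCategory V] [SymmetricCategory V]
  {P : Type w} [Category.{w} P] [MonoidalCategory P] [SymmetricCategory P] [PicardGroupoid P]

lemma exists_whiskerRight_eq (X : P) {Y Z : P} (f : Y ⊗ X ⟶ Z ⊗ X) : ∃ g : Y ⟶ Z, g ▷ X = f := by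
  obtain ⟨g, hg⟩ := exists_whiskerLeft_eq X ((β_ X Y).hom ≫ f ≫ (β_ Z X).hom)
  refine ⟨g, ?_⟩
  rw [← cancel_epi (β_ X Y).hom, ← cancel_mono (β_ Z X).hom, Category.assoc, Category.assoc, ← hg,
    ← BraidedCategory.braiding_naturality_right_assoc]
  simp

namespace PreMod

variable {M N : PreMod (monStr V) P}

-- Tensoring with `M.F.obj (𝟙_ V)` is full, and additivity morphisms are invertible, so the left
-- unit triangle at `𝟙_ V` can be solved for the unit constraint. Faithfulness makes the solution
-- unique.
variable (M) in
lemma exists_unit : ∃ ε : 𝟙_ P ⟶ M.F.obj (𝟙_ V),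
    ε ▷ M.F.obj (𝟙_ V) ≫ M.addHom (λ_ (𝟙_ V)).hom = (λ_ _).hom := by
  obtain ⟨ε, h⟩ := exists_whiskerRight_eq (M.F.obj (𝟙_ V))
    ((λ_ _).hom ≫ inv (M.addHom (λ_ (𝟙_ V)).hom))
  exact ⟨ε, by rw [h]; simp⟩

variable (M) in
/-- The unit of a functor with additivity morphisms to a Picard groupoid. -/
def unit : 𝟙_ P ⟶ M.F.obj (𝟙_ V) := M.exists_unit.choose

variable (M) in
lemma unit_addHom : M.unit ▷ M.F.obj (𝟙_ V) ≫ M.addHom (λ_ (𝟙_ V)).hom = (λ_ _).hom :=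
  M.exists_unit.choose_spec

lemma IsMod.unit_addHom_left (hM : M.IsMod) (x : V) :
    M.unit ▷ M.F.obj x ≫ M.addHom (λ_ x).hom = (λ_ _).hom := by
  -- Associativity for the summands `𝟙_`, `𝟙_`, `x`: the inner sum is governed by the definition of
  -- the unit, and the invertible additivity morphism of `λ_ x` is then cancelled.
  have h := hM.addHom_assoc (s₁ := (λ_ (𝟙_ V)).hom) (s₂ := (λ_ x).hom) (s₃ := (λ_ x).hom)
    (s₄ := (λ_ x).hom) (by simp)
  replace h := congr_arg (fun t => (M.unit ▷ _) ▷ _ ≫ t) h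
  rw [← comp_whiskerRight_assoc, unit_addHom, associator_naturality_left_assoc,
    ← whisker_exchange_assoc] at h
  rw [← cancel_epi (_ ◁ M.addHom (λ_ x).hom), ← cancel_epi (α_ _ _ _).hom, ← h]
  simp

lemma IsMod.unit_addHom_right (hM : M.IsMod) (x : V) :
    M.F.obj x ◁ M.unit ≫ M.addHom (ρ_ x).hom = (ρ_ _).hom := by
  rw [hM.addHom_comm (s := (ρ_ x).hom) (s' := (λ_ x).hom) (by simp),
    BraidedCategory.braiding_naturality_right_assoc, hM.unit_addHom_left]
  simp

variable (M) in
lemma eq_unit {ε : 𝟙_ P ⟶ M.F.obj (𝟙_ V)}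
    (h : ε ▷ M.F.obj (𝟙_ V) ≫ M.addHom (λ_ (𝟙_ V)).hom = (λ_ _).hom) : ε = M.unit := by
  rw [← unit_addHom, cancel_mono] at h
  exact whiskerRight_cancel _ h

/-- The image of a unit constraint under `γ` solves the equation that characterizes `N.unit`. Hence
compatibility with units is a consequence of additivity. -/
lemma IsHom.eq_unit {γ : M.F ⟶ N.F} (h : IsHom M N γ) {ε : 𝟙_ P ⟶ M.F.obj (𝟙_ V)}
    (hε : ε ▷ M.F.obj (𝟙_ V) ≫ M.addHom (λ_ (𝟙_ V)).hom = (λ_ _).hom) :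
    ε ≫ γ.app (𝟙_ V) = N.unit := by
  refine N.eq_unit ?_
  have h' : M.addHom (λ_ (𝟙_ V)).hom ≫ γ.app _ = (γ.app _ ⊗ₘ γ.app _) ≫ N.addHom (λ_ (𝟙_ V)).hom :=
    h (λ_ (𝟙_ V)).hom
  rw [← cancel_epi (𝟙_ P ◁ γ.app (𝟙_ V)), comp_whiskerRight, Category.assoc,
    whisker_exchange_assoc, ← MonoidalCategory.tensorHom_def'_assoc, ← h', reassoc_of% hε]
  simp

/-- A functor with additivity morphisms to a Picard groupoid is symmetric monoidal. -/
@[reducible]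
def IsMod.braided (hM : M.IsMod) : M.F.Braided where
  toMonoidal := Functor.CoreMonoidal.toMonoidal
    { εIso := asIso M.unit
      μIso := fun x y => asIso (M.addHom (𝟙 (x ⊗ y)))
      μIso_hom_natural_left := fun f x => by
        simp only [asIso_hom]
        rw [hM.addHom_nat (s' := 𝟙 _) (p := f) (q := 𝟙 x) (by simp)]
        simp
      μIso_hom_natural_right := fun x f => by
        simp only [asIso_hom]
        rw [hM.addHom_nat (s' := 𝟙 _) (p := 𝟙 x) (q := f) (by simp)]
        simp
      associativity := fun x y z => by
        simp only [asIso_hom]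
        rw [hM.addHom_id, ← hM.addHom_assoc]
        simp
      left_unitality := fun x => by
        simp only [asIso_hom]
        rw [hM.addHom_id, hM.unit_addHom_left]
      right_unitality := fun x => by
        simp only [asIso_hom]
        rw [hM.addHom_id, hM.unit_addHom_right] }
  braided x y := (hM.addHom_id _).trans (hM.addHom_comm (by simp))

lemma IsMod.ofLax_add (hM : M.IsMod) {x y z : V} (s : x ⊗ y ⟶ z) :
    letI := hM.braided
    (PreMod.ofLax M.F).addHom s = M.addHom s := hM.addHom_id s

/-- Compatibility with the additivity morphisms suffices for a natural transformation between
monoidal functors to a Picard groupoid to be monoidal. -/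
lemma isMonoidal_of_isHom {F G : V ⥤ P} [F.LaxMonoidal] [G.LaxMonoidal] {γ : F ⟶ G}
    (h : IsHom (.ofLax F) (.ofLax G) γ) : NatTrans.IsMonoidal γ where
  unit := by
    have e : ∀ (F : V ⥤ P) [F.LaxMonoidal], Functor.LaxMonoidal.ε F ▷ F.obj (𝟙_ V) ≫
        Functor.LaxMonoidal.μ F _ _ ≫ F.map (λ_ (𝟙_ V)).hom = (λ_ _).hom := fun F _ => by simp
    exact (h.eq_unit (M := .ofLax F) (N := .ofLax G) (e F)).trans
      ((PreMod.ofLax G).eq_unit (e G)).symm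
  tensor x y := by
    have e : (Functor.LaxMonoidal.μ F _ _ ≫ F.map (𝟙 (x ⊗ y))) ≫ γ.app (x ⊗ y) =
      (γ.app x ⊗ₘ γ.app y) ≫ Functor.LaxMonoidal.μ G _ _ ≫ G.map (𝟙 (x ⊗ y)) :=
      h (𝟙 (x ⊗ y))
    simpa using e

end PreMod

end Picard

/-! ### Determinant functors as functors with additivity morphisms -/

section Tri

variable (T : Type u) [Category.{v} T] [HasZeroObject T] [Preadditive T] [HasShift T ℤ]
  [∀ k : ℤ, (shiftFunctor T k).Additive] [Pretriangulated T]

variable {T} in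
/-- A distinguished triangle `y ⟶ z ⟶ x ⟶ Σ y`. -/
structure TriSum (x y z : Core T) where
  f : y.of ⟶ z.of
  g : z.of ⟶ x.of
  h : x.of ⟶ y.of⟦(1 : ℤ)⟧
  mem : Triangle.mk f g h ∈ distTriang T

/-- The sums given by the distinguished triangles. -/
def triStr : SumStr (Core T) where
  Sum := TriSum
  IsNat s s' p q r := s.f ≫ r.iso.hom = q.iso.hom ≫ s'.f ∧ s.g ≫ p.iso.hom = r.iso.hom ≫ s'.g ∧
    s.h ≫ q.iso.hom⟦(1 : ℤ)⟧' = p.iso.hom ≫ s'.h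
  isNat_id {x y z} s := by
    refine ⟨(Category.comp_id _).trans (Category.id_comp _).symm,
      (Category.comp_id _).trans (Category.id_comp _).symm, ?_⟩
    refine Eq.trans ?_ (Category.id_comp _).symm
    refine (congr_arg (s.h ≫ ·) ((shiftFunctor T (1 : ℤ)).map_id y.of)).trans (Category.comp_id _)
  -- The object `z` need only be isomorphic to the biproduct, through some `e` that carries `s` and
  -- `s'` to the two split triangles.
  IsComm {x y z} s s' := ∃ e : z.of ≅ x.of ⊞ y.of, s.f ≫ e.hom = biprod.inr ∧
    s.g = e.hom ≫ biprod.fst ∧ s.h = 0 ∧ s'.f ≫ e.hom = biprod.inl ∧ s'.g = e.hom ≫ biprod.snd ∧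
    s'.h = 0
  -- Here `s₃`, `s₄` and `s₂` are the triangles on the two morphisms and on their composite, and
  -- `s₁` is the new triangle of the octahedron.
  IsAssoc s₁ s₂ s₃ s₄ := ∃ (comm : s₃.f ≫ s₄.f = s₂.f) (O : Octahedron comm s₃.mem s₄.mem s₂.mem),
    O.m₁ = s₁.f ∧ O.m₃ = s₁.g ∧ s₁.h = s₄.h ≫ s₃.g⟦(1 : ℤ)⟧'

variable {T} {P : Type w} [Category.{w} P] [MonoidalCategory P]

/-- The functor with additivity morphisms given by the data of a determinant functor. -/
@[simps]
def PreDet.toPreMod (D : PreDet T P) : PreMod (triStr T) P where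
  F := D.toFunctor
  add s := D.add (Triangle.mk s.f s.g s.h) s.mem

/-- The data of a determinant functor given by a functor with additivity morphisms. -/
@[simps]
def PreMod.toPreDet (M : PreMod (triStr T) P) : PreDet T P where
  toFunctor := M.F
  add Δ h := M.add (σ := triStr T) (x := ⟨Δ.obj₃⟩) (y := ⟨Δ.obj₁⟩) (z := ⟨Δ.obj₂⟩)
    ⟨Δ.mor₁, Δ.mor₂, Δ.mor₃, h⟩

variable [SymmetricCategory P]

lemma PreDet.IsDet.natural_mk {D : PreDet T P} (hD : D.IsDet) {x y z x' y' z' : T} {f : x ⟶ y}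
    {g : y ⟶ z} {h : z ⟶ x⟦(1 : ℤ)⟧} {f' : x' ⟶ y'} {g' : y' ⟶ z'} {h' : z' ⟶ x'⟦(1 : ℤ)⟧}
    (mem : Triangle.mk f g h ∈ distTriang T) (mem' : Triangle.mk f' g' h' ∈ distTriang T)
    (e₁ : x ≅ x') (e₂ : y ≅ y') (e₃ : z ≅ z') (c₁ : f ≫ e₂.hom = e₁.hom ≫ f')
    (c₂ : g ≫ e₃.hom = e₂.hom ≫ g') (c₃ : h ≫ e₁.hom⟦(1 : ℤ)⟧' = e₃.hom ≫ h') :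
    D.add _ mem ≫ D.map e₂ = (D.map e₃ ⊗ₘ D.map e₁) ≫ D.add _ mem' := by
  have H := hD.natural mem mem' (Triangle.isoMk _ _ e₁ e₂ e₃ c₁ c₂ c₃)
  have h₁ : Triangle.π₁.mapIso (Triangle.isoMk (Triangle.mk f g h) (Triangle.mk f' g' h')
    e₁ e₂ e₃ c₁ c₂ c₃) = e₁ := Iso.ext rfl
  have h₂ : Triangle.π₂.mapIso (Triangle.isoMk (Triangle.mk f g h) (Triangle.mk f' g' h')
    e₁ e₂ e₃ c₁ c₂ c₃) = e₂ := Iso.ext rfl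
  have h₃ : Triangle.π₃.mapIso (Triangle.isoMk (Triangle.mk f g h) (Triangle.mk f' g' h')
    e₁ e₂ e₃ c₁ c₂ c₃) = e₃ := Iso.ext rfl
  rw [h₁, h₂, h₃] at H
  exact H

lemma PreDet.map_refl (D : PreDet T P) (x : T) : D.map (Iso.refl x) = 𝟙 (D.obj x) :=
  D.toFunctor.map_id _

/-- The relations of `triStr` are the determinant axioms, except that commutativity is asked of
every `z` identified with a biproduct; naturality along the identification reduces this to the
axiom. -/
lemma PreDet.IsDet.isMod {D : PreDet T P} (hD : D.IsDet) : D.toPreMod.IsMod where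
  nat {x y z x' y' z' s s' p q r} H := by
    exact hD.natural_mk s.mem s'.mem q.iso r.iso p.iso H.1 H.2.1 H.2.2
  comm {x y z s s'} := fun ⟨e, h₁, h₂, h₃, h₄, h₅, h₆⟩ => by
    have e₁ := hD.natural_mk s.mem (biproductTriangle'_distinguished x.of y.of) (Iso.refl _) e
      (Iso.refl _) (h₁.trans (Category.id_comp _).symm) ((Category.comp_id _).trans h₂)
      (by rw [h₃]; exact zero_comp.trans comp_zero.symm)
    have e₂ := hD.natural_mk s'.mem (binaryBiproductTriangle_distinguished x.of y.of) (Iso.refl _) e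
      (Iso.refl _) (h₄.trans (Category.id_comp _).symm) ((Category.comp_id _).trans h₅)
      (by rw [h₆]; exact zero_comp.trans comp_zero.symm)
    have e₃ := hD.commutativity x.of y.of
    rw [D.map_refl, D.map_refl, id_tensorHom_id] at e₁ e₂
    replace e₁ := e₁.trans (Category.id_comp _)
    replace e₂ := e₂.trans (Category.id_comp _)
    change D.add _ s.mem = (β_ _ _).hom ≫ D.add _ s'.mem
    refine (cancel_mono (D.map e)).1 ?_
    exact (e₁.trans e₃).trans ((congr_arg _ e₂.symm).trans (Category.assoc _ _ _).symm)
  assoc {x y t p q z s₁ s₂ s₃ s₄} := fun ⟨comm, O, h₁, h₂, h₃⟩ => by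
    have H := hD.octahedron O
    obtain ⟨f, g, h, mem⟩ := s₁
    dsimp only at h₁ h₂ h₃
    subst h₁ h₂ h₃
    exact H

lemma PreMod.IsMod.isDet {M : PreMod (triStr T) P} (hM : M.IsMod) : M.toPreDet.IsDet where
  natural {Δ Δ'} hΔ hΔ' e := hM.nat (σ := triStr T) ⟨e.hom.comm₁, e.hom.comm₂, e.hom.comm₃⟩
  commutativity x y := hM.comm (σ := triStr T) ⟨Iso.refl _, Category.comp_id _,
    (Category.id_comp _).symm, rfl, Category.comp_id _, (Category.id_comp _).symm, rfl⟩
  octahedron {x y z z' x' y' u₁₂ u₂₃ u₁₃ comm v₁₂ w₁₂ h₁₂ v₂₃ w₂₃ h₂₃ v₁₃ w₁₃ h₁₃} O :=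
    hM.assoc (σ := triStr T) ⟨comm, O, rfl, rfl, rfl⟩

/-- A determinant functor as a functor with additivity morphisms. -/
abbrev DetFunctor.toMod (D : DetFunctor T P) : Mod (triStr T) P := ⟨D.toPreMod, D.isDet.isMod⟩

/-- The determinant functor given by a functor with additivity morphisms. -/
abbrev Mod.toDet (M : Mod (triStr T) P) : DetFunctor T P := ⟨M.toPreDet, M.isMod.isDet⟩

/-- Determinant functors preserve sums. -/
abbrev DetFunctor.sumMap (D : DetFunctor T P) : SumMap (triStr T) (monStr P) := D.isDet.isMod.sumMap

end Tri

/-! ### Universal determinant functors: restriction along them is an equivalence. -/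

section Universal

variable {T : Type u} [Category.{v} T] [HasZeroObject T] [Preadditive T] [HasShift T ℤ]
  [∀ k : ℤ, (shiftFunctor T k).Additive] [Pretriangulated T]
  {V : Type w} [Category.{w} V] [MonoidalCategory V] [SymmetricCategory V]
  {det : DetFunctor T V}
  {P : Type w} [Category.{w} P] [MonoidalCategory P] [SymmetricCategory P] [PicardGroupoid P]

/-- A functor with additivity morphisms and a morphism from its restriction to a determinant
functor define a factorization. -/
def Factorization.ofMod {M : PreMod (monStr V) P} (hM : M.IsMod) {D : PreDet T P}
    (δ : det.toFunctor ⋙ M.F ⟶ D.toFunctor)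
    (h : PreMod.IsHom (M.precomp det.sumMap) D.toPreMod δ) :
    Factorization det.toPreDet D where
  functor := M.F
  braided := hM.braided
  trans := δ
  isHom Δ hΔ := by
    have h₁ := h (x := ⟨Δ.obj₃⟩) (y := ⟨Δ.obj₁⟩) (z := ⟨Δ.obj₂⟩)
      ⟨Δ.mor₁, Δ.mor₂, Δ.mor₃, hΔ⟩
    have h₂ := hM.ofLax_add (det.add Δ hΔ)
    exact (congr_arg (· ≫ δ.app ⟨Δ.obj₂⟩) h₂).trans h₁

lemma PreMod.isHom_id {C : Type u₁} [Category.{v₁} C] {σ : SumStr C} (M : PreMod σ P) :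
    PreMod.IsHom M M (𝟙 M.F) := fun s => by simp

/-- Universality of a determinant functor in terms of functors with additivity morphisms. -/
lemma DetFunctor.IsUniversal.exists_factorization (hdet : det.IsUniversal) (D : DetFunctor T P) :
    ∃ (K : PreMod (monStr V) P) (_ : K.IsMod) (t : det.toFunctor ⋙ K.F ⟶ D.toFunctor),
      PreMod.IsHom (K.precomp det.sumMap) D.toPreMod t ∧ ∀ {M : PreMod (monStr V) P} (_ : M.IsMod)
        (δ : det.toFunctor ⋙ M.F ⟶ D.toFunctor),
        PreMod.IsHom (M.precomp det.sumMap) D.toPreMod δ →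
        ∃! β : K.F ⟶ M.F, PreMod.IsHom K M β ∧ Functor.whiskerLeft det.toFunctor β ≫ δ = t := by
  obtain ⟨c, hc⟩ := hdet P D
  refine ⟨.ofLax c.functor, PreMod.isMod_ofLax c.functor, c.trans, fun s => c.isHom _ s.mem,
    fun {M} hM δ hδ => ?_⟩
  letI := hM.braided
  obtain ⟨β, ⟨h₁, h₂⟩, h₃⟩ := hc (.ofMod hM δ hδ)
  refine ⟨β, ⟨fun {x y z} s => ?_, h₂⟩, fun β' ⟨h₁', h₂'⟩ => h₃ β' ⟨?_, h₂'⟩⟩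
  · have : NatTrans.IsMonoidal (F₁ := c.functor) (F₂ := M.F) β := h₁
    exact (PreMod.isHom_ofLax β s).trans
      (congr_arg ((β.app x ⊗ₘ β.app y) ≫ ·) (hM.ofLax_add s))
  · exact PreMod.isMonoidal_of_isHom (F := c.functor) (G := M.F) fun {x y z} s =>
      (h₁' s).trans (congr_arg ((β'.app x ⊗ₘ β'.app y) ≫ ·) (hM.ofLax_add s).symm)

/-- There is a unique extension of each morphism between restrictions. -/
lemma DetFunctor.IsUniversal.existsUnique (hdet : det.IsUniversal) {M N : PreMod (monStr V) P}
    (hM : M.IsMod) (hN : N.IsMod) (δ : det.toFunctor ⋙ M.F ⟶ det.toFunctor ⋙ N.F)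
    (hδ : PreMod.IsHom (M.precomp det.sumMap) (N.precomp det.sumMap) δ) :
    ∃! γ : M.F ⟶ N.F, PreMod.IsHom M N γ ∧ Functor.whiskerLeft det.toFunctor γ = δ := by
  -- The universal factorization `K` of `N ∘ det` maps to `M` by `β`, using `δ`, and to `N` by `β'`,
  -- using the identity. As `P` is a groupoid, `β` is invertible, and the extension is `β⁻¹ ≫ β'`.
  obtain ⟨K, hK, t, ht, H⟩ :=
    hdet.exists_factorization (Mod.toDet ⟨N.precomp det.sumMap, hN.precomp _⟩)
  obtain ⟨β, ⟨h₁, h₂⟩, -⟩ := H hM δ hδ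
  obtain ⟨β', ⟨h₁', h₂'⟩, hβ'⟩ := H hN (𝟙 (det.toFunctor ⋙ N.F))
    (PreMod.isHom_id (N.precomp det.sumMap))
  have i₁ : IsIso β := NatIso.isIso_of_isIso_app _
  replace h₂' : Functor.whiskerLeft det.toFunctor β' = t := (Category.comp_id _).symm.trans h₂'
  refine ⟨inv β ≫ β', ⟨PreMod.IsHom.comp (PreMod.IsHom.inv (τ := asIso β) h₁) h₁', ?_⟩, ?_⟩
  · rw [Functor.whiskerLeft_comp, h₂']
    replace h₂ : Functor.whiskerLeft det.toFunctor β ≫ δ = t := h₂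
    rw [← h₂, ← Category.assoc, ← Functor.whiskerLeft_comp, IsIso.inv_hom_id]
    exact Category.id_comp δ
  · rintro γ ⟨hγ, hγ'⟩
    refine (IsIso.eq_inv_comp β).2 (hβ' (β ≫ γ) ⟨h₁.comp hγ, ?_⟩)
    refine (Category.comp_id _).trans ((Functor.whiskerLeft_comp _ _ _).trans ?_)
    rw [hγ']
    exact h₂

/-- A universal determinant functor is universal for functors with additivity morphisms. -/
lemma DetFunctor.IsUniversal.sumMap (hdet : det.IsUniversal) : det.sumMap.IsUniversal where
  full P _ _ _ _ := ⟨fun {M N} δ => by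
    obtain ⟨γ, ⟨h₁, h₂⟩, -⟩ := hdet.existsUnique M.isMod N.isMod (Mod.Hom.nt δ) (Mod.Hom.isHom δ)
    exact ⟨Mod.homMk γ h₁, Mod.Hom.ext h₂⟩⟩
  faithful P _ _ _ _ := ⟨fun {M N γ γ'} h => by
    exact Mod.Hom.ext ((hdet.existsUnique M.isMod N.isMod _
      (Mod.Hom.isHom ((det.sumMap.res P).map γ'))).unique
      ⟨Mod.Hom.isHom γ, congr_arg Mod.Hom.nt h⟩ ⟨Mod.Hom.isHom γ', rfl⟩)⟩
  essSurj P _ _ _ _ := ⟨fun D => by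
    obtain ⟨K, hK, t, ht, -⟩ := hdet.exists_factorization D.toDet
    -- In a groupoid the transformation of the factorization is automatically invertible, so `K` is
    -- an object restricting to `D` up to isomorphism.
    have h : IsIso t := NatIso.isIso_of_isIso_app _
    exact ⟨⟨K, hK⟩, ⟨Mod.isoMk (@asIso _ _ _ _ t h) ht⟩⟩⟩

end Universal

/-! ### Additivity morphisms with fixed other variables -/

section Update

variable {n : ℕ} {C : Fin n → Type u} [∀ i, Category.{v} (C i)]

/-- The morphism to the family with `i`-th entry `x` given by its components. -/
def toUpd {X Z : ∀ j, C j} (i : Fin n) (f : ∀ j, j ≠ i → (X j ⟶ Z j)) {x : C i} (p : X i ⟶ x) :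
    X ⟶ (Function.update Z i x : ∀ j, C j) := fun j => by
  by_cases h : j = i
  · subst h
    exact p ≫ eqToHom (Function.update_self j x Z).symm
  · exact f j h ≫ eqToHom (Function.update_of_ne h x Z).symm

lemma toUpd_self {X Z : ∀ j, C j} (i : Fin n) (f : ∀ j, j ≠ i → (X j ⟶ Z j)) {x : C i}
    (p : X i ⟶ x) : toUpd i f p i = p ≫ eqToHom (Function.update_self i x Z).symm := by
  simp [toUpd]

lemma toUpd_of_ne {X Z : ∀ j, C j} (i : Fin n) (f : ∀ j, j ≠ i → (X j ⟶ Z j)) {x : C i}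
    (p : X i ⟶ x) {j : Fin n} (h : j ≠ i) :
    toUpd i f p j = f j h ≫ eqToHom (Function.update_of_ne h x Z).symm := by
  simp [toUpd, h]

lemma updHom_self {a b : ∀ j, C j} (i : Fin n) (φ : ∀ j, j ≠ i → (a j ⟶ b j)) {x y : C i}
    (f : x ⟶ y) : updHom i φ f i = eqToHom (Function.update_self i x a) ≫ f ≫
      eqToHom (Function.update_self i y b).symm := by
  simp [updHom]

lemma updHom_of_ne {a b : ∀ j, C j} (i : Fin n) (φ : ∀ j, j ≠ i → (a j ⟶ b j)) {x y : C i}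
    (f : x ⟶ y) {j : Fin n} (h : j ≠ i) : updHom i φ f j =
      eqToHom (Function.update_of_ne h x a) ≫ φ j h ≫
        eqToHom (Function.update_of_ne h y b).symm := by
  simp [updHom, h]

/-- Two morphisms of families agree if they agree at `i` and away from `i`. -/
lemma pi_hom_ext (i : Fin n) {X Y : ∀ j, C j} {f g : X ⟶ Y} (h : f i = g i)
    (h' : ∀ j, j ≠ i → f j = g j) : f = g := by
  funext j
  by_cases e : j = i
  · subst e
    exact h
  · exact h' j e

lemma pi_eqToHom_apply {X Y : ∀ j, C j} (h : X = Y) (i : Fin n) :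
    eqToHom h i = eqToHom (congr_fun h i) := by
  subst h
  rfl

lemma toUpd_updHom {X Z B : ∀ j, C j} (i : Fin n) (f : ∀ j, j ≠ i → (X j ⟶ Z j)) {x y : C i}
    (p : X i ⟶ x) (φ : ∀ j, j ≠ i → (Z j ⟶ B j)) (q : x ⟶ y) :
    toUpd i f p ≫ updHom i φ q = toUpd i (fun j h => f j h ≫ φ j h) (p ≫ q) :=
  pi_hom_ext i (by simp [toUpd_self, updHom_self])
    (fun j h => by simp [toUpd_of_ne _ _ _ h, updHom_of_ne _ _ _ h])

lemma comp_toUpd {X Y Z : ∀ j, C j} (i : Fin n) (g : X ⟶ Y) (f : ∀ j, j ≠ i → (Y j ⟶ Z j))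
    {x : C i} (p : Y i ⟶ x) :
    g ≫ toUpd i f p = toUpd i (fun j h => g j ≫ f j h) (g i ≫ p) :=
  pi_hom_ext i (by simp [toUpd_self]) (fun j h => by simp [toUpd_of_ne _ _ _ h])

/-- Replacing an entry of a family by itself. -/
def updSelf (Z : ∀ j, C j) (i : Fin n) : Z ≅ Function.update Z i (Z i) :=
  eqToIso (Function.update_eq_self i Z).symm

lemma updSelf_hom (Z : ∀ j, C j) (i : Fin n) :
    (updSelf Z i).hom = toUpd i (fun j _ => 𝟙 (Z j)) (𝟙 (Z i)) :=
  pi_hom_ext i (by simp [updSelf, toUpd_self, pi_eqToHom_apply])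
    (fun j h => by simp [updSelf, toUpd_of_ne _ _ _ h, pi_eqToHom_apply])

lemma updSelf_inv_toUpd {Z B : ∀ j, C j} (i : Fin n) (f : ∀ j, j ≠ i → (Z j ⟶ B j)) {x : C i}
    (p : Z i ⟶ x) : (updSelf Z i).inv ≫ toUpd i f p = updHom i f p := by
  rw [Iso.inv_comp_eq, updSelf_hom, toUpd_updHom]
  simp

lemma toUpd_eta {X Z : ∀ j, C j} (i : Fin n) {x : C i}
    (m : X ⟶ (Function.update Z i x : ∀ j, C j)) :
    toUpd i (fun j h => m j ≫ eqToHom (Function.update_of_ne h x Z))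
      (m i ≫ eqToHom (Function.update_self i x Z)) = m :=
  pi_hom_ext i (by simp [toUpd_self]) (fun j h => by simp [toUpd_of_ne _ _ _ h])

/-- The morphism to a family with two prescribed entries given by its components. -/
def toUpd₂ {X Z : ∀ k, C k} (i j : Fin n) (f : ∀ k, k ≠ i → k ≠ j → (X k ⟶ Z k)) {x : C i} {y : C j}
    (p : X i ⟶ x) (q : X j ⟶ y) :
    X ⟶ (Function.update (Function.update Z i x) j y : ∀ k, C k) := fun k => by
  by_cases hj : k = j
  · subst hj
    exact q ≫ eqToHom (Function.update_self k y _).symm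
  · by_cases hi : k = i
    · subst hi
      exact p ≫ eqToHom ((Function.update_of_ne hj y _).trans (Function.update_self k x Z)).symm
    · exact f k hi hj ≫
        eqToHom ((Function.update_of_ne hj y _).trans (Function.update_of_ne hi x Z)).symm

section

variable {X Z : ∀ k, C k} {i j : Fin n} (f : ∀ k, k ≠ i → k ≠ j → (X k ⟶ Z k)) {x : C i} {y : C j}
    (p : X i ⟶ x) (q : X j ⟶ y)

lemma toUpd₂_snd : toUpd₂ i j f p q j = q ≫ eqToHom (Function.update_self j y _).symm := by
  simp [toUpd₂]

lemma toUpd₂_fst (hij : i ≠ j) : toUpd₂ i j f p q i = p ≫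
    eqToHom ((Function.update_of_ne hij y _).trans (Function.update_self i x Z)).symm := by
  simp [toUpd₂, hij]

lemma toUpd₂_of_ne {k : Fin n} (hi : k ≠ i) (hj : k ≠ j) : toUpd₂ i j f p q k = f k hi hj ≫
    eqToHom ((Function.update_of_ne hj y _).trans (Function.update_of_ne hi x Z)).symm := by
  simp [toUpd₂, hi, hj]

lemma toUpd₂_swap (hij : i ≠ j) : toUpd₂ i j f p q ≫ (swap hij Z x y).hom =
    toUpd₂ j i (fun k hj hi => f k hi hj) q p := by
  refine pi_hom_ext i ?_ (fun k hi => ?_)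
  · simp [toUpd₂_snd, toUpd₂_fst _ _ _ hij, swap, pi_eqToHom_apply]
  · by_cases hj : k = j
    · subst hj
      simp [toUpd₂_snd, toUpd₂_fst _ _ _ hi, swap, pi_eqToHom_apply]
    · simp [toUpd₂_of_ne _ _ _ hi hj, toUpd₂_of_ne _ _ _ hj hi, swap, pi_eqToHom_apply]

end

end Update

/-- A functor of several variables with additivity morphisms in each variable, for fixed values of
the other variables. -/
structure PreStrict {n : ℕ} {C : Fin n → Type u} [∀ i, Category.{v} (C i)]
    (σ : ∀ i, SumStr (C i)) (P : Type u₁) [Category.{v₁} P] [MonoidalCategory P] where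
  F : (∀ i, C i) ⥤ P
  add : ∀ (a : ∀ i, C i) (i : Fin n) {x y z : C i}, (σ i).Sum x y z →
    (F.obj (Function.update a i x) ⊗ F.obj (Function.update a i y) ⟶
      F.obj (Function.update a i z))

namespace PreStrict

variable {n : ℕ} {C : Fin n → Type u} [∀ i, Category.{v} (C i)] {σ : ∀ i, SumStr (C i)}
  {P : Type u₁} [Category.{v₁} P] [MonoidalCategory P]

/-- The functor of the `i`-th variable. -/
@[simps]
def slot (S : PreStrict σ P) (a : ∀ i, C i) (i : Fin n) : PreMod (σ i) P where
  F := MultiDeterminant.slot a i ⋙ S.F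
  add s := S.add a i s

/-- Compatibility of a natural transformation with the additivity morphisms. -/
def IsHom (S S' : PreStrict σ P) (τ : S.F ⟶ S'.F) : Prop :=
  ∀ (a : ∀ i, C i) (i : Fin n) {x y z : C i} (s : (σ i).Sum x y z),
    S.add a i s ≫ τ.app _ = (τ.app _ ⊗ₘ τ.app _) ≫ S'.add a i s

/-- The additivity morphism in the `i`-th variable, for fixed values of all variables but the
`i`-th and `j`-th. -/
def fst (S : PreStrict σ P) {i j : Fin n} (hij : i ≠ j) (a : ∀ i, C i) {x x' x'' : C i}
    (s : (σ i).Sum x x' x'') (y : C j) :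
    S.F.obj (Function.update (Function.update a i x) j y) ⊗
      S.F.obj (Function.update (Function.update a i x') j y) ⟶
      S.F.obj (Function.update (Function.update a i x'') j y) :=
  (S.F.map (swap hij a x y).hom ⊗ₘ S.F.map (swap hij a x' y).hom) ≫
    S.add (Function.update a j y) i s ≫ S.F.map (swap hij a x'' y).inv

/-- The additivity morphisms satisfy all relations. -/
structure IsStrict [SymmetricCategory P] (S : PreStrict σ P) : Prop where
  isMod : ∀ a i, (S.slot a i).IsMod
  natural : ∀ {a b : ∀ i, C i} (i : Fin n) (φ : ∀ j, j ≠ i → (a j ⟶ b j)),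
    PreMod.IsHom (S.slot a i) (S.slot b i) (Functor.whiskerRight (slotMap i φ) S.F)
  inter : ∀ {i j : Fin n} (hij : i ≠ j) (a : ∀ i, C i) {x x' x'' : C i} {y y' y'' : C j}
    (s : (σ i).Sum x x' x'') (s' : (σ j).Sum y y' y''),
    (S.fst hij a s y ⊗ₘ S.fst hij a s y') ≫ S.add (Function.update a i x'') j s' =
      tensorμ _ _ _ _ ≫ (S.add (Function.update a i x) j s' ⊗ₘ
        S.add (Function.update a i x') j s') ≫ S.fst hij a s y''

/-- The additivity morphisms extended to families of morphisms in the other variables. -/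
def madd (S : PreStrict σ P) (i : Fin n) {X Y Z : ∀ j, C j} (s : PiSum σ i X Y Z) :
    S.F.obj X ⊗ S.F.obj Y ⟶ S.F.obj Z :=
  (S.F.map (toUpd i s.f (𝟙 _)) ⊗ₘ S.F.map (toUpd i s.g (𝟙 _))) ≫
    S.add Z i s.s ≫ S.F.map (updSelf Z i).inv

/-- The functor of several variables given by additivity morphisms for fixed values of the other
variables. -/
@[simps]
def toMulti (S : PreStrict σ P) : PreMulti σ P where
  F := S.F
  add i _ _ _ s := S.madd i s

variable [SymmetricCategory P] {S : PreStrict σ P} (hS : S.IsStrict)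

include hS

/-- Joint naturality in all variables: a morphism of updated families is one in the other variables
followed by one in the `i`-th. -/
lemma IsStrict.add_updHom {a b : ∀ j, C j} {i : Fin n} {x y z x' y' z' : C i}
    {s : (σ i).Sum x y z} {s' : (σ i).Sum x' y' z'} (φ : ∀ j, j ≠ i → (a j ⟶ b j)) {p : x ⟶ x'}
    {q : y ⟶ y'} {r : z ⟶ z'} (H : (σ i).IsNat s s' p q r) :
    S.add a i s ≫ S.F.map (updHom i φ r) =
      (S.F.map (updHom i φ p) ⊗ₘ S.F.map (updHom i φ q)) ≫ S.add b i s' := by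
  have h₁ : S.add a i s ≫ S.F.map (updHom i φ (𝟙 z)) =
    (S.F.map (updHom i φ (𝟙 x)) ⊗ₘ S.F.map (updHom i φ (𝟙 y))) ≫ S.add b i s := hS.natural i φ s
  have h₂ : S.add b i s ≫ S.F.map (updHom i (fun j _ => 𝟙 (b j)) r) =
    (S.F.map (updHom i (fun j _ => 𝟙 (b j)) p) ⊗ₘ S.F.map (updHom i (fun j _ => 𝟙 (b j)) q)) ≫
      S.add b i s' := (hS.isMod b i).nat H
  have e {x x' : C i} (p : x ⟶ x') :
      updHom i φ p = updHom i φ (𝟙 x) ≫ updHom i (fun j _ => 𝟙 (b j)) p := by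
    rw [← updHom_comp]
    simp
  rw [e r, e p, e q, S.F.map_comp, reassoc_of% h₁, h₂]
  simp

/-- The working description of `madd`: along any compatible morphisms to families that differ only
in the `i`-th entry, it becomes the given additivity morphism. The equations `hf`, `hg` and `H`
express compatibility entry by entry. -/
lemma IsStrict.madd_comp {i : Fin n} {X Y Z B : ∀ j, C j} (s : PiSum σ i X Y Z) {x y z : C i}
    (t : (σ i).Sum x y z) (mX : X ⟶ (Function.update B i x : ∀ j, C j))
    (mY : Y ⟶ (Function.update B i y : ∀ j, C j)) (mZ : Z ⟶ (Function.update B i z : ∀ j, C j))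
    (hf : ∀ k h, s.f k h ≫ mZ k ≫ eqToHom (Function.update_of_ne h z B) =
      mX k ≫ eqToHom (Function.update_of_ne h x B))
    (hg : ∀ k h, s.g k h ≫ mZ k ≫ eqToHom (Function.update_of_ne h z B) =
      mY k ≫ eqToHom (Function.update_of_ne h y B))
    (H : (σ i).IsNat s.s t (mX i ≫ eqToHom (Function.update_self i x B))
      (mY i ≫ eqToHom (Function.update_self i y B))
      (mZ i ≫ eqToHom (Function.update_self i z B))) :
    S.madd i s ≫ S.F.map mZ = (S.F.map mX ⊗ₘ S.F.map mY) ≫ S.add B i t := by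
  rw [madd, Category.assoc, Category.assoc, ← S.F.map_comp, ← toUpd_eta i mZ, updSelf_inv_toUpd,
    hS.add_updHom _ H, tensorHom_comp_tensorHom_assoc, ← S.F.map_comp, ← S.F.map_comp,
    toUpd_updHom, toUpd_updHom]
  simp only [hf, hg, Category.id_comp, toUpd_eta]

lemma IsStrict.madd_toUpd {i : Fin n} {X Y Z B : ∀ j, C j} (s : PiSum σ i X Y Z) {x y z : C i}
    {t : (σ i).Sum x y z} (b : ∀ j, j ≠ i → (Z j ⟶ B j)) {p : X i ⟶ x} {q : Y i ⟶ y}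
    {r : Z i ⟶ z} (H : (σ i).IsNat s.s t p q r) :
    S.madd i s ≫ S.F.map (toUpd i b r) =
      (S.F.map (toUpd i (fun j h => s.f j h ≫ b j h) p) ⊗ₘ
        S.F.map (toUpd i (fun j h => s.g j h ≫ b j h) q)) ≫ S.add B i t :=
  hS.madd_comp s t _ _ _ (fun k h => by simp [toUpd_of_ne _ _ _ h])
    (fun k h => by simp [toUpd_of_ne _ _ _ h]) (by simpa [toUpd_self] using H)

lemma IsStrict.madd_nat {i : Fin n} {X Y Z X' Y' Z' : ∀ j, C j} {s : PiSum σ i X Y Z}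
    {s' : PiSum σ i X' Y' Z'} {p : X ⟶ X'} {q : Y ⟶ Y'} {r : Z ⟶ Z'}
    (H : (piStr σ i).IsNat s s' p q r) :
    S.madd i s ≫ S.F.map r = (S.F.map p ⊗ₘ S.F.map q) ≫ S.madd i s' := by
  obtain ⟨H₁, H₂, H₃⟩ := H
  have e := hS.madd_toUpd s (fun j _ => r j) H₁
  have e' : toUpd i (fun j _ => r j) (r i) = r ≫ (updSelf Z' i).hom := by
    rw [updSelf_hom, comp_toUpd]
    simp
  rw [← cancel_mono (S.F.map (updSelf Z' i).hom), Category.assoc, ← S.F.map_comp, ← e', e]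
  simp only [H₂, H₃, madd, Category.assoc, ← S.F.map_comp, Iso.inv_hom_id]
  rw [CategoryTheory.Functor.map_id, Category.comp_id, tensorHom_comp_tensorHom_assoc,
    ← S.F.map_comp, ← S.F.map_comp, comp_toUpd, comp_toUpd, Category.comp_id, Category.comp_id]

lemma IsStrict.madd_comm {i : Fin n} {X Y Z : ∀ j, C j} {s : PiSum σ i X Y Z}
    {s' : PiSum σ i Y X Z} (H : (piStr σ i).IsComm s s') :
    S.madd i s = (β_ _ _).hom ≫ S.madd i s' := by
  obtain ⟨H₁, H₂, H₃⟩ := H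
  have e : S.add Z i s.s = (β_ _ _).hom ≫ S.add Z i s'.s := (hS.isMod Z i).comm H₁
  have e₂ : s.f = s'.g := funext fun j => funext (H₂ j)
  have e₃ : s.g = s'.f := funext fun j => funext (H₃ j)
  simp only [madd, e, Category.assoc, BraidedCategory.braiding_naturality_assoc, e₂, e₃]

lemma IsStrict.madd_assoc {i : Fin n} {X Y T U V Z : ∀ j, C j} {s₁ : PiSum σ i X Y U}
    {s₂ : PiSum σ i U T Z} {s₃ : PiSum σ i Y T V} {s₄ : PiSum σ i X V Z}
    (H : (piStr σ i).IsAssoc s₁ s₂ s₃ s₄) :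
    S.madd i s₁ ▷ _ ≫ S.madd i s₂ = (α_ _ _ _).hom ≫ _ ◁ S.madd i s₃ ≫ S.madd i s₄ := by
  obtain ⟨H₁, H₂, H₃, H₄⟩ := H
  have e : S.add Z i s₁.s ▷ _ ≫ S.add Z i s₂.s =
    (α_ _ _ _).hom ≫ _ ◁ S.add Z i s₃.s ≫ S.add Z i s₄.s := (hS.isMod Z i).assoc H₁
  have e₂ : S.madd i s₂ = (S.F.map (toUpd i s₂.f (𝟙 _)) ⊗ₘ S.F.map (toUpd i s₂.g (𝟙 _))) ≫
    S.add Z i s₂.s ≫ S.F.map (updSelf Z i).inv := rfl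
  have e₄ : S.madd i s₄ = (S.F.map (toUpd i s₄.f (𝟙 _)) ⊗ₘ S.F.map (toUpd i s₄.g (𝟙 _))) ≫
    S.add Z i s₄.s ≫ S.F.map (updSelf Z i).inv := rfl
  rw [e₂, e₄, whiskerRight_comp_tensorHom_assoc,
    whiskerLeft_comp_tensorHom_assoc, hS.madd_toUpd s₁ s₂.f ((σ i).isNat_id _),
    hS.madd_toUpd s₃ s₄.g ((σ i).isNat_id _), ← Category.assoc, ← Category.assoc (_ ⊗ₘ _),
    tensor_assoc_comp e]
  have e₅ : s₂.g = fun j h => s₃.g j h ≫ s₄.g j h := funext fun j => funext (H₄ j)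
  simp only [H₂, H₃, e₅, Category.assoc]

/-- Both sides are transported to families that agree with `Z₃` outside `i` and `j`. There all
additivity morphisms are strict, and the interchange of `S` applies. -/
lemma IsStrict.madd_inter {i j : Fin n} {hij : i ≠ j} {X₁ X₂ X₃ Y₁ Y₂ Y₃ Z₁ Z₂ Z₃ : ∀ k, C k}
    {s₁ : PiSum σ i X₁ Y₁ Z₁} {s₂ : PiSum σ i X₂ Y₂ Z₂} {s₃ : PiSum σ i X₃ Y₃ Z₃}
    {sX : PiSum σ j X₁ X₂ X₃} {sY : PiSum σ j Y₁ Y₂ Y₃} {sZ : PiSum σ j Z₁ Z₂ Z₃}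
    (H : IsGrid σ i j hij s₁ s₂ s₃ sX sY sZ) :
    (S.madd i s₁ ⊗ₘ S.madd i s₂) ≫ S.madd j sZ =
      tensorμ _ _ _ _ ≫ (S.madd j sX ⊗ₘ S.madd j sY) ≫ S.madd i s₃ := by
  -- Transport of a row, a sum in the `i`-th variable, with common `j`-th entry `w`. The swaps in
  -- `fst` are absorbed by `toUpd₂_swap`; `hsnd` below does the same for columns.
  have hfst {X Y Z : ∀ k, C k} (s : PiSum σ i X Y Z) (c : ∀ k, k ≠ j → (Z k ⟶ Z₃ k))
      {x y z : C i} {w : C j} {t : (σ i).Sum x y z} (wX : X j ⟶ w) (wY : Y j ⟶ w) (wZ : Z j ⟶ w)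
      (hX : s.f j hij.symm ≫ wZ = wX) (hY : s.g j hij.symm ≫ wZ = wY)
      {p : X i ⟶ x} {q : Y i ⟶ y} {r : Z i ⟶ z} (H : (σ i).IsNat s.s t p q r) :
      S.madd i s ≫ S.F.map (toUpd₂ i j (fun k _ hj => c k hj) r wZ) =
        (S.F.map (toUpd₂ i j (fun k hi hj => s.f k hi ≫ c k hj) p wX) ⊗ₘ
          S.F.map (toUpd₂ i j (fun k hi hj => s.g k hi ≫ c k hj) q wY)) ≫
          S.fst hij Z₃ t w := by
    rw [fst, tensorHom_comp_tensorHom_assoc, ← S.F.map_comp, ← S.F.map_comp, toUpd₂_swap,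
      toUpd₂_swap, ← Category.assoc, ← S.F.mapIso_inv, Iso.eq_comp_inv, Category.assoc,
      Functor.mapIso_hom, ← S.F.map_comp, toUpd₂_swap]
    refine hS.madd_comp s t _ _ _ (fun k hi => ?_) (fun k hi => ?_) (by simpa [toUpd₂_snd] using H)
    · by_cases hj : k = j
      · subst hj
        simp [toUpd₂_fst _ _ _ hi, ← hX]
      · simp [toUpd₂_of_ne _ _ _ hj hi]
    · by_cases hj : k = j
      · subst hj
        simp [toUpd₂_fst _ _ _ hi, ← hY]
      · simp [toUpd₂_of_ne _ _ _ hj hi]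
  have hsnd {X Y Z : ∀ k, C k} (s : PiSum σ j X Y Z) (c : ∀ k, k ≠ i → (Z k ⟶ Z₃ k))
      {x y z : C j} {w : C i} {t : (σ j).Sum x y z} (wX : X i ⟶ w) (wY : Y i ⟶ w) (wZ : Z i ⟶ w)
      (hX : s.f i hij ≫ wZ = wX) (hY : s.g i hij ≫ wZ = wY)
      {p : X j ⟶ x} {q : Y j ⟶ y} {r : Z j ⟶ z} (H : (σ j).IsNat s.s t p q r) :
      S.madd j s ≫ S.F.map (toUpd₂ i j (fun k hi _ => c k hi) wZ r) =
        (S.F.map (toUpd₂ i j (fun k hi hj => s.f k hj ≫ c k hi) wX p) ⊗ₘ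
          S.F.map (toUpd₂ i j (fun k hi hj => s.g k hj ≫ c k hi) wY q)) ≫
          S.add (Function.update Z₃ i w) j t := by
    refine hS.madd_comp s t _ _ _ (fun k hj => ?_) (fun k hj => ?_) (by simpa [toUpd₂_snd] using H)
    · by_cases hi : k = i
      · subst hi
        simp [toUpd₂_fst _ _ _ hij, ← hX]
      · simp [toUpd₂_of_ne _ _ _ hi hj]
    · by_cases hi : k = i
      · subst hi
        simp [toUpd₂_fst _ _ _ hij, ← hY]
      · simp [toUpd₂_of_ne _ _ _ hi hj]
  -- `Z₃` with its own `i`-th and `j`-th entries reinserted equals `Z₃` only propositionally; `m` is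
  -- that identification, cancelled at the end.
  let m : Z₃ ⟶ (Function.update (Function.update Z₃ i (Z₃ i)) j (Z₃ j) : ∀ k, C k) :=
    toUpd₂ i j (fun k _ _ => 𝟙 (Z₃ k)) (𝟙 (Z₃ i)) (𝟙 (Z₃ j))
  have hm : m = eqToHom (by simp) := pi_hom_ext j
    (by simp [m, toUpd₂_snd, pi_eqToHom_apply]) (fun k hj => by
      by_cases hi : k = i
      · subst hi
        simp [m, toUpd₂_fst _ _ _ hj, pi_eqToHom_apply]
      · simp [m, toUpd₂_of_ne _ _ _ hi hj, pi_eqToHom_apply])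
  have : IsIso m := hm ▸ inferInstance
  have hZ := hsnd sZ (t := sZ.s) (fun k _ => 𝟙 (Z₃ k)) (sZ.f i hij) (sZ.g i hij) (𝟙 (Z₃ i))
    (Category.comp_id _) (Category.comp_id _) ((σ j).isNat_id _)
  have h₃ := hfst s₃ (t := s₃.s) (fun k _ => 𝟙 (Z₃ k)) (s₃.f j hij.symm) (s₃.g j hij.symm)
    (𝟙 (Z₃ j)) (Category.comp_id _) (Category.comp_id _) ((σ i).isNat_id _)
  have h₁ := hfst s₁ sZ.f (s₁.f j hij.symm) (s₁.g j hij.symm)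
    (𝟙 (Z₁ j)) (Category.comp_id _) (Category.comp_id _) H.nat_f
  have h₂ := hfst s₂ sZ.g (s₂.f j hij.symm) (s₂.g j hij.symm)
    (𝟙 (Z₂ j)) (Category.comp_id _) (Category.comp_id _) H.nat_g
  have hX := hsnd sX s₃.f (sX.f i hij) (sX.g i hij)
    (𝟙 (X₃ i)) (Category.comp_id _) (Category.comp_id _) H.nat_f'
  have hY := hsnd sY s₃.g (sY.f i hij) (sY.g i hij)
    (𝟙 (Y₃ i)) (Category.comp_id _) (Category.comp_id _) H.nat_g'
  rw [← cancel_mono (S.F.map m)]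
  simp only [Category.comp_id] at hZ h₃
  simp only [Category.assoc]
  rw [hZ, h₃, tensorHom_comp_tensorHom_assoc, tensorHom_comp_tensorHom_assoc, h₁, h₂, hX, hY,
    ← tensorHom_comp_tensorHom_assoc, ← tensorHom_comp_tensorHom_assoc, hS.inter,
    tensorμ_natural_assoc]
  simp only [H.ff, H.fg, H.gf, H.gg]

lemma IsStrict.toMulti : S.toMulti.IsMulti where
  isMod i := ⟨hS.madd_nat, hS.madd_comm, hS.madd_assoc⟩
  inter := hS.madd_inter

end PreStrict

/-! ### Sums transported along equalities of objects. -/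

section Cast

variable {C : Type u} [Category.{v} C]

/-- Sums of equal objects. -/
def SumStr.castSum (σ : SumStr C) {x y z x' y' z' : C} (hx : x' = x) (hy : y' = y) (hz : z' = z)
    (s : σ.Sum x y z) : σ.Sum x' y' z' := by
  subst hx hy hz
  exact s

variable {σ : SumStr C}

lemma SumStr.castSum_isNat {x y z x' y' z' : C} {hx : x' = x} {hy : y' = y} {hz : z' = z}
    {s : σ.Sum x y z} {x₁ y₁ z₁ x₁' y₁' z₁' : C} {hx₁ : x₁' = x₁} {hy₁ : y₁' = y₁}
    {hz₁ : z₁' = z₁} {s₁ : σ.Sum x₁ y₁ z₁} {p : x ⟶ x₁} {q : y ⟶ y₁} {r : z ⟶ z₁}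
    (H : σ.IsNat s s₁ p q r) {p' : x' ⟶ x₁'} {q' : y' ⟶ y₁'} {r' : z' ⟶ z₁'}
    (hp : p' = eqToHom hx ≫ p ≫ eqToHom hx₁.symm) (hq : q' = eqToHom hy ≫ q ≫ eqToHom hy₁.symm)
    (hr : r' = eqToHom hz ≫ r ≫ eqToHom hz₁.symm) :
    σ.IsNat (σ.castSum hx hy hz s) (σ.castSum hx₁ hy₁ hz₁ s₁) p' q' r' := by
  subst hx hy hz hx₁ hy₁ hz₁ hp hq hr
  have e : σ.IsNat s s₁ (eqToHom rfl ≫ p ≫ eqToHom rfl) (eqToHom rfl ≫ q ≫ eqToHom rfl)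
      (eqToHom rfl ≫ r ≫ eqToHom rfl) := by
    simpa using H
  exact e

lemma SumStr.castSum_isComm {x y z x' y' z' : C} {hx : x' = x} {hy : y' = y} {hz : z' = z}
    {s : σ.Sum x y z} {s₁ : σ.Sum y x z} (H : σ.IsComm s s₁) :
    σ.IsComm (σ.castSum hx hy hz s) (σ.castSum hy hx hz s₁) := by
  subst hx hy hz
  exact H

lemma SumStr.castSum_isAssoc {x y t p q z x' y' t' p' q' z' : C} {hx : x' = x} {hy : y' = y}
    {hz : z' = z} {ht : t' = t} {hp : p' = p} {hq : q' = q} {s₁ : σ.Sum x y p} {s₂ : σ.Sum p t z}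
    {s₃ : σ.Sum y t q} {s₄ : σ.Sum x q z} (H : σ.IsAssoc s₁ s₂ s₃ s₄) :
    σ.IsAssoc (σ.castSum hx hy hp s₁) (σ.castSum hp ht hz s₂) (σ.castSum hy ht hq s₃)
      (σ.castSum hx hq hz s₄) := by
  subst hx hy hz ht hp hq
  exact H

end Cast

/-! ### Passing between additivity for families and for fixed values of the other variables. -/

section

variable {n : ℕ} {C : Fin n → Type u} [∀ i, Category.{v} (C i)] {σ : ∀ i, SumStr (C i)}

/-- A sum in the `i`-th variable, with the same entries in the other variables. -/
def updSum (a : ∀ j, C j) (i : Fin n) {x y z : C i} (s : (σ i).Sum x y z) :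
    PiSum σ i (Function.update a i x) (Function.update a i y) (Function.update a i z) where
  s := (σ i).castSum (Function.update_self i x a) (Function.update_self i y a)
    (Function.update_self i z a) s
  f j h := eqToHom ((Function.update_of_ne h x a).trans (Function.update_of_ne h z a).symm)
  g j h := eqToHom ((Function.update_of_ne h y a).trans (Function.update_of_ne h z a).symm)

lemma updSum_isNat {a b : ∀ j, C j} {i : Fin n} {x y z x' y' z' : C i}
    {s : (σ i).Sum x y z} {s' : (σ i).Sum x' y' z'} (φ : ∀ j, j ≠ i → (a j ⟶ b j)) {p : x ⟶ x'}
    {q : y ⟶ y'} {r : z ⟶ z'} (H : (σ i).IsNat s s' p q r) :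
    (piStr σ i).IsNat (updSum a i s) (updSum b i s') (updHom i φ p) (updHom i φ q)
      (updHom i φ r) :=
  ⟨SumStr.castSum_isNat H (updHom_self _ _ _) (updHom_self _ _ _) (updHom_self _ _ _),
    fun j h => by simp [updSum, updHom_of_ne _ _ _ h],
    fun j h => by simp [updSum, updHom_of_ne _ _ _ h]⟩

/-- A sum in the `i`-th variable, with the same entries in the other variables, for a given `j`-th
entry. -/
def updSum₂ (a : ∀ k, C k) {i j : Fin n} (hij : i ≠ j) {x x' x'' : C i}
    (s : (σ i).Sum x x' x'') (y : C j) :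
    PiSum σ i (Function.update (Function.update a i x) j y)
      (Function.update (Function.update a i x') j y)
      (Function.update (Function.update a i x'') j y) where
  s := (σ i).castSum ((Function.update_of_ne hij _ _).trans (Function.update_self i x a))
    ((Function.update_of_ne hij _ _).trans (Function.update_self i x' a))
    ((Function.update_of_ne hij _ _).trans (Function.update_self i x'' a)) s
  f k h := eqToHom ((congr_fun (Function.update_comm hij x y a) k).trans
    (((Function.update_of_ne h _ _).trans (Function.update_of_ne h _ _).symm).trans
      (congr_fun (Function.update_comm hij x'' y a) k).symm))
  g k h := eqToHom ((congr_fun (Function.update_comm hij x' y a) k).trans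
    (((Function.update_of_ne h _ _).trans (Function.update_of_ne h _ _).symm).trans
      (congr_fun (Function.update_comm hij x'' y a) k).symm))

lemma updSum₂_isNat_swap (a : ∀ k, C k) {i j : Fin n} (hij : i ≠ j) {x x' x'' : C i}
    (s : (σ i).Sum x x' x'') (y : C j) :
    (piStr σ i).IsNat (updSum₂ a hij s y) (updSum (Function.update a j y) i s)
      (swap hij a x y).hom (swap hij a x' y).hom (swap hij a x'' y).hom :=
  ⟨SumStr.castSum_isNat ((σ i).isNat_id s) (by simp [swap, pi_eqToHom_apply])
      (by simp [swap, pi_eqToHom_apply]) (by simp [swap, pi_eqToHom_apply]),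
    fun k h => by simp [updSum, updSum₂, swap, pi_eqToHom_apply],
    fun k h => by simp [updSum, updSum₂, swap, pi_eqToHom_apply]⟩

lemma isGrid_updSum (a : ∀ k, C k) {i j : Fin n} (hij : i ≠ j) {x x' x'' : C i} {y y' y'' : C j}
    (s : (σ i).Sum x x' x'') (s' : (σ j).Sum y y' y'') :
    IsGrid σ i j hij (updSum₂ a hij s y) (updSum₂ a hij s y') (updSum₂ a hij s y'')
      (updSum (Function.update a i x) j s') (updSum (Function.update a i x') j s')
      (updSum (Function.update a i x'') j s') where
  nat_f := SumStr.castSum_isNat ((σ i).isNat_id s) (by simp [updSum]) (by simp [updSum])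
    (by simp [updSum])
  nat_g := SumStr.castSum_isNat ((σ i).isNat_id s) (by simp [updSum]) (by simp [updSum])
    (by simp [updSum])
  nat_f' := SumStr.castSum_isNat ((σ j).isNat_id s') (by simp [updSum₂]) (by simp [updSum₂])
    (by simp [updSum₂])
  nat_g' := SumStr.castSum_isNat ((σ j).isNat_id s') (by simp [updSum₂]) (by simp [updSum₂])
    (by simp [updSum₂])
  ff k hi hj := by simp [updSum, updSum₂]
  gf k hi hj := by simp [updSum, updSum₂]
  fg k hi hj := by simp [updSum, updSum₂]
  gg k hi hj := by simp [updSum, updSum₂]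

variable {P : Type u₁} [Category.{v₁} P] [MonoidalCategory P]

/-- The additivity morphisms for fixed values of the other variables. -/
@[simps]
def PreMulti.toStrict (G : PreMulti σ P) : PreStrict σ P where
  F := G.F
  add a i _ _ _ s := G.add i (updSum a i s)

variable [SymmetricCategory P]

section

variable {G : PreMulti σ P} (hG : G.IsMulti)

include hG

/-- The conjugation by swaps in `fst` is absorbed by naturality along `updSum₂_isNat_swap`. -/
lemma PreMulti.IsMulti.toStrict_fst {i j : Fin n} (hij : i ≠ j) (a : ∀ i, C i)
    {x x' x'' : C i} (s : (σ i).Sum x x' x'') (y : C j) :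
    G.toStrict.fst hij a s y = G.add i (updSum₂ a hij s y) := by
  have h : G.add i (updSum₂ a hij s y) ≫ G.F.map (swap hij a x'' y).hom =
    (G.F.map (swap hij a x y).hom ⊗ₘ G.F.map (swap hij a x' y).hom) ≫
      G.add i (updSum (Function.update a j y) i s) :=
    (hG.isMod i).nat (updSum₂_isNat_swap a hij s y)
  have h' : (G.F.map (swap hij a x y).hom ⊗ₘ G.F.map (swap hij a x' y).hom) ≫
      G.add i (updSum (Function.update a j y) i s) ≫ G.F.map (swap hij a x'' y).inv =
      G.add i (updSum₂ a hij s y) := by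
    rw [← reassoc_of% h, ← Functor.map_comp, Iso.hom_inv_id]
    simp
  exact h'

lemma PreMulti.IsMulti.toStrict : G.toStrict.IsStrict where
  isMod a i :=
    { nat := fun H => (hG.isMod i).nat (updSum_isNat (fun j _ => 𝟙 (a j)) H)
      comm := fun H => (hG.isMod i).comm ⟨SumStr.castSum_isComm H, fun _ _ => rfl, fun _ _ => rfl⟩
      assoc := fun H => (hG.isMod i).assoc ⟨SumStr.castSum_isAssoc H,
        fun _ _ => by simp [updSum], fun _ _ => by simp [updSum], fun _ _ => by
          simp only [updSum]
          exact (eqToHom_trans _ _).symm⟩ }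
  natural i φ := fun s => (hG.isMod i).nat (updSum_isNat φ ((σ i).isNat_id s))
  inter hij a x x' x'' y y' y'' s s' := by
    rw [hG.toStrict_fst, hG.toStrict_fst, hG.toStrict_fst]
    exact hG.inter (isGrid_updSum a hij s s')

/-- No additivity is lost by fixing the other variables: a general sum maps naturally to the one in
which the other entries are those of `Z`. -/
lemma PreMulti.IsMulti.toStrict_madd {i : Fin n} {X Y Z : ∀ j, C j} (s : PiSum σ i X Y Z) :
    G.toStrict.madd i s = G.add i s := by
  have h : G.add i s ≫ G.F.map (updSelf Z i).hom =
      (G.F.map (toUpd i s.f (𝟙 _)) ⊗ₘ G.F.map (toUpd i s.g (𝟙 _))) ≫ G.add i (updSum Z i s.s) :=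
    (hG.isMod i).nat ⟨SumStr.castSum_isNat (hx := rfl) (hy := rfl) (hz := rfl)
      ((σ i).isNat_id s.s) (by simp [toUpd_self]) (by simp [toUpd_self])
      (by simp [updSelf, pi_eqToHom_apply]),
      fun k h => by simp [updSum, updSelf, pi_eqToHom_apply, toUpd_of_ne _ _ _ h],
      fun k h => by simp [updSum, updSelf, pi_eqToHom_apply, toUpd_of_ne _ _ _ h]⟩
  have h' : (G.F.map (toUpd i s.f (𝟙 _)) ⊗ₘ G.F.map (toUpd i s.g (𝟙 _))) ≫
      G.add i (updSum Z i s.s) ≫ G.F.map (updSelf Z i).inv = G.add i s := by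
    rw [← reassoc_of% h, ← Functor.map_comp, Iso.hom_inv_id]
    simp
  exact h'

end

namespace PreStrict

variable {S S' : PreStrict σ P}

/-- The opposite round trip; with all comparison morphisms equal to identities, this is a case of
`madd_comp`. -/
lemma IsStrict.madd_updSum (hS : S.IsStrict) (a : ∀ j, C j) (i : Fin n) {x y z : C i}
    (s : (σ i).Sum x y z) : S.madd i (updSum a i s) = S.add a i s := by
  have h := hS.madd_comp (updSum a i s) s (𝟙 _) (𝟙 _) (𝟙 _) (fun k h => by simp [updSum])
    (fun k h => by simp [updSum])
    (SumStr.castSum_isNat (hx₁ := rfl) (hy₁ := rfl) (hz₁ := rfl) ((σ i).isNat_id s)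
      (by simp) (by simp) (by simp))
  simpa using h

lemma IsHom.toMulti {τ : S.F ⟶ S'.F} (h : IsHom S S' τ) :
    PreMulti.IsHom S.toMulti S'.toMulti τ := fun i X Y Z s => by
  have e : S.madd i s ≫ τ.app Z = (τ.app X ⊗ₘ τ.app Y) ≫ S'.madd i s := by
    simp only [madd, Category.assoc, τ.naturality, reassoc_of% (h Z i s.s),
      tensorHom_comp_tensorHom_assoc]
  exact e

lemma IsHom.of_toMulti (hS : S.IsStrict) (hS' : S'.IsStrict) {τ : S.F ⟶ S'.F}
    (h : PreMulti.IsHom S.toMulti S'.toMulti τ) : IsHom S S' τ := fun a i x y z s => by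
  have e : S.madd i (updSum a i s) ≫ τ.app _ = (τ.app _ ⊗ₘ τ.app _) ≫ S'.madd i (updSum a i s) :=
    h i (updSum a i s)
  rwa [hS.madd_updSum, hS'.madd_updSum] at e

end PreStrict

end

/-! ### Multiexact functors of Picard groupoids -/

section

variable {n : ℕ} {V : Fin n → Type w} [∀ i, Category.{w} (V i)]
  [∀ i, MonoidalCategory (V i)] [∀ i, SymmetricCategory (V i)]
  {P : Type w} [Category.{w} P] [MonoidalCategory P] [SymmetricCategory P]

namespace PreStrict

variable (S : PreStrict (fun i => monStr (V i)) P)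

/-- The additivity morphism of a morphism `x ⊗ y ⟶ z`. -/
def addHom (a : ∀ i, V i) (i : Fin n) {x y z : V i} (s : x ⊗ y ⟶ z) :
    S.F.obj (Function.update a i x) ⊗ S.F.obj (Function.update a i y) ⟶
      S.F.obj (Function.update a i z) :=
  S.add a i (show (monStr (V i)).Sum x y z from s)

/-- The additivity morphism of a morphism `x ⊗ y ⟶ z` in the first of two variables. -/
def fstHom {i j : Fin n} (hij : i ≠ j) (a : ∀ i, V i) {x x' x'' : V i} (s : x ⊗ x' ⟶ x'')
    (y : V j) :
    S.F.obj (Function.update (Function.update a i x) j y) ⊗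
      S.F.obj (Function.update (Function.update a i x') j y) ⟶
      S.F.obj (Function.update (Function.update a i x'') j y) :=
  (S.F.map (swap hij a x y).hom ⊗ₘ S.F.map (swap hij a x' y).hom) ≫
    S.addHom (Function.update a j y) i s ≫ S.F.map (swap hij a x'' y).inv

variable {S} (hM : ∀ a i, (S.slot a i).IsMod)
  (hN : ∀ {a b : ∀ i, V i} (i : Fin n) (φ : ∀ j, j ≠ i → (a j ⟶ b j)),
    PreMod.IsHom (S.slot a i) (S.slot b i) (Functor.whiskerRight (slotMap i φ) S.F))

include hM

lemma addHom_id_comp (a : ∀ i, V i) (i : Fin n) {x y z : V i} (s : x ⊗ y ⟶ z) :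
    S.addHom a i (𝟙 (x ⊗ y)) ≫ S.F.map (updHom i (fun j _ => 𝟙 (a j)) s) = S.addHom a i s :=
  (hM a i).addHom_id s

include hN

lemma addHom_updHom {a b : ∀ j, V j} {i : Fin n} {x y x' y' : V i}
    (φ : ∀ j, j ≠ i → (a j ⟶ b j)) (p : x ⟶ x') (q : y ⟶ y') :
    S.addHom a i (𝟙 (x ⊗ y)) ≫ S.F.map (updHom i φ (p ⊗ₘ q)) =
      (S.F.map (updHom i φ p) ⊗ₘ S.F.map (updHom i φ q)) ≫ S.addHom b i (𝟙 (x' ⊗ y')) := by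
  have h₁ {z : V i} (s : x ⊗ y ⟶ z) : S.addHom a i s ≫ S.F.map (updHom i φ (𝟙 z)) =
    (S.F.map (updHom i φ (𝟙 x)) ⊗ₘ S.F.map (updHom i φ (𝟙 y))) ≫ S.addHom b i s := hN i φ s
  have h₂ : S.addHom b i (𝟙 (x ⊗ y)) ≫ S.F.map (updHom i (fun j _ => 𝟙 (b j)) (p ⊗ₘ q)) =
    (S.F.map (updHom i (fun j _ => 𝟙 (b j)) p) ⊗ₘ S.F.map (updHom i (fun j _ => 𝟙 (b j)) q)) ≫
      S.addHom b i (𝟙 (x' ⊗ y')) :=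
    (hM b i).addHom_nat (s := 𝟙 (x ⊗ y)) (s' := 𝟙 (x' ⊗ y')) (p := p) (q := q) (by simp)
  have e {x x' : V i} (p : x ⟶ x') :
      updHom i φ p = updHom i φ (𝟙 x) ≫ updHom i (fun j _ => 𝟙 (b j)) p := by
    rw [← updHom_comp]
    simp
  rw [e (p ⊗ₘ q), e p, e q, S.F.map_comp, reassoc_of% h₁, h₂]
  simp

/-- It suffices to check the compatibility of the additivity morphisms in two variables for
identities. -/
lemma isStrict_of_interchange (hI : ∀ {i j : Fin n} (hij : i ≠ j) (a : ∀ i, V i) (x x' : V i)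
    (y y' : V j), (S.fstHom hij a (𝟙 (x ⊗ x')) y ⊗ₘ S.fstHom hij a (𝟙 (x ⊗ x')) y') ≫
      S.addHom (Function.update a i (x ⊗ x')) j (𝟙 (y ⊗ y')) =
      tensorμ _ _ _ _ ≫ (S.addHom (Function.update a i x) j (𝟙 (y ⊗ y')) ⊗ₘ
        S.addHom (Function.update a i x') j (𝟙 (y ⊗ y'))) ≫
          S.fstHom hij a (𝟙 (x ⊗ x')) (y ⊗ y')) : S.IsStrict where
  isMod := hM
  natural := hN
  inter {i j} hij a x x' x'' y y' y'' s s' := by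
    -- `K s t` is the morphism given by `s` and `t` in the two variables. `K'` is its counterpart
    -- for the other order of updating; `hK` relates them by swaps.
    let K {x₁ x₂ : V i} (s : x₁ ⟶ x₂) {y₁ y₂ : V j} (t : y₁ ⟶ y₂) :
      (Function.update (Function.update a i x₁) j y₁ : ∀ k, V k) ⟶
        Function.update (Function.update a i x₂) j y₂ :=
      updHom j (fun k _ => updHom i (fun l _ => 𝟙 (a l)) s k) t
    let K' {x₁ x₂ : V i} (s : x₁ ⟶ x₂) {y₁ y₂ : V j} (t : y₁ ⟶ y₂) :
      (Function.update (Function.update a j y₁) i x₁ : ∀ k, V k) ⟶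
        Function.update (Function.update a j y₂) i x₂ :=
      updHom i (fun k _ => updHom j (fun l _ => 𝟙 (a l)) t k) s
    have hK {x₁ x₂ : V i} (s : x₁ ⟶ x₂) {y₁ y₂ : V j} (t : y₁ ⟶ y₂) :
        K s t ≫ (swap hij a x₂ y₂).hom = (swap hij a x₁ y₁).hom ≫ K' s t := by
      refine pi_hom_ext i ?_ (fun k hi => ?_)
      · simp [K, K', updHom_self, updHom_of_ne _ _ _ hij, swap, pi_eqToHom_apply]
      · by_cases hj : k = j
        · subst hj
          simp [K, K', updHom_self, updHom_of_ne _ _ _ hi, swap, pi_eqToHom_apply]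
        · simp [K, K', updHom_of_ne _ _ _ hi, updHom_of_ne _ _ _ hj, swap, pi_eqToHom_apply]
    have hKc {x₁ x₂ x₃ : V i} (s : x₁ ⟶ x₂) (s' : x₂ ⟶ x₃) {y₁ y₂ y₃ : V j} (t : y₁ ⟶ y₂)
        (t' : y₂ ⟶ y₃) : K s t ≫ K s' t' = K (s ≫ s') (t ≫ t') := by
      refine pi_hom_ext i ?_ (fun k hi => ?_)
      · simp [K, updHom_self, updHom_of_ne _ _ _ hij]
      · by_cases hj : k = j
        · subst hj
          simp [K, updHom_self]
        · simp [K, updHom_of_ne _ _ _ hi, updHom_of_ne _ _ _ hj]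
    have hfst₀ {x₁ x₂ x₃ x₁' x₂' x₃' : V i} {y₁ y₂ : V j} {s : x₁ ⊗ x₂ ⟶ x₃} {s' : x₁' ⊗ x₂' ⟶ x₃'}
        {p : x₁ ⟶ x₁'} {q : x₂ ⟶ x₂'} {r : x₃ ⟶ x₃'} (t : y₁ ⟶ y₂)
        (h : S.addHom (Function.update a j y₁) i s ≫ S.F.map (K' r t) =
          (S.F.map (K' p t) ⊗ₘ S.F.map (K' q t)) ≫ S.addHom (Function.update a j y₂) i s') :
        S.fstHom hij a s y₁ ≫ S.F.map (K r t) =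
          (S.F.map (K p t) ⊗ₘ S.F.map (K q t)) ≫ S.fstHom hij a s' y₂ := by
      rw [fstHom, fstHom, tensorHom_comp_tensorHom_assoc, ← S.F.map_comp, ← S.F.map_comp, hK, hK,
        S.F.map_comp, S.F.map_comp, ← tensorHom_comp_tensorHom_assoc, ← reassoc_of% h,
        Category.assoc, Category.assoc, ← S.F.map_comp, ← S.F.map_comp,
        (Iso.inv_comp_eq _).2 ((Category.assoc _ _ _).symm.trans
          ((Iso.eq_comp_inv _).2 (hK r t)).symm).symm]
    have hfst {x₁ x₂ x₁' x₂' : V i} (s₁ : x₁ ⟶ x₁') (s₂ : x₂ ⟶ x₂') {y₁ y₂ : V j} (t : y₁ ⟶ y₂) :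
        S.fstHom hij a (𝟙 (x₁ ⊗ x₂)) y₁ ≫ S.F.map (K (s₁ ⊗ₘ s₂) t) =
          (S.F.map (K s₁ t) ⊗ₘ S.F.map (K s₂ t)) ≫ S.fstHom hij a (𝟙 (x₁' ⊗ x₂')) y₂ := by
      exact hfst₀ t (addHom_updHom hM hN _ s₁ s₂)
    have hK₁ (x₁ : V i) (y₁ : V j) : K (𝟙 x₁) (𝟙 y₁) = 𝟙 _ := by
      refine pi_hom_ext i ?_ (fun k hi => ?_)
      · simp [K, updHom_self, updHom_of_ne _ _ _ hij]
      · by_cases hj : k = j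
        · subst hj
          simp [K, updHom_self]
        · simp [K, updHom_of_ne _ _ _ hi, updHom_of_ne _ _ _ hj]
    have hfst' {x₁ x₂ x₃ : V i} (s : x₁ ⊗ x₂ ⟶ x₃) (y : V j) :
        S.fstHom hij a (𝟙 (x₁ ⊗ x₂)) y ≫ S.F.map (K s (𝟙 y)) = S.fstHom hij a s y := by
      have h := hfst₀ (s := 𝟙 (x₁ ⊗ x₂)) (s' := s) (p := 𝟙 x₁) (q := 𝟙 x₂) (r := s) (𝟙 y) (by
        have e {z₁ z₂ : V i} (s : z₁ ⟶ z₂) :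
            K' s (𝟙 y) = updHom i (fun k _ => 𝟙 (Function.update a j y k)) s := by
          simp only [K', updHom_id]
          rfl
        rw [e, e, e, addHom_id_comp hM, updHom_id, updHom_id]
        simp)
      rw [h, hK₁, hK₁]
      simp
    have hsnd {x₁ x₂ : V i} (s : x₁ ⟶ x₂) {y₁ y₂ y₁' y₂' : V j} (t₁ : y₁ ⟶ y₁') (t₂ : y₂ ⟶ y₂') :
        S.addHom (Function.update a i x₁) j (𝟙 (y₁ ⊗ y₂)) ≫ S.F.map (K s (t₁ ⊗ₘ t₂)) =
          (S.F.map (K s t₁) ⊗ₘ S.F.map (K s t₂)) ≫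
            S.addHom (Function.update a i x₂) j (𝟙 (y₁' ⊗ y₂')) :=
      addHom_updHom hM hN _ t₁ t₂
    have hsnd' (x₁ : V i) {y₁ y₂ y₃ : V j} (t : y₁ ⊗ y₂ ⟶ y₃) :
        S.addHom (Function.update a i x₁) j (𝟙 (y₁ ⊗ y₂)) ≫ S.F.map (K (𝟙 x₁) t) =
          S.addHom (Function.update a i x₁) j t := by
      rw [← addHom_id_comp hM (s := t)]
      have : K (𝟙 x₁) t = updHom j (fun k _ => 𝟙 (Function.update a i x₁ k)) t := by
        simp only [K, updHom_id]
        rfl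
      rw [this]
    -- Each additivity morphism is the one of an identity followed by some `K`. After `hI` for
    -- identities, the remaining morphisms `K` on the two sides agree by functoriality in both
    -- variables.
    have key (s : x ⊗ x' ⟶ x'') (s' : y ⊗ y' ⟶ y'') : (S.fstHom hij a s y ⊗ₘ S.fstHom hij a s y') ≫
        S.addHom (Function.update a i x'') j s' =
      tensorμ _ _ _ _ ≫ (S.addHom (Function.update a i x) j s' ⊗ₘ
        S.addHom (Function.update a i x') j s') ≫ S.fstHom hij a s y'' := by
      rw [← hfst' s y, ← hfst' s y', ← hsnd' x'', ← tensorHom_comp_tensorHom_assoc,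
        ← reassoc_of% (hsnd s (𝟙 y) (𝟙 y')), reassoc_of% (hI hij a x x' y y'),
        ← hsnd' x s', ← hsnd' x' s', ← hfst' s y'', ← tensorHom_comp_tensorHom_assoc,
        ← reassoc_of% (hfst (𝟙 x) (𝟙 x') s'), ← S.F.map_comp, ← S.F.map_comp]
      have e : K s (𝟙 y ⊗ₘ 𝟙 y') ≫ K (𝟙 x'') s' = K (𝟙 x ⊗ₘ 𝟙 x') s' ≫ K s (𝟙 y'') := by
        simp only [hKc, id_tensorHom_id, Category.id_comp, Category.comp_id]
      rw [e]
    exact key s s'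

end PreStrict

lemma PreMod.IsHom.isMonoidal {V : Type u} [Category.{v} V] [MonoidalCategory V]
    [SymmetricCategory V] [PicardGroupoid P] {M N : PreMod (monStr V) P} {γ : M.F ⟶ N.F}
    (h : IsHom M N γ) (hM : M.IsMod) (hN : N.IsMod) :
    letI := hM.braided
    letI := hN.braided
    NatTrans.IsMonoidal γ := by
  letI := hM.braided
  letI := hN.braided
  refine PreMod.isMonoidal_of_isHom (F := M.F) (G := N.F) fun {x y z} s => ?_
  exact (congr_arg (· ≫ γ.app z) (hM.ofLax_add s)).trans ((h s).trans
    (congr_arg ((γ.app x ⊗ₘ γ.app y) ≫ ·) (hN.ofLax_add s).symm))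

namespace MultiexactPic

open Functor.LaxMonoidal

/-- The additivity morphisms of a multiexact functor. -/
def toStrict (d : MultiexactPic V P) : PreStrict (fun i => monStr (V i)) P where
  F := d.toFunctor
  add a i _ _ _ s := (PreMod.ofLax (slot a i ⋙ d.toFunctor)).add s

lemma toStrict_addHom_id (d : MultiexactPic V P) (a : ∀ i, V i) (i : Fin n) (x y : V i) :
    d.toStrict.addHom a i (𝟙 (x ⊗ y)) = μ (slot a i ⋙ d.toFunctor) x y :=
  (congr_arg (μ (slot a i ⋙ d.toFunctor) x y ≫ ·) ((slot a i ⋙ d.toFunctor).map_id _)).trans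
    (Category.comp_id _)

lemma toStrict_fstHom_id (d : MultiexactPic V P) {i j : Fin n} (hij : i ≠ j) (a : ∀ i, V i)
    (x x' : V i) (y : V j) :
    d.toStrict.fstHom hij a (𝟙 (x ⊗ x')) y = d.sumFst hij a x x' y := by
  unfold PreStrict.fstHom
  rw [toStrict_addHom_id]
  rfl

lemma toStrict_isStrict (d : MultiexactPic V P) : d.toStrict.IsStrict := by
  refine PreStrict.isStrict_of_interchange (fun a i => PreMod.isMod_ofLax (slot a i ⋙ d.toFunctor))
    (fun {a b} i φ => ?_) (fun {i j} hij a x x' y y' => ?_)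
  · have := d.natural i φ
    exact fun {x y z} s => PreMod.isHom_ofLax (F := slot a i ⋙ d.toFunctor)
      (G := slot b i ⋙ d.toFunctor) (Functor.whiskerRight (slotMap i φ) d.toFunctor) s
  · have h := d.interchange hij a x x' y y'
    rw [toStrict_fstHom_id, toStrict_fstHom_id, toStrict_fstHom_id, toStrict_addHom_id,
      toStrict_addHom_id, toStrict_addHom_id]
    have h' : (d.sumFst hij a x x' y ⊗ₘ d.sumFst hij a x x' y') ≫ d.sumSnd i j a (x ⊗ x') y y' =
        tensorμ _ _ _ _ ≫ (d.sumSnd i j a x y y' ⊗ₘ d.sumSnd i j a x' y y') ≫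
          d.sumFst hij a x x' (y ⊗ y') := by
      rw [h, reassoc_of% tensorμ_tensorμ]
    exact h'

variable [PicardGroupoid P]

/-- A functor of several variables with additivity morphisms to a Picard groupoid is
multiexact. -/
def ofStrict {S : PreStrict (fun i => monStr (V i)) P} (hS : S.IsStrict) : MultiexactPic V P where
  toFunctor := S.F
  braided a i := (hS.isMod a i).braided
  natural {a b} i φ := PreMod.IsHom.isMonoidal (hS.natural i φ) (hS.isMod a i) (hS.isMod b i)
  interchange {i j} hij a x x' y y' := by
    have h : (S.fstHom hij a (𝟙 (x ⊗ x')) y ⊗ₘ S.fstHom hij a (𝟙 (x ⊗ x')) y') ≫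
      S.addHom (Function.update a i (x ⊗ x')) j (𝟙 (y ⊗ y')) =
      tensorμ _ _ _ _ ≫ (S.addHom (Function.update a i x) j (𝟙 (y ⊗ y')) ⊗ₘ
        S.addHom (Function.update a i x') j (𝟙 (y ⊗ y'))) ≫
          S.fstHom hij a (𝟙 (x ⊗ x')) (y ⊗ y') :=
      hS.inter hij a (σ := fun i => monStr (V i)) (show (monStr (V i)).Sum x x' _ from 𝟙 (x ⊗ x'))
        (show (monStr (V j)).Sum y y' _ from 𝟙 (y ⊗ y'))
    -- `interchange` adds in the second variable first, whereas `inter` adds in the first variable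
    -- first; the involution `tensorμ` converts one into the other.
    have h' : (S.addHom (Function.update a i x) j (𝟙 (y ⊗ y')) ⊗ₘ
        S.addHom (Function.update a i x') j (𝟙 (y ⊗ y'))) ≫
          S.fstHom hij a (𝟙 (x ⊗ x')) (y ⊗ y') =
        tensorμ _ _ _ _ ≫ (S.fstHom hij a (𝟙 (x ⊗ x')) y ⊗ₘ S.fstHom hij a (𝟙 (x ⊗ x')) y') ≫
      S.addHom (Function.update a i (x ⊗ x')) j (𝟙 (y ⊗ y')) := by
      rw [h, reassoc_of% tensorμ_tensorμ]
    exact h'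

lemma ofStrict_toStrict_add {S : PreStrict (fun i => monStr (V i)) P} (hS : S.IsStrict)
    (a : ∀ i, V i) (i : Fin n) {x y z : V i} (s : (monStr (V i)).Sum x y z) :
    (ofStrict hS).toStrict.add a i s = S.add a i s :=
  (hS.isMod a i).ofLax_add s

/-- Monoidal transformations must also respect units, but with a Picard groupoid as target this
follows from additivity. -/
lemma isMonoidal_iff {d d' : MultiexactPic V P} (β : d.toFunctor ⟶ d'.toFunctor) :
    MultiexactPic.IsMonoidal (F := d) (G := d') β ↔ PreStrict.IsHom d.toStrict d'.toStrict β := by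
  refine ⟨fun h a i {x y z} s => ?_, fun h a i => ?_⟩
  · have := h a i
    exact PreMod.isHom_ofLax (F := slot a i ⋙ d.toFunctor) (G := slot a i ⋙ d'.toFunctor)
      (Functor.whiskerLeft (slot a i) β) s
  · exact PreMod.isMonoidal_of_isHom (F := slot a i ⋙ d.toFunctor)
      (G := slot a i ⋙ d'.toFunctor) (γ := Functor.whiskerLeft (slot a i) β)
      (fun {x y z} s => h a i s)

end MultiexactPic

end

/-! ### Multi-determinant functors as functors with additivity morphisms -/

section Core

variable {n : ℕ} {T : Fin n → Type u} [∀ i, Category.{v} (T i)]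

lemma coreHom_ext {C : Type u} [Category.{v} C] {X Y : Core C} {f g : X ⟶ Y}
    (h : f.iso.hom = g.iso.hom) : f = g := by
  exact congr_arg CoreHom.mk (Iso.ext h)

lemma eqToHom_conj {C : Type u} [Category.{v} C] {A X Y B D : C} (h₁ : A = X) (f : X ⟶ Y)
    (h₂ : Y = B) (h₃ : B = D) (h₄ : A = X) (h₅ : Y = D) :
    (eqToHom h₁ ≫ f ≫ eqToHom h₂) ≫ eqToHom h₃ = eqToHom h₄ ≫ f ≫ eqToHom h₅ := by
  simp

lemma eqToHom_iso_hom {C : Type u} [Category.{v} C] {X Y : Core C} (h : X = Y) :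
    (eqToHom h).iso.hom = eqToHom (congr_arg Core.of h) := by
  subst h
  rfl

@[simp] lemma coreHom_comp_hom {C : Type u} [Category.{v} C] {X Y Z : Core C} (f : X ⟶ Y)
    (g : Y ⟶ Z) : (f ≫ g).iso.hom = f.iso.hom ≫ g.iso.hom := rfl

/-- The product of the isomorphisms as isomorphisms in the product. -/
@[simps obj]
def coreProd (T : Fin n → Type u) [∀ i, Category.{v} (T i)] :
    (∀ i, Core (T i)) ⥤ Core (∀ i, T i) where
  obj a := ⟨fun i => (a i).of⟩
  map f := ⟨⟨fun i => (f i).iso.hom, fun i => (f i).iso.inv,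
    funext fun i => (f i).iso.hom_inv_id, funext fun i => (f i).iso.inv_hom_id⟩⟩

lemma coreProd_map_hom {a b : ∀ i, Core (T i)} (f : a ⟶ b) (i : Fin n) :
    ((coreProd T).map f).iso.hom i = (f i).iso.hom := rfl

/-- The family of underlying objects. -/
abbrev ofFam (a : ∀ i, Core (T i)) : ∀ i, T i := fun i => (a i).of

/-- Multi-determinant functors live on the core of the product, the curried theory on the product of
the cores. Updating commutes with the comparison only propositionally, which is the source of the
`eqToHom`s that follow. -/
lemma coreProd_update (a : ∀ i, Core (T i)) (i : Fin n) (x : Core (T i)) :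
    (coreProd T).obj (Function.update a i x) = ⟨Function.update (ofFam a) i x.of⟩ :=
  congr_arg Core.mk (funext fun k => Function.apply_update (fun _ y => y.of) a i x k)

lemma coreProd_updHom {a b : ∀ i, Core (T i)} {i : Fin n} (φ : ∀ j, j ≠ i → (a j ⟶ b j))
    {x y : Core (T i)} (f : x ⟶ y)
    {m : (⟨Function.update (ofFam a) i x.of⟩ : Core (∀ i, T i)) ⟶
      ⟨Function.update (ofFam b) i y.of⟩}
    (hm : m.iso.hom = updHom i (fun j h => (φ j h).iso.hom) f.iso.hom) :
    (coreProd T).map (updHom i φ f) ≫ eqToHom (coreProd_update b i y) =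
      eqToHom (coreProd_update a i x) ≫ m := by
  apply coreHom_ext
  rw [coreHom_comp_hom, coreHom_comp_hom, hm]
  refine pi_hom_ext i ?_ (fun j h => ?_)
  · simp [eqToHom_iso_hom, coreProd_map_hom, updHom_self, pi_eqToHom_apply]
    exact eqToHom_conj _ _ _ _ _ _
  · simp [eqToHom_iso_hom, coreProd_map_hom, updHom_of_ne _ _ _ h, pi_eqToHom_apply]
    exact eqToHom_conj _ _ _ _ _ _

/-- The functors of the `i`-th variable given by a family of objects. -/
def coreSlot (a : ∀ i, Core (T i)) (i : Fin n) :
    slot a i ⋙ coreProd T ≅ (slot (ofFam a) i).core :=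
  NatIso.ofComponents (fun x => eqToIso (coreProd_update a i x))
    (fun f => coreProd_updHom (fun j _ => 𝟙 (a j)) f rfl)

end Core

section

variable {n : ℕ} {T : Fin n → Type u} [∀ i, Category.{v} (T i)] [∀ i, HasZeroObject (T i)]
  [∀ i, Preadditive (T i)] [∀ i, HasShift (T i) ℤ]
  [∀ i, ∀ k : ℤ, (shiftFunctor (T i) k).Additive] [∀ i, Pretriangulated (T i)]
  {P : Type w} [Category.{w} P] [MonoidalCategory P]

namespace PreMultiDet

/-- The additivity morphism of a sum of objects. -/
def addTri (E : PreMultiDet T P) (a : ∀ i, T i) (i : Fin n) {x y z : Core (T i)}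
    (s : TriSum x y z) : E.toFunctor.obj ⟨Function.update a i x.of⟩ ⊗
      E.toFunctor.obj ⟨Function.update a i y.of⟩ ⟶ E.toFunctor.obj ⟨Function.update a i z.of⟩ :=
  E.add a i (Triangle.mk s.f s.g s.h) s.mem

/-- The additivity morphism of a sum of objects in the first of two variables. -/
def fstTri (E : PreMultiDet T P) {i j : Fin n} (hij : i ≠ j) (a : ∀ k, T k)
    {x x' x'' : Core (T i)} (s : TriSum x x' x'') (y : T j) :
    E.obj₂ a i j x.of y ⊗ E.obj₂ a i j x'.of y ⟶ E.obj₂ a i j x''.of y :=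
  E.addFst hij a (Triangle.mk s.f s.g s.h) s.mem y

/-- The additivity morphisms for families of objects. -/
def toStrict (E : PreMultiDet T P) : PreStrict (fun i => triStr (T i)) P where
  F := coreProd T ⋙ E.toFunctor
  add a i {x y z} s :=
    (E.toFunctor.map (eqToHom (coreProd_update a i x)) ⊗ₘ
      E.toFunctor.map (eqToHom (coreProd_update a i y))) ≫
      E.addTri (ofFam a) i s ≫ E.toFunctor.map (eqToHom (coreProd_update a i z).symm)

/-- The additivity morphism of a sum of objects in `toStrict`. -/
def sAdd (E : PreMultiDet T P) (a : ∀ i, Core (T i)) (i : Fin n) {x y z : Core (T i)}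
    (s : TriSum x y z) : E.toFunctor.obj ((coreProd T).obj (Function.update a i x)) ⊗
      E.toFunctor.obj ((coreProd T).obj (Function.update a i y)) ⟶
      E.toFunctor.obj ((coreProd T).obj (Function.update a i z)) :=
  (E.toFunctor.map (eqToHom (coreProd_update a i x)) ⊗ₘ
      E.toFunctor.map (eqToHom (coreProd_update a i y))) ≫
      E.addTri (ofFam a) i s ≫ E.toFunctor.map (eqToHom (coreProd_update a i z).symm)

lemma toStrict_add (E : PreMultiDet T P) (a : ∀ i, Core (T i)) (i : Fin n) {x y z : Core (T i)}
    (s : TriSum x y z) : E.toStrict.add a i s = E.sAdd a i s := rfl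

variable {E E' : PreMultiDet T P}

lemma isHom_coreSlot (a : ∀ i, Core (T i)) (i : Fin n) :
    PreMod.IsHom (E.toStrict.slot a i) (E.restrict (ofFam a) i).toPreMod
      (Functor.isoWhiskerRight (coreSlot a i) E.toFunctor).hom := fun {x y z} s => by
  have h (s : TriSum x y z) : E.sAdd a i s ≫ E.toFunctor.map (eqToHom (coreProd_update a i z)) =
      (E.toFunctor.map (eqToHom (coreProd_update a i x)) ⊗ₘ
      E.toFunctor.map (eqToHom (coreProd_update a i y))) ≫ E.addTri (ofFam a) i s := by
    rw [sAdd, Category.assoc, Category.assoc, ← E.toFunctor.map_comp, eqToHom_trans, eqToHom_refl]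
    simp
  exact h s

lemma isHom_iff_addTri {τ : E.toFunctor ⟶ E'.toFunctor} : PreMultiDet.IsHom τ ↔
    ∀ (a : ∀ i, T i) (i : Fin n) {x y z : Core (T i)} (s : TriSum x y z),
      E.addTri a i s ≫ τ.app ⟨Function.update a i z.of⟩ =
      (τ.app ⟨Function.update a i x.of⟩ ⊗ₘ τ.app ⟨Function.update a i y.of⟩) ≫ E'.addTri a i s :=
  ⟨fun h a i _ _ _ s => h a i (Triangle.mk s.f s.g s.h) s.mem, fun h a i Δ hΔ =>
    h a i (x := ⟨Δ.obj₃⟩) (y := ⟨Δ.obj₁⟩) (z := ⟨Δ.obj₂⟩) ⟨Δ.mor₁, Δ.mor₂, Δ.mor₃, hΔ⟩⟩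

/-- The `eqToHom`s conjugating the additivity of `toStrict` slide through `τ` by naturality and
cancel; every family of objects comes from a family in the cores. -/
lemma isHom_toStrict_iff {τ : E.toFunctor ⟶ E'.toFunctor} :
    PreStrict.IsHom E.toStrict E'.toStrict (Functor.whiskerLeft (coreProd T) τ) ↔
      PreMultiDet.IsHom τ := by
  rw [isHom_iff_addTri]
  have key (a : ∀ i, Core (T i)) (i : Fin n) {x y z : Core (T i)} (s : TriSum x y z) :
      E.sAdd a i s ≫ τ.app ((coreProd T).obj (Function.update a i z)) =
      (τ.app ((coreProd T).obj (Function.update a i x)) ⊗ₘ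
        τ.app ((coreProd T).obj (Function.update a i y))) ≫ E'.sAdd a i s ↔
      E.addTri (ofFam a) i s ≫ τ.app ⟨Function.update (ofFam a) i z.of⟩ =
      (τ.app ⟨Function.update (ofFam a) i x.of⟩ ⊗ₘ τ.app ⟨Function.update (ofFam a) i y.of⟩) ≫
        E'.addTri (ofFam a) i s := by
    have h (x) := τ.naturality (eqToHom (coreProd_update a i x))
    rw [sAdd, sAdd, Category.assoc, Category.assoc,
      τ.naturality (eqToHom (coreProd_update a i z).symm), tensorHom_comp_tensorHom_assoc,
      ← h x, ← h y, ← tensorHom_comp_tensorHom_assoc, cancel_epi,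
      ← Category.assoc, ← Category.assoc, cancel_mono]
  exact ⟨fun h a i x y z s => (key (fun i => ⟨a i⟩) i s).1 (h (fun i => ⟨a i⟩) i s),
    fun h a i x y z s => (key a i s).2 (h (ofFam a) i s)⟩

lemma obj₂_comm (E : PreMultiDet T P) {i j : Fin n} (hij : i ≠ j) (a : ∀ k, T k) (x : T i)
    (y : T j) : E.obj₂ a i j x y = E.toFunctor.obj ⟨Function.update (Function.update a j y) i x⟩ :=
  congr_arg _ (congr_arg Core.mk (Function.update_comm hij x y a))

/-- Swaps are images of equalities. Written as `eqToHom`s, they compose freely with the other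
bookkeeping isomorphisms. -/
lemma fstTri_eq (E : PreMultiDet T P) {i j : Fin n} (hij : i ≠ j) (a : ∀ k, T k)
    {x x' x'' : Core (T i)} (s : TriSum x x' x'') (y : T j) :
    E.fstTri hij a s y = (eqToHom (E.obj₂_comm hij a x.of y) ⊗ₘ
      eqToHom (E.obj₂_comm hij a x'.of y)) ≫ E.addTri (Function.update a j y) i s ≫
        eqToHom (E.obj₂_comm hij a x''.of y).symm := by
  have e (x : T i) : E.toFunctor.map (CoreHom.mk (swap hij a x y)) =
      eqToHom (E.obj₂_comm hij a x y) :=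
    (congr_arg _ (coreHom_ext (eqToHom_iso_hom (congr_arg Core.mk
      (Function.update_comm hij x y a))).symm)).trans (eqToHom_map _ _)
  have e' (x : T i) : E.toFunctor.map (CoreHom.mk (swap hij a x y).symm) =
      eqToHom (E.obj₂_comm hij a x y).symm :=
    (congr_arg _ (coreHom_ext (eqToHom_iso_hom (congr_arg Core.mk
      (Function.update_comm hij x y a).symm)).symm)).trans (eqToHom_map _ _)
  have h : E.fstTri hij a s y = (E.toFunctor.map (CoreHom.mk (swap hij a x.of y)) ⊗ₘ
      E.toFunctor.map (CoreHom.mk (swap hij a x'.of y))) ≫ E.addTri (Function.update a j y) i s ≫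
        E.toFunctor.map (CoreHom.mk (swap hij a x''.of y).symm) := rfl
  rw [h, e, e, e']

lemma ofFam_update (a : ∀ i, Core (T i)) (i : Fin n) (x : Core (T i)) :
    ofFam (Function.update a i x) = Function.update (ofFam a) i x.of :=
  funext fun k => Function.apply_update (fun _ y => y.of) a i x k

lemma coreProd_update' {a : ∀ i, Core (T i)} {b : ∀ i, T i} (h : ofFam a = b) (i : Fin n)
    (x : Core (T i)) :
    (coreProd T).obj (Function.update a i x) = ⟨Function.update b i x.of⟩ := by
  rw [coreProd_update, h]

lemma sAdd_eq (E : PreMultiDet T P) {a : ∀ i, Core (T i)} {b : ∀ i, T i} (h : ofFam a = b)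
    (i : Fin n) {x y z : Core (T i)} (s : TriSum x y z) :
    E.sAdd a i s = (eqToHom (congr_arg _ (coreProd_update' h i x)) ⊗ₘ
      eqToHom (congr_arg _ (coreProd_update' h i y))) ≫ E.addTri b i s ≫
      eqToHom (congr_arg _ (coreProd_update' h i z).symm) := by
  subst h
  rw [sAdd, eqToHom_map, eqToHom_map, eqToHom_map]

lemma coreProd_update₂ {i j : Fin n} (a : ∀ k, Core (T k)) (x : Core (T i)) (y : Core (T j)) :
    (coreProd T).obj (Function.update (Function.update a i x) j y) =
      ⟨Function.update (Function.update (ofFam a) i x.of) j y.of⟩ :=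
  coreProd_update' (ofFam_update a i x) j y

/-- The additivity morphism of a sum of objects in the first of two variables in `toStrict`. -/
def sFst (E : PreMultiDet T P) {i j : Fin n} (hij : i ≠ j) (a : ∀ k, Core (T k))
    {x x' x'' : Core (T i)} (s : TriSum x x' x'') (y : Core (T j)) :
    E.toFunctor.obj ((coreProd T).obj (Function.update (Function.update a i x) j y)) ⊗
      E.toFunctor.obj ((coreProd T).obj (Function.update (Function.update a i x') j y)) ⟶
      E.toFunctor.obj ((coreProd T).obj (Function.update (Function.update a i x'') j y)) :=
  E.toStrict.fst hij a s y

lemma sFst_eq (E : PreMultiDet T P) {i j : Fin n} (hij : i ≠ j) (a : ∀ k, Core (T k))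
    {x x' x'' : Core (T i)} (s : TriSum x x' x'') (y : Core (T j)) :
    E.sFst hij a s y = (eqToHom (congr_arg E.toFunctor.obj (coreProd_update₂ a x y)) ⊗ₘ
      eqToHom (congr_arg E.toFunctor.obj (coreProd_update₂ a x' y))) ≫
      E.fstTri hij (ofFam a) s y.of ≫ eqToHom (congr_arg E.toFunctor.obj (coreProd_update₂ a x'' y).symm) := by
  have e (x : Core (T i)) : E.toFunctor.map ((coreProd T).map (swap hij a x y).hom) = eqToHom (by
      rw [Function.update_comm hij]) :=
    show (coreProd T ⋙ E.toFunctor).map (eqToHom (Function.update_comm hij x y a)) = _ from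
      eqToHom_map _ _
  have e' (x : Core (T i)) : E.toFunctor.map ((coreProd T).map (swap hij a x y).inv) = eqToHom (by
      rw [Function.update_comm hij]) :=
    show (coreProd T ⋙ E.toFunctor).map (eqToHom (Function.update_comm hij x y a).symm) = _ from
      eqToHom_map _ _
  have h : E.sFst hij a s y = (E.toFunctor.map ((coreProd T).map (swap hij a x y).hom) ⊗ₘ
      E.toFunctor.map ((coreProd T).map (swap hij a x' y).hom)) ≫ E.sAdd (Function.update a j y) i s ≫
        E.toFunctor.map ((coreProd T).map (swap hij a x'' y).inv) := rfl
  rw [h, e, e, e', E.sAdd_eq (ofFam_update a j y), fstTri_eq]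
  simp only [tensorHom_comp_tensorHom_assoc, eqToHom_trans, eqToHom_trans_assoc, Category.assoc]

variable [SymmetricCategory P]

/-- In each variable the functor is isomorphic, through `coreSlot`, to the determinant data given by
`E`; the relations in one variable and naturality in the others are transported. Interchange is
`twoTriangles` conjugated by `eqToHom`s. -/
lemma IsMultiDet.toStrict (hE : E.IsMultiDet) : E.toStrict.IsStrict where
  isMod a i := (hE.isDet (ofFam a) i).isMod.of_isHom (M := E.toStrict.slot a i)
    (Functor.isoWhiskerRight (coreSlot a i) E.toFunctor) (isHom_coreSlot a i)
  natural {a b} i φ := by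
    have h : PreMod.IsHom (E.restrict (ofFam a) i).toPreMod (E.restrict (ofFam b) i).toPreMod
        (Functor.whiskerRight (slotIso i fun k h => (φ k h).iso).core.hom E.toFunctor) :=
      fun {x y z} s => hE.triangleFunction i (fun k h => (φ k h).iso) _ s.mem
    have h₁ : PreMod.IsHom (E.restrict (ofFam b) i).toPreMod (E.toStrict.slot b i)
        (Functor.isoWhiskerRight (coreSlot b i) E.toFunctor).inv :=
      PreMod.IsHom.inv (M := E.toStrict.slot b i) (N := (E.restrict (ofFam b) i).toPreMod)
        (τ := Functor.isoWhiskerRight (coreSlot b i) E.toFunctor)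
        (isHom_coreSlot b i)
    -- Morphisms in the cores are isomorphisms, so this transformation is the one in
    -- `triangleFunction`, conjugated by `coreSlot`.
    have e : Functor.whiskerRight (slotMap i φ) E.toStrict.F =
        ((Functor.isoWhiskerRight (coreSlot a i) E.toFunctor).hom ≫
        (Functor.whiskerRight (slotIso i fun k h => (φ k h).iso).core.hom E.toFunctor)) ≫
        (Functor.isoWhiskerRight (coreSlot b i) E.toFunctor).inv := by
      ext x
      have h₄ : (coreProd T).map (updHom i φ (𝟙 x)) ≫ (coreSlot b i).hom.app x =
        (coreSlot a i).hom.app x ≫ (slotIso i fun k h => (φ k h).iso).core.hom.app x :=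
        coreProd_updHom φ (𝟙 x) rfl
      have h₅ : E.toFunctor.map ((coreProd T).map (updHom i φ (𝟙 x))) =
          (E.toFunctor.map ((coreSlot a i).hom.app x) ≫
            E.toFunctor.map ((slotIso i fun k h => (φ k h).iso).core.hom.app x)) ≫
            E.toFunctor.map ((coreSlot b i).inv.app x) := by
        rw [← E.toFunctor.map_comp, ← E.toFunctor.map_comp, ← h₄]
        exact congr_arg E.toFunctor.map ((Category.assoc _ _ _).trans ((congr_arg _
          ((coreSlot b i).hom_inv_id_app x)).trans (Category.comp_id _))).symm
      exact h₅
    rw [e]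
    exact fun {x y z} s => PreMod.IsHom.comp (M := E.toStrict.slot a i) (N := (E.restrict (ofFam b) i).toPreMod)
      (K := E.toStrict.slot b i) (PreMod.IsHom.comp (M := E.toStrict.slot a i)
      (N := (E.restrict (ofFam a) i).toPreMod) (K := (E.restrict (ofFam b) i).toPreMod)
      (isHom_coreSlot a i) h) h₁ s
  inter {i j} hij a x x' x'' y y' y'' s s' := by
    have key (s : TriSum x x' x'') (s' : TriSum y y' y'') :
        (E.sFst hij a s y ⊗ₘ E.sFst hij a s y') ≫ E.sAdd (Function.update a i x'') j s' =
      tensorμ _ _ _ _ ≫ (E.sAdd (Function.update a i x) j s' ⊗ₘ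
        E.sAdd (Function.update a i x') j s') ≫ E.sFst hij a s y'' := by
      have H : (E.fstTri hij (ofFam a) s y.of ⊗ₘ E.fstTri hij (ofFam a) s y'.of) ≫
          E.addTri (Function.update (ofFam a) i x''.of) j s' =
        tensorμ _ _ _ _ ≫ (E.addTri (Function.update (ofFam a) i x.of) j s' ⊗ₘ
          E.addTri (Function.update (ofFam a) i x'.of) j s') ≫ E.fstTri hij (ofFam a) s y''.of :=
        hE.twoTriangles hij (ofFam a) _ s.mem _ s'.mem
      have hA (x : Core (T i)) := E.sAdd_eq (ofFam_update a i x) j s'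
      rw [hA, hA, hA, sFst_eq, sFst_eq, sFst_eq]
      simp only [tensorHom_comp_tensorHom_assoc, eqToHom_trans, eqToHom_trans_assoc, Category.assoc,
        eqToHom_refl, Category.comp_id]
      rw [← tensorHom_comp_tensorHom_assoc, ← tensorHom_comp_tensorHom_assoc, reassoc_of% H,
        tensorμ_natural_assoc]
    exact key s s'

end PreMultiDet

end

/-! ### Pairs of a multiexact functor and a natural transformation -/

/-- `madd` of `G.toStrict` is the additivity of `G`, so both conditions concern the same morphisms.
-/
lemma PreStrict.isHom_toStrict_iff {n : ℕ} {C : Fin n → Type u} [∀ i, Category.{v} (C i)]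
    {σ : ∀ i, SumStr (C i)} {P : Type u₁} [Category.{v₁} P] [MonoidalCategory P]
    [SymmetricCategory P] {G : PreMulti σ P} (hG : G.IsMulti) {S : PreStrict σ P} (hS : S.IsStrict)
    {τ : G.F ⟶ S.F} :
    PreStrict.IsHom G.toStrict S τ ↔ PreMulti.IsHom G S.toMulti τ := by
  have key (i : Fin n) {X Y Z : ∀ j, C j} (s : PiSum σ i X Y Z) := hG.toStrict_madd s
  refine ⟨fun h i X Y Z s => ?_, fun h => PreStrict.IsHom.of_toMulti hG.toStrict hS ?_⟩
  · exact (congr_arg (· ≫ τ.app Z) (key i s).symm).trans (h.toMulti i s)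
  · exact fun i X Y Z s => (congr_arg (· ≫ τ.app Z) (key i s)).trans (h i s)

lemma SumStr.isNat_of_eq {C : Type u} [Category.{v} C] {σ : SumStr C} {x y z x' y' z' : C}
    {s : σ.Sum x y z} {s' : σ.Sum x' y' z'} {f f₁ : x ⟶ x'} {g g₁ : y ⟶ y'} {h h₁ : z ⟶ z'}
    (H : σ.IsNat s s' f g h) (hf : f₁ = f) (hg : g₁ = g) (hh : h₁ = h) :
    σ.IsNat s s' f₁ g₁ h₁ := by
  subst hf hg hh
  exact H

lemma map_eqToHom_comp {C : Type u} [Category.{v} C] {D : Type u₁} [Category.{v₁} D] (F : C ⥤ D)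
    {X Y : C} (h : X = Y) {A A' B : D} (h₁ : F.obj Y = A) (h₂ : A = B) (h₃ : F.obj X = A')
    (h₄ : A' = B) :
    F.map (eqToHom h) ≫ eqToHom h₁ ≫ eqToHom h₂ = eqToHom h₃ ≫ eqToHom h₄ := by
  simp [eqToHom_map]

lemma eqToHom_comp_eqToHom {C : Type u} [Category.{v} C] {D : Type u₁} [Category.{v₁} D]
    (F : C ⥤ D) {X Y : C} {h : X = Y} {A : D} (h₁ : F.obj X = A) (h₂ : A = F.obj Y) :
    eqToHom h₁ ≫ eqToHom h₂ = F.map (eqToHom h) := by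
  simp [eqToHom_map]

lemma comp_map_eqToHom {C : Type u} [Category.{v} C] {D : Type u₁} [Category.{v₁} D] (F : C ⥤ D)
    {X Y : C} (h : X = Y) (h' : Y = X) {A B : D} (p : A ⟶ B) (m : B ⟶ F.obj X) :
    (p ≫ m ≫ F.map (eqToHom h)) ≫ F.map (eqToHom h') = p ≫ m := by
  simp [eqToHom_map]

section

variable {n : ℕ} {T : Fin n → Type u} [∀ i, Category.{v} (T i)] [∀ i, HasZeroObject (T i)]
  [∀ i, Preadditive (T i)] [∀ i, HasShift (T i) ℤ]
  [∀ i, ∀ k : ℤ, (shiftFunctor (T i) k).Additive] [∀ i, Pretriangulated (T i)]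
  {P : Type w} [Category.{w} P] [MonoidalCategory P] [SymmetricCategory P]
  {V : Fin n → Type w} [∀ i, Category.{w} (V i)]
  [∀ i, MonoidalCategory (V i)] [∀ i, SymmetricCategory (V i)]
  (det : ∀ i, DetFunctor (T i) (V i))

/-- The determinant functors as functors which preserve sums. -/
abbrev sumMaps (i : Fin n) : SumMap (triStr (T i)) (monStr (V i)) := (det i).sumMap

/-- The product of the determinant functors. -/
abbrev piDet : (∀ i, Core (T i)) ⥤ ∀ i, V i := Functor.pi fun i => (sumMaps det i).F

lemma piDet_update (a : ∀ i, Core (T i)) (i : Fin n) (x : Core (T i)) :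
    (piDet det).obj (Function.update a i x) =
      Function.update ((piDet det).obj a) i ((det i).toFunctor.obj x) :=
  funext fun k => Function.apply_update (fun l y => (det l).toFunctor.obj y) a i x k

variable (d : MultiexactPic V P)

/-- The composite with the product of the determinant functors. -/
abbrev precompDet : PreMulti (fun i => triStr (T i)) P := d.toStrict.toMulti.precomp (sumMaps det)

lemma precompDet_isMulti : (precompDet det d).IsMulti :=
  d.toStrict_isStrict.toMulti.precomp _

/-- The additivity morphism of `d` at the image of a sum. -/
def detAdd (a : ∀ i, Core (T i)) (i : Fin n) {x y z : Core (T i)} (s : TriSum x y z) :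
    d.toFunctor.obj (Function.update ((piDet det).obj a) i ((det i).toFunctor.obj x)) ⊗
      d.toFunctor.obj (Function.update ((piDet det).obj a) i ((det i).toFunctor.obj y)) ⟶
      d.toFunctor.obj (Function.update ((piDet det).obj a) i ((det i).toFunctor.obj z)) :=
  d.toStrict.add ((piDet det).obj a) i ((sumMaps det i).map s)

lemma prodDet_update (a : ∀ i, Core (T i)) (i : Fin n) (x : Core (T i)) :
    (prodDet det).obj ⟨Function.update (ofFam a) i x.of⟩ =
      Function.update ((piDet det).obj a) i ((det i).toFunctor.obj x) :=
  funext fun k => Function.apply_update (fun l y => (det l).obj y) (ofFam a) i x.of k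

lemma prodDet_coreProd_update (a : ∀ i, Core (T i)) (i : Fin n) (x : Core (T i)) :
    (prodDet det).obj ((coreProd T).obj (Function.update a i x)) =
      Function.update ((piDet det).obj a) i ((det i).toFunctor.obj x) :=
  (congr_arg _ (coreProd_update a i x)).trans (prodDet_update det a i x)

lemma compProdDet_addTri (a : ∀ i, Core (T i)) (i : Fin n) {x y z : Core (T i)}
    (s : TriSum x y z) :
    (compProdDet det d).addTri (ofFam a) i s =
      (d.toFunctor.map (eqToHom (prodDet_update det a i x)) ⊗ₘ
        d.toFunctor.map (eqToHom (prodDet_update det a i y))) ≫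
        detAdd det d a i s ≫ d.toFunctor.map (eqToHom (prodDet_update det a i z).symm) := by
  exact congr_arg (_ ≫ ·) (Category.assoc _ _ _).symm

/-- The additivity morphism of `compProdDet` for families of objects. -/
lemma compProdDet_sAdd (a : ∀ i, Core (T i)) (i : Fin n) {x y z : Core (T i)}
    (s : TriSum x y z) :
    (compProdDet det d).sAdd a i s =
      (d.toFunctor.map (eqToHom (prodDet_coreProd_update det a i x)) ⊗ₘ
        d.toFunctor.map (eqToHom (prodDet_coreProd_update det a i y))) ≫
        detAdd det d a i s ≫
          d.toFunctor.map (eqToHom (prodDet_coreProd_update det a i z).symm) := by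
  have h₁ : (compProdDet det d).sAdd a i s =
      (d.toFunctor.map ((prodDet det).map (eqToHom (coreProd_update a i x))) ⊗ₘ
        d.toFunctor.map ((prodDet det).map (eqToHom (coreProd_update a i y)))) ≫
      ((d.toFunctor.map (eqToHom (prodDet_update det a i x)) ⊗ₘ
        d.toFunctor.map (eqToHom (prodDet_update det a i y))) ≫
        detAdd det d a i s ≫ d.toFunctor.map (eqToHom (prodDet_update det a i z).symm)) ≫
      d.toFunctor.map ((prodDet det).map (eqToHom (coreProd_update a i z).symm)) :=
    congr_arg (fun m => _ ≫ m ≫ _) (compProdDet_addTri det d a i s)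
  rw [h₁]
  simp only [Category.assoc, tensorHom_comp_tensorHom_assoc, ← d.toFunctor.map_comp, eqToHom_map,
    eqToHom_trans]
  rfl

/-- The product of the determinants takes an updated family to an updated family up to equality, and
takes the sum to its image; `madd_comp` turns this into an equation of additivity morphisms. -/
lemma precompDet_add_comp (a : ∀ i, Core (T i)) (i : Fin n) {x y z : Core (T i)}
    (s : TriSum x y z) :
    (precompDet det d).add i (updSum a i (σ := fun i => triStr (T i)) s) ≫
      d.toFunctor.map (eqToHom (piDet_update det a i z)) =
      (d.toFunctor.map (eqToHom (piDet_update det a i x)) ⊗ₘ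
        d.toFunctor.map (eqToHom (piDet_update det a i y))) ≫ detAdd det d a i s := by
  have hc : (triStr (T i)).IsNat (updSum a i (σ := fun i => triStr (T i)) s).s s
      (eqToHom (Function.update_self i x a)) (eqToHom (Function.update_self i y a))
      (eqToHom (Function.update_self i z a)) :=
    SumStr.castSum_isNat (hx₁ := rfl) (hy₁ := rfl) (hz₁ := rfl) ((triStr (T i)).isNat_id s)
      (by simp) (by simp) (by simp)
  have hc' := (sumMaps det i).isNat hc
  refine d.toStrict_isStrict.madd_comp (σ := fun i => monStr (V i)) (B := (piDet det).obj a)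
    (x := (det i).toFunctor.obj x) (y := (det i).toFunctor.obj y) (z := (det i).toFunctor.obj z)
    ((updSum a i (σ := fun i => triStr (T i)) s).map (sumMaps det))
    ((sumMaps det i).map s) (eqToHom (piDet_update det a i x))
      (eqToHom (piDet_update det a i y)) (eqToHom (piDet_update det a i z))
      (fun k h => ?_) (fun k h => ?_) ?_
  · rw [pi_eqToHom_apply, pi_eqToHom_apply]
    exact map_eqToHom_comp (det k).toFunctor
      ((Function.update_of_ne h x a).trans (Function.update_of_ne h z a).symm) _ _ _ _
  · rw [pi_eqToHom_apply, pi_eqToHom_apply]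
    exact map_eqToHom_comp (det k).toFunctor
      ((Function.update_of_ne h y a).trans (Function.update_of_ne h z a).symm) _ _ _ _
  · rw [pi_eqToHom_apply, pi_eqToHom_apply, pi_eqToHom_apply]
    have e (x : Core (T i)) := eqToHom_comp_eqToHom (det i).toFunctor
      (X := Function.update a i x i) (Y := x) (h := Function.update_self i x a) (congr_fun (piDet_update det a i x) i)
      (Function.update_self i ((det i).toFunctor.obj x) ((piDet det).obj a))
    exact SumStr.isNat_of_eq hc' (e x) (e y) (e z)

/-- The additivity of `d ∘ det` as in the definition of a pair is the one obtained by restricting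
`d` along functors that preserve sums: both are `detAdd` up to equalities of families. -/
lemma compProdDet_sAdd_eq (a : ∀ i, Core (T i)) (i : Fin n) {x y z : Core (T i)}
    (s : TriSum x y z) :
    (compProdDet det d).sAdd a i s =
      (precompDet det d).add i (updSum a i (σ := fun i => triStr (T i)) s) := by
  refine (cancel_mono (d.toFunctor.map (eqToHom (piDet_update det a i z)))).1
    (Eq.trans ?_ (precompDet_add_comp det d a i s).symm)
  rw [compProdDet_sAdd]
  exact comp_map_eqToHom d.toFunctor _ _ _ _

/-- Translates the condition on a pair into the language in which the extension theorems are stated.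
-/
lemma isHom_compProdDet_iff {E : PreMultiDet T P} (hE : E.IsMultiDet)
    (δ : prodDet det ⋙ d.toFunctor ⟶ E.toFunctor) :
    PreMultiDet.IsHom (E := compProdDet det d) (E' := E) δ ↔
      PreMulti.IsHom (precompDet det d) E.toStrict.toMulti (Functor.whiskerLeft (coreProd T) δ) := by
  refine PreMultiDet.isHom_toStrict_iff.symm.trans (Iff.trans ?_
    (PreStrict.isHom_toStrict_iff (precompDet_isMulti det d) hE.toStrict))
  refine forall_congr' fun a => forall_congr' fun i => forall_congr' fun x => forall_congr' fun y =>
    forall_congr' fun z => forall_congr' fun s => ?_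
  have e := compProdDet_sAdd_eq det d a i s
  exact ⟨fun h => (congr_arg (· ≫ δ.app _) e.symm).trans h,
    fun h => (congr_arg (· ≫ δ.app _) e).trans h⟩

end

lemma MultiexactPic.isMonoidal_iff_toMulti {n : ℕ} {V : Fin n → Type w} [∀ i, Category.{w} (V i)]
    [∀ i, MonoidalCategory (V i)] [∀ i, SymmetricCategory (V i)]
    {P : Type w} [Category.{w} P] [MonoidalCategory P] [SymmetricCategory P] [PicardGroupoid P]
    {d d' : MultiexactPic V P} (β : d.toFunctor ⟶ d'.toFunctor) :
    MultiexactPic.IsMonoidal (F := d) (G := d') β ↔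
      PreMulti.IsHom d.toStrict.toMulti d'.toStrict.toMulti β :=
  (MultiexactPic.isMonoidal_iff β).trans ⟨fun h => h.toMulti, fun h =>
    PreStrict.IsHom.of_toMulti d.toStrict_isStrict d'.toStrict_isStrict h⟩

/-! ### Existence and comparison of pairs over a multi-determinant functor. -/

section

variable {n : ℕ} {T : Fin n → Type u} [∀ i, Category.{v} (T i)] [∀ i, HasZeroObject (T i)]
  [∀ i, Preadditive (T i)] [∀ i, HasShift (T i) ℤ]
  [∀ i, ∀ k : ℤ, (shiftFunctor (T i) k).Additive] [∀ i, Pretriangulated (T i)]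
  {P : Type w} [Category.{w} P] [MonoidalCategory P] [SymmetricCategory P] [PicardGroupoid P]
  {V : Fin n → Type w} [∀ i, Category.{w} (V i)]
  [∀ i, MonoidalCategory (V i)] [∀ i, SymmetricCategory (V i)]
  {det : ∀ i, DetFunctor (T i) (V i)}
  {E : PreMultiDet T P}

lemma ofStrict_toMulti_add {G : PreMulti (fun i => monStr (V i)) P} (hG : G.IsMulti) (i : Fin n)
    {X Y Z : ∀ i, V i} (s : PiSum (fun i => monStr (V i)) i X Y Z) :
    (MultiexactPic.ofStrict hG.toStrict).toStrict.toMulti.add i s = G.add i s := by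
  have e := MultiexactPic.ofStrict_toStrict_add hG.toStrict Z i s.s
  have e' : (MultiexactPic.ofStrict hG.toStrict).toStrict.madd i s = G.toStrict.madd i s :=
    congr_arg (_ ≫ · ≫ _) e
  exact e'.trans (hG.toStrict_madd s)

/-- A multi-determinant functor factors through the universal determinant functors. -/
theorem nonempty_inducedPair (hdet : ∀ i, (det i).IsUniversal) (hE : E.IsMultiDet) :
    Nonempty (InducedPair det E) := by
  obtain ⟨G, hG, τ, hτ⟩ := PreMulti.exists_extension n (fun i => (hdet i).sumMap)
    hE.toStrict.toMulti
  -- An object of the core of the product is the same as a family in the cores, so `τ` supplies the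
  -- components on the core of the product.
  let trans : prodDet det ⋙ (MultiexactPic.ofStrict hG.toStrict).toFunctor ⟶ E.toFunctor :=
    { app := fun X => τ.app fun i => ⟨X.of i⟩
      naturality := fun X Y f => by
        let f' : (fun i => ⟨X.of i⟩ : ∀ i, Core (T i)) ⟶ fun i => ⟨Y.of i⟩ :=
          fun i => ((Pi.eval T i).core.map f)
        have e : (coreProd T).map f' = f := coreHom_ext rfl
        exact (τ.naturality f').trans (congr_arg (_ ≫ E.toFunctor.map ·) e) }
  refine ⟨⟨MultiexactPic.ofStrict hG.toStrict, trans, (isHom_compProdDet_iff det _ hE _).2 ?_⟩⟩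
  intro i X Y Z s
  exact (congr_arg (· ≫ τ.app Z) (ofStrict_toMulti_add hG i (s.map (sumMaps det)))).trans (hτ i s)

/-- There is a unique monoidal comparison between any two pairs. -/
theorem existsUnique_inducedPair_hom (hdet : ∀ i, (det i).IsUniversal) (hE : E.IsMultiDet)
    (c c' : InducedPair det E) : ∃! γ : c.functor.toFunctor ⟶ c'.functor.toFunctor,
      MultiexactPic.IsMonoidal (F := c.functor) (G := c'.functor) γ ∧
        Functor.whiskerLeft (prodDet det) γ ≫ c'.trans = c.trans := by
  have h := (isHom_compProdDet_iff det c.functor hE c.trans).1 c.isHom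
  have h' := (isHom_compProdDet_iff det c'.functor hE c'.trans).1 c'.isHom
  have : ∀ X, IsIso (c'.trans.app X) := fun X => inferInstance
  -- `P` is a groupoid, so a comparison must restrict to `c.trans` followed by the inverse of
  -- `c'.trans`. Extending this transformation gives existence.
  have : IsIso c'.trans := NatIso.isIso_of_isIso_app _
  have h'' : PreMulti.IsHom (precompDet det c'.functor) E.toStrict.toMulti
    (Functor.isoWhiskerLeft (coreProd T) (asIso c'.trans)).hom := h'
  obtain ⟨γ, hγ, hγ'⟩ := PreMulti.exists_hom_extension n (fun i => (hdet i).sumMap)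
    c.functor.toStrict_isStrict.toMulti c'.functor.toStrict_isStrict.toMulti (h.comp h''.inv)
  have hc' (X) : γ.app ((prodDet det).obj X) ≫ c'.trans.app X = c.trans.app X := by
    have e : γ.app ((prodDet det).obj X) = c.trans.app X ≫ (inv c'.trans).app X :=
      hγ' fun i => ⟨X.of i⟩
    have e' : (c.trans.app X ≫ (inv c'.trans).app X) ≫ c'.trans.app X = c.trans.app X := by
      rw [Category.assoc, ← NatTrans.comp_app, IsIso.inv_hom_id]
      exact Category.comp_id _
    exact (congr_arg (· ≫ c'.trans.app X) e).trans e'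
  refine ⟨γ, ⟨(MultiexactPic.isMonoidal_iff_toMulti _).2 hγ, NatTrans.ext (funext hc')⟩, ?_⟩
  rintro γ₂ ⟨hγ₂, hγ₂'⟩
  -- Two comparisons agree on the image of the determinants, since `c'.trans` can be cancelled.
  refine PreMulti.hom_ext_of_isUniversal n (fun i => (hdet i).sumMap)
    c.functor.toStrict_isStrict.toMulti c'.functor.toStrict_isStrict.toMulti
    ((MultiexactPic.isMonoidal_iff_toMulti _).1 hγ₂) hγ fun X => ?_
  have h₁ : γ₂.app ((prodDet det).obj ((coreProd T).obj X)) ≫ c'.trans.app _ = c.trans.app _ :=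
    NatTrans.congr_app hγ₂' ((coreProd T).obj X)
  exact (cancel_mono (c'.trans.app ((coreProd T).obj X))).1 (h₁.trans (hc' _).symm)

end

/-! ### Rotation of triangles and determinant functors -/

section Rotation

variable {T : Type u} [Category.{v} T] [HasZeroObject T] [Preadditive T] [HasShift T ℤ]
  [∀ k : ℤ, (shiftFunctor T k).Additive] [Pretriangulated T]

/-- Its rotation is a split triangle, the sign being harmless on the zero morphism. -/
lemma zero_inl_snd_distinguished (x z : T) :
    Triangle.mk (0 : x ⟶ z) (biprod.inl : z ⟶ z ⊞ x⟦(1 : ℤ)⟧) biprod.snd ∈ distTriang T := by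
  rw [rotate_distinguished_triangle]
  refine isomorphic_distinguished _ (binaryBiproductTriangle_distinguished z (x⟦(1 : ℤ)⟧)) _
    (Triangle.isoMk _ _ (Iso.refl _) (Iso.refl _) (Iso.refl _) ?_ ?_ ?_)
  · exact (Category.comp_id _).trans (Category.id_comp _).symm
  · exact (Category.comp_id _).trans (Category.id_comp _).symm
  · change (-(shiftFunctor T (1 : ℤ)).map (0 : x ⟶ z)) ≫ (shiftFunctor T (1 : ℤ)).map (𝟙 _) =
      𝟙 _ ≫ 0
    simp

/-- The automorphism of `z ⊞ w` given by a morphism `z ⟶ w`. -/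
@[simps]
def shear {z w : T} (h : z ⟶ w) : z ⊞ w ≅ z ⊞ w where
  hom := 𝟙 _ + biprod.fst ≫ h ≫ biprod.inr
  inv := 𝟙 _ - biprod.fst ≫ h ≫ biprod.inr
  hom_inv_id := by simp [Preadditive.comp_sub, Preadditive.add_comp]
  inv_hom_id := by simp [Preadditive.comp_add, Preadditive.sub_comp]

/-- The isomorphism from `binaryBiproductTriangle` to a sheared triangle, on the biproducts. -/
@[simps]
def liftDescIso {z w : T} (h : z ⟶ w) : z ⊞ w ≅ z ⊞ w where
  hom := biprod.desc (biprod.lift (𝟙 z) h) (biprod.lift 0 (-𝟙 w))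
  inv := biprod.desc (biprod.lift (𝟙 z) h) (biprod.lift 0 (-𝟙 w))

/-- The involution `liftDescIso h` of `z ⊞ w` carries this triangle to the standard split one. -/
lemma lift_desc_distinguished {z w : T} (h : z ⟶ w) :
    Triangle.mk (biprod.lift (𝟙 z) h) (biprod.desc h (-𝟙 w)) (0 : w ⟶ z⟦(1 : ℤ)⟧) ∈
      distTriang T := by
  have c₁ : biprod.lift (𝟙 z) h ≫ (liftDescIso h).hom = 𝟙 z ≫ biprod.inl := by
    ext <;> simp [biprod.lift_eq]
  have c₂ : biprod.desc h (-𝟙 w) ≫ 𝟙 w = (liftDescIso h).hom ≫ biprod.snd := by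
    ext <;> simp
  have c₃ : (0 : w ⟶ z⟦(1 : ℤ)⟧) ≫ (shiftFunctor T (1 : ℤ)).map (𝟙 z) = 𝟙 w ≫ 0 := by simp
  exact isomorphic_distinguished _ (binaryBiproductTriangle_distinguished z w) _
    (Triangle.isoMk _ _ (Iso.refl _) (liftDescIso h) (Iso.refl _) c₁ c₂ c₃)

lemma neg_map_comp_map {x y z : T} {f : x ⟶ y} {g : y ⟶ z} {h : z ⟶ x⟦(1 : ℤ)⟧}
    (mem : Triangle.mk f g h ∈ distTriang T) : (-(f⟦(1 : ℤ)⟧')) ≫ g⟦(1 : ℤ)⟧' = 0 := by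
  have : f ≫ g = 0 := comp_distTriang_mor_zero₁₂ _ mem
  rw [Preadditive.neg_comp, ← Functor.map_comp, this, Functor.map_zero, neg_zero]

/-- The third morphism is zero, but is kept in the form prescribed for the new triangle of an
octahedron. -/
lemma lift_desc_distinguished' {x y z : T} {f : x ⟶ y} {g : y ⟶ z} {h : z ⟶ x⟦(1 : ℤ)⟧}
    (mem : Triangle.mk f g h ∈ distTriang T) :
    Triangle.mk (biprod.lift (𝟙 z) h) (biprod.desc h (-𝟙 _))
      ((-(f⟦(1 : ℤ)⟧')) ≫ g⟦(1 : ℤ)⟧') ∈ distTriang T := by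
  rw [neg_map_comp_map mem]
  exact lift_desc_distinguished h

lemma comp_lift_of_comp_eq_zero {y z w : T} {g : y ⟶ z} {h : z ⟶ w} (e : g ≫ h = 0) :
    g ≫ biprod.lift (𝟙 z) h = g ≫ biprod.inl := by
  ext <;> simp [e]

lemma snd_comp_of_comp_eq_zero {z w v : T} {h : z ⟶ w} {k : w ⟶ v} (e : h ≫ k = 0) :
    biprod.snd ≫ k = biprod.desc h (-𝟙 _) ≫ (-k) := by
  ext <;> simp [e]

lemma comp_eq_zero₁₂ {x y z : T} {f : x ⟶ y} {g : y ⟶ z} {h : z ⟶ x⟦(1 : ℤ)⟧}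
    (mem : Triangle.mk f g h ∈ distTriang T) : f ≫ g = 0 :=
  comp_distTriang_mor_zero₁₂ _ mem

/-- The octahedron on the composite of two morphisms of a distinguished triangle. -/
def compOctahedron {x y z : T} {f : x ⟶ y} {g : y ⟶ z} {h : z ⟶ x⟦(1 : ℤ)⟧}
    (mem : Triangle.mk f g h ∈ distTriang T)
    (mem' : Triangle.mk g h (-f⟦(1 : ℤ)⟧') ∈ distTriang T) :
    Octahedron (comp_eq_zero₁₂ mem) mem mem' (zero_inl_snd_distinguished x z) where
  m₁ := biprod.lift (𝟙 z) h
  m₃ := biprod.desc h (-𝟙 _)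
  comm₁ := comp_lift_of_comp_eq_zero (comp_distTriang_mor_zero₂₃ _ mem)
  comm₂ := biprod.lift_snd _ _
  comm₃ := biprod.inl_desc _ _
  comm₄ := snd_comp_of_comp_eq_zero (comp_distTriang_mor_zero₃₁ _ mem)
  mem := lift_desc_distinguished' mem

variable {P : Type w} [Category.{w} P] [MonoidalCategory P] [SymmetricCategory P]
  [PicardGroupoid P] {D : PreDet T P}

/-- The shear is an automorphism of the split triangle `w ⟶ z ⊞ w ⟶ z` that is the identity on the
outer objects. By naturality it acts trivially on the determinant of the middle. -/
lemma PreDet.IsDet.map_shear (hD : D.IsDet) {z w : T} (h : z ⟶ w) : D.map (shear h) = 𝟙 _ := by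
  have e := hD.natural_mk (biproductTriangle'_distinguished z w)
    (biproductTriangle'_distinguished z w) (Iso.refl _) (shear h) (Iso.refl _) (by simp) (by simp)
    (by simp)
  rw [D.map_refl, D.map_refl, id_tensorHom_id] at e
  exact (cancel_epi (D.add _ (biproductTriangle'_distinguished z w))).1
    (e.trans ((Category.id_comp _).trans (Category.comp_id _).symm))

/-- The shear by `h` carries the triangle for `0` to the triangle for `h`, and it acts trivially. -/
lemma PreDet.IsDet.add_lift_desc (hD : D.IsDet) {z w : T} (h : z ⟶ w) :
    D.add _ (lift_desc_distinguished h) = D.add _ (lift_desc_distinguished (0 : z ⟶ w)) := by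
  have e := hD.natural_mk (lift_desc_distinguished (0 : z ⟶ w)) (lift_desc_distinguished h)
    (Iso.refl _) (shear h) (Iso.refl _) (by ext <;> simp) (by ext <;> simp) (by simp)
  rw [D.map_refl, D.map_refl, id_tensorHom_id] at e
  have e' : D.add _ (lift_desc_distinguished (0 : z ⟶ w)) ≫ D.map (shear h) =
    D.add _ (lift_desc_distinguished (0 : z ⟶ w)) ≫ 𝟙 _ := congr_arg (_ ≫ ·) (hD.map_shear h)
  exact ((Category.comp_id _).symm.trans (e'.symm.trans (e.trans (Category.id_comp _)))).symm

omit [SymmetricCategory P] [PicardGroupoid P] in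
lemma PreDet.add_congr (D : PreDet T P) {x y z : T} {f f' : x ⟶ y} {g g' : y ⟶ z}
    {h h' : z ⟶ x⟦(1 : ℤ)⟧} (hf : f = f') (hg : g = g') (hh : h = h')
    (mem : Triangle.mk f g h ∈ distTriang T) (mem' : Triangle.mk f' g' h' ∈ distTriang T) :
    D.add _ mem = D.add _ mem' := by
  subst hf hg hh
  rfl

/-- The additivity morphism of a triangle `x ⟶ y ⟶ z ⟶ Σ x`. -/
abbrev PreDet.addMk (D : PreDet T P) {x y z : T} {f : x ⟶ y} {g : y ⟶ z} {h : z ⟶ x⟦(1 : ℤ)⟧}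
    (mem : Triangle.mk f g h ∈ distTriang T) : D.obj z ⊗ D.obj x ⟶ D.obj y :=
  D.add _ mem

/-- The composite of the additivity morphisms of a triangle and its rotation only depends on the
first and the third object of the triangle. -/
lemma PreDet.IsDet.add_rotate (hD : D.IsDet) {x y z y₂ : T} {f : x ⟶ y} {g : y ⟶ z}
    {h : z ⟶ x⟦(1 : ℤ)⟧} (mem : Triangle.mk f g h ∈ distTriang T)
    (mem' : Triangle.mk g h (-f⟦(1 : ℤ)⟧') ∈ distTriang T) {f₂ : x ⟶ y₂} {g₂ : y₂ ⟶ z}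
    {h₂ : z ⟶ x⟦(1 : ℤ)⟧} (mem₂ : Triangle.mk f₂ g₂ h₂ ∈ distTriang T)
    (mem₂' : Triangle.mk g₂ h₂ (-f₂⟦(1 : ℤ)⟧') ∈ distTriang T) :
    D.obj (x⟦(1 : ℤ)⟧) ◁ D.addMk mem ≫ D.addMk mem' =
      D.obj (x⟦(1 : ℤ)⟧) ◁ D.addMk mem₂ ≫ D.addMk mem₂' := by
  have h₁ := hD.octahedron (compOctahedron mem mem')
  have h₂ := hD.octahedron (compOctahedron mem₂ mem₂')
  have e {y : T} {f : x ⟶ y} {g : y ⟶ z} {h : z ⟶ x⟦(1 : ℤ)⟧}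
      (mem : Triangle.mk f g h ∈ distTriang T) : D.add _ (lift_desc_distinguished' mem) =
      D.add _ (lift_desc_distinguished (0 : z ⟶ x⟦(1 : ℤ)⟧)) :=
    (D.add_congr rfl rfl (neg_map_comp_map mem) _ _).trans (hD.add_lift_desc h)
  -- By the octahedron on `f ≫ g = 0`, each side equals an expression involving the triangle on `0 :
  -- x ⟶ z` and the new triangle `z ⟶ z ⊞ Σx ⟶ Σx`. The first depends only on `x` and `z`; so does
  -- the additivity of the second, by `add_lift_desc`.
  refine (cancel_epi (α_ _ _ _).hom).1 ?_
  refine h₁.symm.trans (Eq.trans ?_ h₂)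
  exact congr_arg (· ▷ _ ≫ _) ((e mem).trans (e mem₂).symm)

end Rotation

/-! ### Diagrams in a Picard groupoid -/

section Picard

variable {P : Type w} [Category.{w} P] [MonoidalCategory P]

/-- Rebracketing of an octahedron relation `h` after a further summand `c` has been inserted below
it. -/
lemma whiskerLeft_comp_whiskerRight {S s x y z A Z : P} {ω : S ⊗ Z ⟶ z} {ρ : z ⊗ x ⟶ y}
    {φ : Z ⊗ x ⟶ A} {θ : S ⊗ A ⟶ y} (h : ω ▷ x ≫ ρ = (α_ S Z x).hom ≫ S ◁ φ ≫ θ)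
    (c : z ⊗ s ⟶ Z) :
    (S ◁ c ≫ ω) ▷ x ≫ ρ = (α_ _ _ _).hom ≫ S ◁ (c ▷ x ≫ φ) ≫ θ := by
  simp [h]

variable [SymmetricCategory P]

/-- The symmetry of the last two of three summands. -/
def permute (z s x : P) : (z ⊗ s) ⊗ x ⟶ (z ⊗ x) ⊗ s :=
  (β_ z s).hom ▷ x ≫ (α_ s z x).hom ≫ (β_ s (z ⊗ x)).hom

/-- `tensorμ` exchanges the middle summands `x` and `s`, and `permute` exchanges them back. -/
lemma tensorμ_permute {z x s x' : P} :
    tensorμ z x s x' ≫ (α_ (z ⊗ s) x x').inv ≫ permute z s x ▷ x' = (α_ (z ⊗ x) s x').inv := by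
  have h : z ◁ (β_ x s).hom ▷ x' ≫ z ◁ (β_ s x).hom ▷ x' = 𝟙 _ := by
    rw [← MonoidalCategory.whiskerLeft_comp, ← comp_whiskerRight]
    simp
  have h' : (β_ z s).hom ▷ x ▷ x' ≫ (β_ s z).hom ▷ x ▷ x' = 𝟙 _ := by
    rw [← comp_whiskerRight, ← comp_whiskerRight]
    simp
  simp only [permute, BraidedCategory.braiding_tensor_right_hom, tensorμ]
  simp [reassoc_of% h, reassoc_of% h']

variable [PicardGroupoid P]

lemma tensorLeft_map_injective (S : P) {A B : P} {f g : A ⟶ B} (h : S ◁ f = S ◁ g) : f = g := by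
  have := PicardGroupoid.isEquivalence_tensorLeft S
  exact (tensorLeft S).map_injective h

/-- Comparison of two octahedra with the same composite `ρ`. After adding `S`, the two sides for `A`
are determined by `ρ` and by the composites in `hc` and `hψ`, which agree with those of the model
`A'`. The known identity `hσ` of the model therefore carries over, and `S` cancels. -/
lemma permute_cancel {S s x y z A Z A' Z' : P} {ω : S ⊗ Z ⟶ z} {ρ : z ⊗ x ⟶ y}
    {φ : Z ⊗ x ⟶ A} {θ : S ⊗ A ⟶ y} (h : ω ▷ x ≫ ρ = (α_ S Z x).hom ≫ S ◁ φ ≫ θ)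
    {ω' : S ⊗ Z' ⟶ z} {φ' : Z' ⊗ x ⟶ A'} {θ' : S ⊗ A' ⟶ y}
    (h' : ω' ▷ x ≫ ρ = (α_ S Z' x).hom ≫ S ◁ φ' ≫ θ') {c : z ⊗ s ⟶ Z} {c' : z ⊗ s ⟶ Z'}
    (hc : S ◁ c ≫ ω = S ◁ c' ≫ ω') {ψ : y ⊗ s ⟶ A} {ψ' : y ⊗ s ⟶ A'}
    (hψ : S ◁ ψ ≫ θ = S ◁ ψ' ≫ θ') {σ : (z ⊗ s) ⊗ x ⟶ (z ⊗ x) ⊗ s}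
    (hσ : c' ▷ x ≫ φ' = σ ≫ ρ ▷ s ≫ ψ') : c ▷ x ≫ φ = σ ≫ ρ ▷ s ≫ ψ := by
  apply tensorLeft_map_injective S
  rw [← cancel_mono θ, ← cancel_epi (α_ S (z ⊗ s) x).hom, ← whiskerLeft_comp_whiskerRight h, hc,
    whiskerLeft_comp_whiskerRight h', hσ]
  simp [hψ]

-- The relations `h₁` and `h₂` factor both ways of forming `y` through `δ : A ⊗ x' ⟶ y`. The summand
-- `x'` is then a spectator, and only the identity `h` of morphisms to `A` is needed.
omit [PicardGroupoid P] in
lemma tensorμ_of_permute {x' y' z' x y z x'' y'' z'' A : P} {ρ' : z' ⊗ x' ⟶ y'} {ρ : z ⊗ x ⟶ y}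
    {ρ'' : z'' ⊗ x'' ⟶ y''} {p : x'' ⊗ x' ⟶ x} {q : y'' ⊗ y' ⟶ y} {r : z'' ⊗ z' ⟶ z}
    {φ : z ⊗ x'' ⟶ A} {ψ : y'' ⊗ z' ⟶ A} {δ : A ⊗ x' ⟶ y}
    (h₁ : φ ▷ x' ≫ δ = (α_ _ _ _).hom ≫ z ◁ p ≫ ρ)
    (h₂ : ψ ▷ x' ≫ δ = (α_ _ _ _).hom ≫ y'' ◁ ρ' ≫ q)
    (h : r ▷ x'' ≫ φ = permute z'' z' x'' ≫ ρ'' ▷ z' ≫ ψ) :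
    (ρ'' ⊗ₘ ρ') ≫ q = tensorμ z'' x'' z' x' ≫ (r ⊗ₘ p) ≫ ρ := by
  have e₁ : (ρ'' ⊗ₘ ρ') ≫ q = (α_ _ _ _).inv ≫ (ρ'' ▷ z' ≫ ψ) ▷ x' ≫ δ := by
    simp [h₂, MonoidalCategory.tensorHom_def]
  have e₂ : (r ⊗ₘ p) ≫ ρ = (α_ _ _ _).inv ≫ (r ▷ x'' ≫ φ) ▷ x' ≫ δ := by
    simp [h₁, MonoidalCategory.tensorHom_def]
  rw [e₁, e₂, h, comp_whiskerRight (permute _ _ _), Category.assoc,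
    reassoc_of% (tensorμ_permute (z := z'') (x := x'') (s := z') (x' := x'))]

end Picard

/-! ### Determinant functors and Verdier structures -/

section Verdier

variable {T : Type u} [Category.{v} T] [HasZeroObject T] [Preadditive T] [HasShift T ℤ]
  [∀ k : ℤ, (shiftFunctor T k).Additive] [Pretriangulated T]

lemma rotate_mk {x y z : T} {f : x ⟶ y} {g : y ⟶ z} {h : z ⟶ x⟦(1 : ℤ)⟧}
    (mem : Triangle.mk f g h ∈ distTriang T) : Triangle.mk g h (-f⟦(1 : ℤ)⟧') ∈ distTriang T :=
  rot_of_distTriang _ mem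

/-- The sum of a distinguished triangle and `0 ⟶ s ⟶ s`. -/
lemma sum_distinguished [IsTriangulated T] {x y z : T} (s : T) {f : x ⟶ y} {g : y ⟶ z}
    {h : z ⟶ x⟦(1 : ℤ)⟧} (mem : Triangle.mk f g h ∈ distTriang T) :
    Triangle.mk (f ≫ (biprod.inl : y ⟶ y ⊞ s)) (biprod.map g (𝟙 s)) (biprod.fst ≫ h) ∈
      distTriang T := by
  -- `Z` is a cone of `x ⟶ y ⟶ y ⊞ s`. The octahedron places it in a triangle `z ⟶ Z ⟶ s` with zero
  -- connecting morphism.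
  obtain ⟨Z, η, k, hk⟩ := distinguished_cocone_triangle (f ≫ (biprod.inl : y ⟶ y ⊞ s))
  let O := someOctahedron rfl mem (binaryBiproductTriangle_distinguished y s) hk
  have c₁ : g ≫ O.m₁ = biprod.inl ≫ η := O.comm₁
  have c₂ : O.m₁ ≫ k = h := O.comm₂
  have c₃ : η ≫ O.m₃ = biprod.snd := O.comm₃
  have c₄ : η ≫ k = 0 := comp_distTriang_mor_zero₂₃ _ hk
  have hO : Triangle.mk O.m₁ O.m₃ (0 : s ⟶ z⟦(1 : ℤ)⟧) ∈ distTriang T := by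
    have h₀ : (0 : s ⟶ y⟦(1 : ℤ)⟧) ≫ (shiftFunctor T (1 : ℤ)).map g = 0 := zero_comp
    have := O.mem
    rw [← h₀]
    exact this
  let e : z ⊞ s ⟶ Z := biprod.desc O.m₁ (biprod.inr ≫ η)
  let m : binaryBiproductTriangle z s ⟶ Triangle.mk O.m₁ O.m₃ (0 : s ⟶ z⟦(1 : ℤ)⟧) :=
    Triangle.homMk _ _ (𝟙 z) e (𝟙 s)
      (show biprod.inl ≫ e = 𝟙 z ≫ O.m₁ by simp [e])
      (show biprod.snd ≫ 𝟙 s = e ≫ O.m₃ by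
        have : O.m₁ ≫ O.m₃ = 0 := comp_distTriang_mor_zero₁₂ _ hO
        ext <;> simp [e, c₃, this])
      (show (0 : s ⟶ z⟦(1 : ℤ)⟧) ≫ (shiftFunctor T (1 : ℤ)).map (𝟙 z) = 𝟙 s ≫ 0 by simp)
  -- Comparison with the split triangle on `z` and `s`: the outer components are identities, so `e`
  -- identifies `Z` with `z ⊞ s`.
  have he : IsIso e := isIso₂_of_isIso₁₃ m (binaryBiproductTriangle_distinguished z s) hO
    (inferInstanceAs (IsIso (𝟙 z))) (inferInstanceAs (IsIso (𝟙 s)))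
  let e' : z ⊞ s ≅ Z := asIso e
  exact isomorphic_distinguished _ hk _ (Triangle.isoMk _ _ (Iso.refl _) (Iso.refl _) e'
    (show (f ≫ biprod.inl) ≫ 𝟙 (y ⊞ s) = 𝟙 x ≫ f ≫ biprod.inl by simp)
    (show biprod.map g (𝟙 s) ≫ e = 𝟙 _ ≫ η by ext <;> simp [e, c₁])
    (show (biprod.fst ≫ h) ≫ (shiftFunctor T (1 : ℤ)).map (𝟙 x) = e ≫ k by
      ext <;> simp [e, c₂, c₄]))

lemma fst_comp_of_comp_eq_zero {x y z s : T} {h : z ⟶ x} {k : x ⟶ y} (e : h ≫ k = 0) :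
    (biprod.fst ≫ h) ≫ k = (biprod.snd : z ⊞ s ⟶ s) ≫ (0 : s ⟶ y) := by
  simp [e]

/-- The octahedron on `x ⟶ y ⟶ y ⊞ s`. -/
def inlOctahedron [IsTriangulated T] {x y z : T} (s : T) {f : x ⟶ y} {g : y ⟶ z}
    {h : z ⟶ x⟦(1 : ℤ)⟧} (mem : Triangle.mk f g h ∈ distTriang T) :
    Octahedron (rfl : f ≫ (biprod.inl : y ⟶ y ⊞ s) = _) mem
      (binaryBiproductTriangle_distinguished y s) (sum_distinguished s mem) where
  m₁ := (biprod.inl : z ⟶ z ⊞ s)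
  m₃ := biprod.snd
  comm₁ := (biprod.inl_map _ _).symm
  comm₂ := biprod.inl_fst_assoc _
  comm₃ := (biprod.map_snd _ _).trans (Category.comp_id _)
  comm₄ := fst_comp_of_comp_eq_zero (comp_distTriang_mor_zero₃₁ _ mem)
  mem := by
    have h₀ : (0 : s ⟶ y⟦(1 : ℤ)⟧) ≫ (shiftFunctor T (1 : ℤ)).map g = 0 := zero_comp
    have := binaryBiproductTriangle_distinguished z s
    rw [binaryBiproductTriangle, ← h₀] at this
    exact this

lemma fstOctahedron_comm {x y s : T} (f : x ⟶ y) :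
    (f ≫ (biprod.inl : y ⟶ y ⊞ s)) ≫ biprod.fst = f := by simp

/-- The octahedron on `x ⟶ y ⊞ s ⟶ y`. -/
def fstOctahedron [IsTriangulated T] {x y z : T} (s : T) {f : x ⟶ y} {g : y ⟶ z}
    {h : z ⟶ x⟦(1 : ℤ)⟧} (mem : Triangle.mk f g h ∈ distTriang T) :
    Octahedron (fstOctahedron_comm (s := s) f) (sum_distinguished s mem)
      (rotate_mk (biproductTriangle'_distinguished y s)) mem where
  m₁ := (biprod.fst : z ⊞ s ⟶ z)
  m₃ := 0
  comm₁ := biprod.map_fst _ _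
  comm₂ := rfl
  comm₃ := comp_zero
  comm₄ := by
    have : h ≫ (f ≫ (biprod.inl : y ⟶ y ⊞ s))⟦(1 : ℤ)⟧' = 0 := by
      have e : h ≫ f⟦(1 : ℤ)⟧' = 0 := comp_distTriang_mor_zero₃₁ _ mem
      rw [Functor.map_comp, reassoc_of% e, zero_comp]
    exact this.trans zero_comp.symm
  mem := by
    have h₀ : (-(biprod.inr : s ⟶ y ⊞ s)⟦(1 : ℤ)⟧') ≫
        (shiftFunctor T (1 : ℤ)).map (biprod.map g (𝟙 s)) = -(biprod.inr : s ⟶ z ⊞ s)⟦(1 : ℤ)⟧' := by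
      rw [Preadditive.neg_comp, ← Functor.map_comp]
      simp
    have := rotate_mk (biproductTriangle'_distinguished z s)
    rw [← h₀] at this
    exact this

variable {P : Type w} [Category.{w} P] [MonoidalCategory P] [SymmetricCategory P]
  [PicardGroupoid P] {D : PreDet T P}

-- The octahedron on `x ⟶ y ⟶ y ⊞ s` gives the relation with the other split triangles, those
-- starting from `z` and `y`. Commutativity turns these into the ones starting from `s`, at the
-- price of the braidings collected in `permute`.
omit [PicardGroupoid P] in
lemma PreDet.IsDet.add_sum [IsTriangulated T] (hD : D.IsDet) {x y z : T} (s : T) {f : x ⟶ y}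
    {g : y ⟶ z} {h : z ⟶ x⟦(1 : ℤ)⟧} (mem : Triangle.mk f g h ∈ distTriang T) :
    D.addMk (biproductTriangle'_distinguished z s) ▷ D.obj x ≫ D.addMk (sum_distinguished s mem) =
      permute (D.obj z) (D.obj s) (D.obj x) ≫ D.addMk mem ▷ D.obj s ≫
        D.addMk (biproductTriangle'_distinguished y s) := by
  have h₁ : D.addMk (binaryBiproductTriangle_distinguished z s) ▷ D.obj x ≫
      D.addMk (sum_distinguished s mem) = (α_ _ _ _).hom ≫ D.obj s ◁ D.addMk mem ≫
        D.addMk (binaryBiproductTriangle_distinguished y s) := by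
    refine Eq.trans ?_ (hD.octahedron (inlOctahedron s mem))
    exact congr_arg (· ▷ _ ≫ _) (D.add_congr rfl rfl zero_comp.symm _ _)
  have h₂ (z : T) : D.addMk (biproductTriangle'_distinguished z s) = (β_ (D.obj z) (D.obj s)).hom ≫
      D.addMk (binaryBiproductTriangle_distinguished z s) := hD.commutativity z s
  rw [h₂, h₂, permute]
  simp only [Category.assoc, comp_whiskerRight, h₁, ← BraidedCategory.braiding_naturality_right_assoc,
    SymmetricCategory.symmetry_assoc]

/-- The nine lemma for determinant functors. -/
theorem PreDet.IsDet.nine [IsTriangulated T] (hD : D.IsDet) {N : NineDiagram T}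
    (hf' : Triangle.mk N.f' N.g' N.h' ∈ distTriang T)
    (hf : Triangle.mk N.f N.g N.h ∈ distTriang T)
    (hf'' : Triangle.mk N.f'' N.g'' N.h'' ∈ distTriang T)
    (hp : Triangle.mk N.p' N.p N.p'' ∈ distTriang T)
    (hq : Triangle.mk N.q' N.q N.q'' ∈ distTriang T)
    (hr : Triangle.mk N.r' N.r N.r'' ∈ distTriang T) (hN : N.HasVerdierStructure) :
    (D.addMk hf'' ⊗ₘ D.addMk hf') ≫ D.addMk hq =
      tensorμ (D.obj N.z'') (D.obj N.x'') (D.obj N.z') (D.obj N.x') ≫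
        (D.addMk hr ⊗ₘ D.addMk hp) ≫ D.addMk hf := by
  obtain ⟨A, α, v, _, _, _, _, _, hA, hsq, O₁, O₂, hεγ, hγ, O₃, e₁, e₂, e₃⟩ := hN
  have h₁ := hD.octahedron O₁
  have h₂ := hD.octahedron O₂
  have h₃ := hD.octahedron O₃
  have h₃' := hD.octahedron (fstOctahedron N.z' hf'')
  -- `O₁` and `O₂` share the triangle with third vertex `A`, which removes the corner `x'`.
  refine tensorμ_of_permute h₁ h₂ ?_
  -- `O₃` is compared with the split octahedron on `x'' ⟶ y'' ⊞ z' ⟶ y''`. The model identity is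
  -- `add_sum`, the cancelled object `D (Σz')`; the two remaining goals are instances of the
  -- rotation principle.
  refine permute_cancel h₃ h₃' ?_ ?_ (hD.add_sum N.z' hf'')
  · have hr' : Triangle.mk N.r N.r'' (-N.r'⟦(1 : ℤ)⟧') ∈ distTriang T := rotate_mk hr
    -- The condition `β ≫ η = r'` shows that the new triangle of `O₃` is the rotation of the third
    -- column.
    have e : (-O₂.m₁⟦(1 : ℤ)⟧') ≫ O₁.m₃⟦(1 : ℤ)⟧' = -N.r'⟦(1 : ℤ)⟧' := by
      rw [Preadditive.neg_comp, ← Functor.map_comp, e₃]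
    have e' : (-(biprod.inr : N.z' ⟶ N.y'' ⊞ N.z')⟦(1 : ℤ)⟧') ≫
        (shiftFunctor T (1 : ℤ)).map (biprod.map N.g'' (𝟙 N.z')) =
          -(biprod.inr : N.z' ⟶ N.z'' ⊞ N.z')⟦(1 : ℤ)⟧' := by
      rw [Preadditive.neg_comp, ← Functor.map_comp]
      simp
    have a₁ : D.add _ O₃.mem = D.addMk hr' := D.add_congr e₁ e₂ e _ _
    have a₂ : D.add _ (fstOctahedron N.z' hf'').mem =
        D.addMk (rotate_mk (biproductTriangle'_distinguished N.z'' N.z')) :=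
      D.add_congr rfl rfl e' _ _
    exact (congr_arg (_ ≫ ·) a₁).trans ((hD.add_rotate hr hr' _ _).trans
      (congr_arg (_ ≫ ·) a₂).symm)
  · exact hD.add_rotate O₂.mem hγ _ _

end Verdier

/-! ### Composition of determinant functors with triangulated functors -/

section

variable {C : Type u} [Category.{v} C] [Preadditive C] [HasBinaryBiproducts C]
  {T : Type u₀} [Category.{v₀} T] [Preadditive T]
  (G : C ⥤ T) [G.Additive] (x y : C) [PreservesBinaryBiproduct x y G]

lemma map_inl_mapBiprod :
    G.map biprod.inl ≫ (G.mapBiprod x y).hom = 𝟙 (G.obj x) ≫ biprod.inl := by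
  rw [Functor.mapBiprod_hom, Category.id_comp]
  apply biprod.hom_ext <;> simp [← G.map_comp]

lemma map_inr_mapBiprod :
    G.map biprod.inr ≫ (G.mapBiprod x y).hom = 𝟙 (G.obj y) ≫ biprod.inr := by
  rw [Functor.mapBiprod_hom, Category.id_comp]
  apply biprod.hom_ext <;> simp [← G.map_comp]

lemma map_fst_mapBiprod :
    G.map biprod.fst ≫ 𝟙 (G.obj x) = (G.mapBiprod x y).hom ≫ biprod.fst := by
  rw [Functor.mapBiprod_hom, Category.comp_id, biprod.lift_fst]

lemma map_snd_mapBiprod :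
    G.map biprod.snd ≫ 𝟙 (G.obj y) = (G.mapBiprod x y).hom ≫ biprod.snd := by
  rw [Functor.mapBiprod_hom, Category.comp_id, biprod.lift_snd]

end

section Comp

variable {C : Type u} [Category.{v} C] [HasZeroObject C] [Preadditive C] [HasShift C ℤ]
  [∀ k : ℤ, (shiftFunctor C k).Additive] [Pretriangulated C]
  {T : Type u₀} [Category.{v₀} T] [HasZeroObject T] [Preadditive T] [HasShift T ℤ]
  [∀ k : ℤ, (shiftFunctor T k).Additive] [Pretriangulated T]
  {P : Type w} [Category.{w} P] [MonoidalCategory P]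

/-- The composite of a determinant functor and a triangulated functor. -/
def PreDet.compTriangulated (D : PreDet T P) (G : C ⥤ T) [G.CommShift ℤ] [G.IsTriangulated] :
    PreDet C P where
  toFunctor := G.core ⋙ D.toFunctor
  add Δ hΔ := D.add (G.mapTriangle.obj Δ) (G.map_distinguished Δ hΔ)

variable [SymmetricCategory P] {D : PreDet T P}

lemma PreDet.IsDet.natural_mk_refl (hD : D.IsDet) {x y y' z : T} {f : x ⟶ y}
    {g : y ⟶ z} {h : z ⟶ x⟦(1 : ℤ)⟧} {f' : x ⟶ y'} {g' : y' ⟶ z} {h' : z ⟶ x⟦(1 : ℤ)⟧}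
    (mem : Triangle.mk f g h ∈ distTriang T) (mem' : Triangle.mk f' g' h' ∈ distTriang T)
    (e : y ≅ y') (c₁ : f ≫ e.hom = 𝟙 x ≫ f') (c₂ : g ≫ 𝟙 z = e.hom ≫ g')
    (c₃ : h ≫ (𝟙 x)⟦(1 : ℤ)⟧' = 𝟙 z ≫ h') : D.add _ mem ≫ D.map e = D.add _ mem' := by
  have H := hD.natural_mk mem mem' (Iso.refl _) e (Iso.refl _) c₁ c₂ c₃
  rw [D.map_refl, D.map_refl, id_tensorHom_id] at H
  exact H.trans (Category.id_comp _)

/-- A triangulated functor preserves isomorphisms of triangles, split triangles (up to `mapBiprod`)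
and octahedra, so each axiom for the composite is an instance of the axiom for `D`. -/
lemma PreDet.IsDet.compTriangulated (hD : D.IsDet) (G : C ⥤ T) [G.CommShift ℤ]
    [G.IsTriangulated] : (D.compTriangulated G).IsDet where
  natural hΔ hΔ' e := by
    exact hD.natural (G.map_distinguished _ hΔ) (G.map_distinguished _ hΔ') (G.mapTriangle.mapIso e)
  commutativity x y := by
    have := preservesBinaryBiproducts_of_preservesBinaryProducts G
    have h₁ := hD.natural_mk_refl (G.map_distinguished _ (biproductTriangle'_distinguished x y))
      (biproductTriangle'_distinguished (G.obj x) (G.obj y)) (G.mapBiprod x y)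
      (map_inr_mapBiprod G x y) (map_fst_mapBiprod G x y)
      (show (G.map 0 ≫ (G.commShiftIso (1 : ℤ)).hom.app y) ≫ (shiftFunctor T (1 : ℤ)).map (𝟙 _) =
        𝟙 _ ≫ 0 by simp)
    have h₂ := hD.natural_mk_refl (G.map_distinguished _ (binaryBiproductTriangle_distinguished x y))
      (binaryBiproductTriangle_distinguished (G.obj x) (G.obj y)) (G.mapBiprod x y)
      (map_inl_mapBiprod G x y) (map_snd_mapBiprod G x y)
      (show (G.map 0 ≫ (G.commShiftIso (1 : ℤ)).hom.app x) ≫ (shiftFunctor T (1 : ℤ)).map (𝟙 _) =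
        𝟙 _ ≫ 0 by simp)
    refine (cancel_mono (D.map (G.mapBiprod x y))).1 ?_
    exact (h₁.trans (hD.commutativity (G.obj x) (G.obj y))).trans
      ((congr_arg _ h₂.symm).trans (Category.assoc _ _ _).symm)
  octahedron {x y z z' x' y' u₁₂ u₂₃ u₁₃ comm v₁₂ w₁₂ h₁₂ v₂₃ w₂₃ h₂₃ v₁₃ w₁₃ h₁₃} O := by
    refine Eq.trans ?_ (hD.octahedron (O.map G))
    -- The third morphism of the image of the new triangle, in the form expected by the image
    -- octahedron.
    have e : G.map (w₂₃ ≫ v₁₂⟦(1 : ℤ)⟧') ≫ (G.commShiftIso (1 : ℤ)).hom.app z' =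
        (G.map w₂₃ ≫ (G.commShiftIso (1 : ℤ)).hom.app y) ≫ (G.map v₁₂)⟦(1 : ℤ)⟧' := by
      simp
    exact congr_arg (· ▷ _ ≫ _) (D.add_congr rfl rfl e _ _)

/-- An isomorphism compatible with shifts induces isomorphisms of image triangles, to which
naturality of `D` applies. -/
lemma PreDet.IsDet.isHom_of_commShift (hD : D.IsDet) {G G' : C ⥤ T} [G.CommShift ℤ]
    [G.IsTriangulated] [G'.CommShift ℤ] [G'.IsTriangulated] (e : G ≅ G')
    (he : NatTrans.CommShift e.hom ℤ) :
    PreDet.IsHom (D := D.compTriangulated G) (D' := D.compTriangulated G')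
      (Functor.whiskerRight e.core.hom D.toFunctor) := fun Δ hΔ => by
  exact hD.natural (G.map_distinguished _ hΔ) (G'.map_distinguished _ hΔ)
    ((Functor.mapTriangleIso e).app Δ)

end Comp

section Multi

variable {n : ℕ} {T : Fin n → Type u} [∀ i, Category.{v} (T i)] [∀ i, HasZeroObject (T i)]
  [∀ i, Preadditive (T i)] [∀ i, HasShift (T i) ℤ]
  [∀ i, ∀ k : ℤ, (shiftFunctor (T i) k).Additive] [∀ i, Pretriangulated (T i)]
  {S : Type u₀} [Category.{v₀} S] [HasZeroObject S] [Preadditive S] [HasShift S ℤ]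
  [∀ k : ℤ, (shiftFunctor S k).Additive] [Pretriangulated S]
  {P : Type w} [Category.{w} P] [MonoidalCategory P] [SymmetricCategory P]

omit [SymmetricCategory P] in
lemma PreMultiDet.IsHom.comp {E₁ E₂ E₃ : PreMultiDet T P} {τ : E₁.toFunctor ⟶ E₂.toFunctor}
    {τ' : E₂.toFunctor ⟶ E₃.toFunctor} (h : PreMultiDet.IsHom τ) (h' : PreMultiDet.IsHom τ') :
    PreMultiDet.IsHom (τ ≫ τ') := fun a i Δ hΔ => by
  have e : E₁.add a i Δ hΔ ≫ τ.app _ = (τ.app _ ⊗ₘ τ.app _) ≫ E₂.add a i Δ hΔ := h a i Δ hΔ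
  have e' : E₂.add a i Δ hΔ ≫ τ'.app _ = (τ'.app _ ⊗ₘ τ'.app _) ≫ E₃.add a i Δ hΔ := h' a i Δ hΔ
  have : E₁.add a i Δ hΔ ≫ τ.app _ ≫ τ'.app _ =
      ((τ.app _ ≫ τ'.app _) ⊗ₘ (τ.app _ ≫ τ'.app _)) ≫ E₃.add a i Δ hΔ := by
    rw [reassoc_of% e, e', tensorHom_comp_tensorHom_assoc]
  exact this

lemma DetFunctor.isHom_whisker (D : DetFunctor S P) {F G : MultiexactFunctor T S}
    {α : F.toFunctor ≅ G.toFunctor} (hα : MultiexactFunctor.IsExactTrans α.hom) :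
    PreMultiDet.IsHom (D.whisker α) := fun a i =>
  D.isDet.isHom_of_commShift (G := slot a i ⋙ F.toFunctor) (G' := slot a i ⋙ G.toFunctor)
    (Functor.isoWhiskerLeft (slot a i) α) (hα a i)

end Multi

/-! ### Composition of determinant functors with multiexact functors -/

/-- The isomorphisms `w` identify the nine objects in one order of the variables with those in the
other. Inside the composites they cancel against the `w'`, and the involution `tensorμ` transposes
the grid. -/
lemma tensorμ_conj {P : Type w} [Category.{w} P] [MonoidalCategory P] [SymmetricCategory P]
    {a₁₁ a₁₂ a₁₃ a₂₁ a₂₂ a₂₃ a₃₁ a₃₂ a₃₃ b₁₁ b₁₂ b₁₃ b₂₁ b₂₂ b₂₃ b₃₁ b₃₂ b₃₃ : P}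
    (w₁₁ : a₁₁ ⟶ b₁₁) (w₁₂ : a₁₂ ⟶ b₁₂) (w₁₃ : a₁₃ ⟶ b₁₃) (w₂₁ : a₂₁ ⟶ b₂₁)
    (w₂₃ : a₂₃ ⟶ b₂₃) (w₃₁ : a₃₁ ⟶ b₃₁) (w₃₂ : a₃₂ ⟶ b₃₂)
    (w₃₃ : a₃₃ ⟶ b₃₃) (w₂₂' : b₂₂ ⟶ a₂₂) (w₁₂' : b₁₂ ⟶ a₁₂) (w₃₂' : b₃₂ ⟶ a₃₂)
    (w₂₁' : b₂₁ ⟶ a₂₁) (w₂₃' : b₂₃ ⟶ a₂₃) (h₁₂ : w₁₂' ≫ w₁₂ = 𝟙 _) (h₃₂ : w₃₂' ≫ w₃₂ = 𝟙 _)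
    (h₂₁ : w₂₁' ≫ w₂₁ = 𝟙 _) (h₂₃ : w₂₃' ≫ w₂₃ = 𝟙 _)
    {r₁ : b₃₁ ⊗ b₁₁ ⟶ b₂₁} {r₂ : b₃₂ ⊗ b₁₂ ⟶ b₂₂} {r₃ : b₃₃ ⊗ b₁₃ ⟶ b₂₃}
    {c₁ : b₁₃ ⊗ b₁₁ ⟶ b₁₂} {c₂ : b₂₃ ⊗ b₂₁ ⟶ b₂₂} {c₃ : b₃₃ ⊗ b₃₁ ⟶ b₃₂}
    (h : (c₃ ⊗ₘ c₁) ≫ r₂ = tensorμ b₃₃ b₃₁ b₁₃ b₁₁ ≫ (r₃ ⊗ₘ r₁) ≫ c₂) :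
    (((w₃₃ ⊗ₘ w₁₃) ≫ r₃ ≫ w₂₃') ⊗ₘ ((w₃₁ ⊗ₘ w₁₁) ≫ r₁ ≫ w₂₁')) ≫ (w₂₃ ⊗ₘ w₂₁) ≫ c₂ ≫ w₂₂' =
      tensorμ a₃₃ a₁₃ a₃₁ a₁₁ ≫ (((w₃₃ ⊗ₘ w₃₁) ≫ c₃ ≫ w₃₂') ⊗ₘ ((w₁₃ ⊗ₘ w₁₁) ≫ c₁ ≫ w₁₂')) ≫
        (w₃₂ ⊗ₘ w₁₂) ≫ r₂ ≫ w₂₂' := by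
  have h' : (r₃ ⊗ₘ r₁) ≫ c₂ = tensorμ b₃₃ b₁₃ b₃₁ b₁₁ ≫ (c₃ ⊗ₘ c₁) ≫ r₂ := by
    rw [h, reassoc_of% (tensorμ_tensorμ b₃₃ b₁₃ b₃₁ b₁₁)]
  have e₁ : (((w₃₃ ⊗ₘ w₁₃) ≫ r₃ ≫ w₂₃') ⊗ₘ ((w₃₁ ⊗ₘ w₁₁) ≫ r₁ ≫ w₂₁')) ≫ (w₂₃ ⊗ₘ w₂₁) =
      ((w₃₃ ⊗ₘ w₁₃) ⊗ₘ (w₃₁ ⊗ₘ w₁₁)) ≫ (r₃ ⊗ₘ r₁) := by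
    simp only [tensorHom_comp_tensorHom, Category.assoc, h₂₃, h₂₁, Category.comp_id]
  have e₂ : (((w₃₃ ⊗ₘ w₃₁) ≫ c₃ ≫ w₃₂') ⊗ₘ ((w₁₃ ⊗ₘ w₁₁) ≫ c₁ ≫ w₁₂')) ≫ (w₃₂ ⊗ₘ w₁₂) =
      ((w₃₃ ⊗ₘ w₃₁) ⊗ₘ (w₁₃ ⊗ₘ w₁₁)) ≫ (c₃ ⊗ₘ c₁) := by
    simp only [tensorHom_comp_tensorHom, Category.assoc, h₃₂, h₁₂, Category.comp_id]
  rw [reassoc_of% e₁, reassoc_of% e₂, reassoc_of% h', ← tensorμ_natural_assoc]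

lemma swap_hom_swap_hom {n : ℕ} {C : Fin n → Type u} [∀ i, Category.{v} (C i)] {i j : Fin n}
    (hij : i ≠ j) (a : ∀ k, C k) (x : C i) (y : C j) :
    (swap hij a x y).hom ≫ (swap hij.symm a y x).hom = 𝟙 _ := by
  simp [swap]

lemma updHom_swap {n : ℕ} {C : Fin n → Type u} [∀ i, Category.{v} (C i)] {i j : Fin n}
    (hij : i ≠ j) (a : ∀ k, C k) {x x' : C i} (f : x ⟶ x') (y : C j) :
    updHom j (fun k _ => updHom i (fun l _ => 𝟙 (a l)) f k) (𝟙 y) ≫ (swap hij a x' y).hom =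
      (swap hij a x y).hom ≫ updHom i (fun k _ => 𝟙 (Function.update a j y k)) f := by
  refine pi_hom_ext j ?_ (fun k hj => ?_)
  · simp [updHom_self, updHom_of_ne _ _ _ hij.symm, swap, pi_eqToHom_apply]
  · by_cases hi : k = i
    · subst hi
      simp [updHom_self, updHom_of_ne _ _ _ hj, swap, pi_eqToHom_apply]
    · simp [updHom_of_ne _ _ _ hi, updHom_of_ne _ _ _ hj, swap, pi_eqToHom_apply]

section

variable {n : ℕ} {T : Fin n → Type u} [∀ i, Category.{v} (T i)] [∀ i, HasZeroObject (T i)]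
  [∀ i, Preadditive (T i)] [∀ i, HasShift (T i) ℤ]
  [∀ i, ∀ k : ℤ, (shiftFunctor (T i) k).Additive] [∀ i, Pretriangulated (T i)]
  {P : Type w} [Category.{w} P] [MonoidalCategory P] [SymmetricCategory P]

/-- The relation for two triangles is symmetric in the two variables. -/
lemma PreMultiDet.twoTriangles_symm (E : PreMultiDet T P) {i j : Fin n} (hij : i ≠ j)
    (a : ∀ k, T k) {Δ : Triangle (T i)} (hΔ : Δ ∈ distTriang (T i)) {Δ' : Triangle (T j)}
    (hΔ' : Δ' ∈ distTriang (T j))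
    (h : (E.addFst hij.symm a Δ' hΔ' Δ.obj₃ ⊗ₘ E.addFst hij.symm a Δ' hΔ' Δ.obj₁) ≫
        E.addSnd j i a Δ'.obj₂ Δ hΔ =
      tensorμ (E.obj₂ a j i Δ'.obj₃ Δ.obj₃) (E.obj₂ a j i Δ'.obj₁ Δ.obj₃)
          (E.obj₂ a j i Δ'.obj₃ Δ.obj₁) (E.obj₂ a j i Δ'.obj₁ Δ.obj₁) ≫
        (E.addSnd j i a Δ'.obj₃ Δ hΔ ⊗ₘ E.addSnd j i a Δ'.obj₁ Δ hΔ) ≫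
        E.addFst hij.symm a Δ' hΔ' Δ.obj₂) :
    (E.addFst hij a Δ hΔ Δ'.obj₃ ⊗ₘ E.addFst hij a Δ hΔ Δ'.obj₁) ≫
        E.addSnd i j a Δ.obj₂ Δ' hΔ' =
      tensorμ (E.obj₂ a i j Δ.obj₃ Δ'.obj₃) (E.obj₂ a i j Δ.obj₁ Δ'.obj₃)
          (E.obj₂ a i j Δ.obj₃ Δ'.obj₁) (E.obj₂ a i j Δ.obj₁ Δ'.obj₁) ≫
        (E.addSnd i j a Δ.obj₃ Δ' hΔ' ⊗ₘ E.addSnd i j a Δ.obj₁ Δ' hΔ') ≫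
        E.addFst hij a Δ hΔ Δ'.obj₂ := by
  let W (x : T i) (y : T j) : E.obj₂ a i j x y ⟶ E.obj₂ a j i y x :=
    E.toFunctor.map (CoreHom.mk (swap hij a x y))
  let W' (x : T i) (y : T j) : E.obj₂ a j i y x ⟶ E.obj₂ a i j x y :=
    E.toFunctor.map (CoreHom.mk (swap hij.symm a y x))
  have hW (x : T i) (y : T j) : W x y ≫ W' x y = 𝟙 _ := by
    refine (E.toFunctor.map_comp _ _).symm.trans (Eq.trans ?_ (E.toFunctor.map_id _))
    exact congr_arg E.toFunctor.map (coreHom_ext (swap_hom_swap_hom hij a x y))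
  have hW' (x : T i) (y : T j) : W' x y ≫ W x y = 𝟙 _ := by
    refine (E.toFunctor.map_comp _ _).symm.trans (Eq.trans ?_ (E.toFunctor.map_id _))
    exact congr_arg E.toFunctor.map (coreHom_ext (swap_hom_swap_hom hij.symm a y x))
  -- Swapping the variables exchanges `addFst` and `addSnd` up to conjugation by `W`.
  have hs (x : T i) : E.addSnd i j a x Δ' hΔ' =
      (W x Δ'.obj₃ ⊗ₘ W x Δ'.obj₁) ≫ E.addFst hij.symm a Δ' hΔ' x ≫ W' x Δ'.obj₂ := by
    have e : E.addFst hij.symm a Δ' hΔ' x =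
      (W' x Δ'.obj₃ ⊗ₘ W' x Δ'.obj₁) ≫ E.addSnd i j a x Δ' hΔ' ≫ W x Δ'.obj₂ := rfl
    rw [e]
    simp only [Category.assoc, hW, tensorHom_comp_tensorHom_assoc]
    simp
  have hf (y : T j) : E.addFst hij a Δ hΔ y =
      (W Δ.obj₃ y ⊗ₘ W Δ.obj₁ y) ≫ E.addSnd j i a y Δ hΔ ≫ W' Δ.obj₂ y := rfl
  rw [hs, hs, hs, hf, hf, hf]
  exact tensorμ_conj _ _ _ _ _ _ _ _ _ _ _ _ _ (hW' _ _) (hW' _ _) (hW' _ _) (hW' _ _) h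

variable {S : Type u₀} [Category.{v₀} S] [HasZeroObject S] [Preadditive S] [HasShift S ℤ]
  [∀ k : ℤ, (shiftFunctor S k).Additive] [Pretriangulated S]

lemma PreMultiexact.mapFst_swap (F : PreMultiexact T S) {i j : Fin n} (hij : i ≠ j)
    (a : ∀ k, T k) {x x' : T i} (f : x ⟶ x') (y : T j) :
    F.mapFst a i j f y ≫ F.toFunctor.map (swap hij a x' y).hom =
      F.toFunctor.map (swap hij a x y).hom ≫
        (slot (Function.update a j y) i ⋙ F.toFunctor).map f :=
  (F.toFunctor.map_comp _ _).symm.trans ((congr_arg _ (updHom_swap hij a f y)).trans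
    (F.toFunctor.map_comp _ _))

lemma comp_map_inv_comp_map {A A' B : S} {C C' : S} (e : C ≅ C') (m : A ⟶ B) (k : A' ⟶ A)
    (l : B ⟶ C'⟦(1 : ℤ)⟧) :
    (k ≫ m ≫ l ≫ e.inv⟦(1 : ℤ)⟧') ≫ e.hom⟦(1 : ℤ)⟧' = (k ≫ m) ≫ l := by
  simp [← Functor.map_comp]

lemma PreMultiexact.triangleFst_mor₃_swap (F : PreMultiexact T S) {i j : Fin n} (hij : i ≠ j)
    (a : ∀ k, T k) (Δ : Triangle (T i)) (y : T j) :
    (F.triangleFst hij a Δ y).mor₃ ≫ (F.toFunctor.map (swap hij a Δ.obj₁ y).hom)⟦(1 : ℤ)⟧' =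
      F.toFunctor.map (swap hij a Δ.obj₃ y).hom ≫
        ((slot (Function.update a j y) i ⋙ F.toFunctor).mapTriangle.obj Δ).mor₃ :=
  (comp_map_inv_comp_map (F.toFunctor.mapIso (swap hij a Δ.obj₁ y)) _ _ _).trans
    ((congr_arg (· ≫ _) (F.mapFst_swap hij a Δ.mor₃ y)).trans (Category.assoc _ _ _))

/-- The comparison of the two images of a triangle in the `i`-th variable. -/
def PreMultiexact.triangleFstIso (F : PreMultiexact T S) {i j : Fin n} (hij : i ≠ j)
    (a : ∀ k, T k) (Δ : Triangle (T i)) (y : T j) :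
    F.triangleFst hij a Δ y ≅
      (slot (Function.update a j y) i ⋙ F.toFunctor).mapTriangle.obj Δ :=
  Triangle.isoMk _ _ (F.toFunctor.mapIso (swap hij a Δ.obj₁ y))
    (F.toFunctor.mapIso (swap hij a Δ.obj₂ y)) (F.toFunctor.mapIso (swap hij a Δ.obj₃ y))
    (F.mapFst_swap hij a Δ.mor₁ y) (F.mapFst_swap hij a Δ.mor₂ y)
    (F.triangleFst_mor₃_swap hij a Δ y)

lemma PreMultiexact.triangleFst_distinguished (F : PreMultiexact T S) {i j : Fin n} (hij : i ≠ j)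
    (a : ∀ k, T k) {Δ : Triangle (T i)} (hΔ : Δ ∈ distTriang (T i)) (y : T j) :
    F.triangleFst hij a Δ y ∈ distTriang S :=
  isomorphic_distinguished _ ((slot (Function.update a j y) i ⋙ F.toFunctor).map_distinguished Δ hΔ)
    _ (F.triangleFstIso hij a Δ y)

omit [MonoidalCategory P] [SymmetricCategory P] in
lemma comp_comp_cancel {A B C C' : P} (k : A ⟶ B) (l : B ⟶ C) {m : C ⟶ C'} {m' : C' ⟶ C}
    (h : m ≫ m' = 𝟙 _) : (k ≫ l ≫ m) ≫ m' = k ≫ l := by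
  simp [h]

/-- The swaps in `addFst` are the components of the isomorphism `triangleFstIso` between the two
images of the triangle; naturality of `D` removes them. -/
lemma compMultiexact_addFst (D : DetFunctor S P) (F : MultiexactFunctor T S) {i j : Fin n}
    (hij : i ≠ j) (a : ∀ k, T k) {Δ : Triangle (T i)} (hΔ : Δ ∈ distTriang (T i)) (y : T j) :
    (D.compMultiexact F).addFst hij a Δ hΔ y =
      D.add _ (F.triangleFst_distinguished hij a hΔ y) := by
  have h := D.isDet.natural (F.triangleFst_distinguished hij a hΔ y)
    ((slot (Function.update a j y) i ⋙ F.toFunctor).map_distinguished Δ hΔ)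
    (F.triangleFstIso hij a Δ y)
  refine (cancel_mono (D.map (Triangle.π₂.mapIso (F.triangleFstIso hij a Δ y)))).1
    (Eq.trans ?_ h.symm)
  have e : (D.compMultiexact F).toFunctor.map (CoreHom.mk (X := ⟨_⟩) (Y := ⟨_⟩)
      (swap hij a Δ.obj₂ y).symm) ≫ D.map (x := F.toFunctor.obj _) (y := F.toFunctor.obj _)
        (F.toFunctor.mapIso (swap hij a Δ.obj₂ y)) = 𝟙 _ := by
    refine (D.toFunctor.map_comp _ _).symm.trans (Eq.trans ?_ (D.toFunctor.map_id _))
    exact congr_arg D.toFunctor.map (coreHom_ext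
      (F.toFunctor.mapIso (swap hij a Δ.obj₂ y)).inv_hom_id)
  exact comp_comp_cancel _ _ e

/-- In each variable `F` is triangulated, with shift isomorphisms natural in the others; this gives
all conditions but the one on two triangles, which is the nine lemma for the induced diagram. -/
theorem DetFunctor.isMultiDet_compMultiexact [IsTriangulated S] [PicardGroupoid P]
    (D : DetFunctor S P) {F : MultiexactFunctor T S} (hF : F.AdmitsVerdierStructure) :
    (D.compMultiexact F).IsMultiDet where
  isDet a i := D.isDet.compTriangulated (slot a i ⋙ F.toFunctor)
  triangleFunction {a b} j φ :=
    D.isDet.isHom_of_commShift (Functor.isoWhiskerRight (slotIso j φ) F.toFunctor)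
      (F.natural j fun k h => (φ k h).hom)
  twoTriangles := by
    have key {i j : Fin n} (hij : i < j) (a : ∀ k, T k) (Δ : Triangle (T i))
        (hΔ : Δ ∈ distTriang (T i)) (Δ' : Triangle (T j)) (hΔ' : Δ' ∈ distTriang (T j)) :=
      D.isDet.nine (N := F.nineDiagram hij.ne a Δ Δ')
        (F.triangleFst_distinguished hij.ne a hΔ Δ'.obj₁)
        (F.triangleFst_distinguished hij.ne a hΔ Δ'.obj₂)
        (F.triangleFst_distinguished hij.ne a hΔ Δ'.obj₃)
        ((slot (Function.update a i Δ.obj₁) j ⋙ F.toFunctor).map_distinguished Δ' hΔ')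
        ((slot (Function.update a i Δ.obj₂) j ⋙ F.toFunctor).map_distinguished Δ' hΔ')
        ((slot (Function.update a i Δ.obj₃) j ⋙ F.toFunctor).map_distinguished Δ' hΔ')
        (hF hij a Δ hΔ Δ' hΔ')
    intro i j hij a Δ hΔ Δ' hΔ'
    rcases lt_or_gt_of_ne hij with h | h
    · rw [compMultiexact_addFst, compMultiexact_addFst, compMultiexact_addFst]
      exact key h a Δ hΔ Δ' hΔ'
    -- Verdier structures are given only for `i < j`; the symmetry of the relation covers the other
    -- order.
    · refine PreMultiDet.twoTriangles_symm _ hij a hΔ hΔ' ?_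
      rw [compMultiexact_addFst, compMultiexact_addFst, compMultiexact_addFst]
      exact key h a Δ' hΔ' Δ hΔ

end

end MultiDeterminant

end

theorem mainTheorem8 {n : ℕ}
    (T : Fin n → Type u) [∀ i, Category.{v} (T i)] [∀ i, HasZeroObject (T i)]
    [∀ i, Preadditive (T i)] [∀ i, HasShift (T i) ℤ]
    [∀ i, ∀ k : ℤ, (shiftFunctor (T i) k).Additive] [∀ i, Pretriangulated (T i)]
    [∀ i, IsTriangulated (T i)]
    (T₀ : Type u₀) [Category.{v₀} T₀] [HasZeroObject T₀] [Preadditive T₀] [HasShift T₀ ℤ]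
    [∀ k : ℤ, (shiftFunctor T₀ k).Additive] [Pretriangulated T₀] [IsTriangulated T₀]
    (V : Fin n → Type w) [∀ i, Category.{w} (V i)] [∀ i, MonoidalCategory (V i)]
    [∀ i, SymmetricCategory (V i)] [∀ i, PicardGroupoid (V i)]
    (det : ∀ i, DetFunctor (T i) (V i)) (hdet : ∀ i, (det i).IsUniversal)
    (P : Type w) [Category.{w} P] [MonoidalCategory P] [SymmetricCategory P]
    [PicardGroupoid P]
    (D : DetFunctor T₀ P) (F₁ F₂ : MultiexactFunctor T T₀)
    (hF₁ : F₁.AdmitsVerdierStructure) (hF₂ : F₂.AdmitsVerdierStructure)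
    (α : F₁.toFunctor ≅ F₂.toFunctor) (hα : MultiexactFunctor.IsExactTrans α.hom) :
    (D.compMultiexact F₁).IsMultiDet ∧ (D.compMultiexact F₂).IsMultiDet ∧
    PreMultiDet.IsHom (D.whisker α) ∧
    (∃ c₁ : InducedPair det (D.compMultiexact F₁), c₁.IsUniversal) ∧
    (∃ c₂ : InducedPair det (D.compMultiexact F₂), c₂.IsUniversal) ∧
    ∀ (c₁ : InducedPair det (D.compMultiexact F₁))
      (c₂ : InducedPair det (D.compMultiexact F₂)),
      ∃! β : c₂.functor.toFunctor ⟶ c₁.functor.toFunctor,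
        MultiexactPic.IsMonoidal (F := c₂.functor) (G := c₁.functor) β ∧
        Functor.whiskerLeft (prodDet det) β ≫ c₁.trans ≫ D.whisker α = c₂.trans := by
  have hE₁ : (D.compMultiexact F₁).IsMultiDet := D.isMultiDet_compMultiexact hF₁
  have hE₂ : (D.compMultiexact F₂).IsMultiDet := D.isMultiDet_compMultiexact hF₂
  have hD : PreMultiDet.IsHom (D.whisker α) := D.isHom_whisker hα
  obtain ⟨c₁⟩ := nonempty_inducedPair hdet hE₁
  obtain ⟨c₂⟩ := nonempty_inducedPair hdet hE₂
  refine ⟨hE₁, hE₂, hD, ⟨c₁, existsUnique_inducedPair_hom hdet hE₁ c₁⟩,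
    ⟨c₂, existsUnique_inducedPair_hom hdet hE₂ c₂⟩, fun c₁ c₂ => ?_⟩
  -- Composing with `D * α` makes a pair over `D ∘ F₁` into a pair over `D ∘ F₂` with the same
  -- multiexact functor.
  exact existsUnique_inducedPair_hom hdet hE₂ c₂ ⟨c₁.functor, c₁.trans ≫ D.whisker α,
    c₁.isHom.comp hD⟩
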